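/- **Setting.** For each $n$ let $K=K_n$ be an integer and $P=P_n$, $Q=Q_n$ probability measures on $\mathbb R$. In the single community model, $C^*$ is uniformly distributed among the subsets of $[n]$ of cardinality $K$, and, given $C^*$, $A$ is a random symmetric $n\times n$ matrix with zero diagonal whose entries $A_{ij}$, $i<j$, are mutually independent with $A_{ij}\sim P$ if $i,j\in C^*$ and $A_{ij}\sim Q$ otherwise. Let $\xi^*\in\{0,1\}^n$ be the indicator vector of $C^*$ and let $d_H$ be the Hamming distance. Almost exact (respectively exact) recovery is *information-theoretically possible* if there are measurable estimators $\hat\xi=\hat\xi_n(A)\in\{0,1\}^n$, which may depend on $K,P,Q$, such that, as $n\to\infty$, $d_H(\xi^*,\hat\xi)/K\to0$ in probability (respectively $\mathbb P[\xi^*\ne\hat\xi]\to0$). Write $D(P\|Q)$ for the Kullback–Leibler divergence and $$E_Q(\theta)=\sup_{\lambda\in\mathbb R}\Big\{\lambda\theta-\log\mathbb E_Q\Big[\exp\Big(\lambda\log\frac{dP}{dQ}\Big)\Big]\Big\}\in[0,\infty].$$ Assume that, for all sufficiently large $n$, $K\ge2$ and $K/n\le c$ for some constant $c<1$, and that one of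 the following holds: * (Gaussian case) for all $n$, $P=\mathcal N(\mu,1)$ and $Q=\mathcal N(0,1)$ with $\mu=\mu_n\neq0$; * (Bernoulli case) for all $n$, $P=\mathrm{Bern}(p)$ and $Q=\mathrm{Bern}(q)$ with $p=p_n$, $q=q_n\in(0,1)$, $p\ne q$, and the sequences $\log\frac pq$ and $\log\frac{1-p}{1-q}$ are bounded. **Theorem.** 1. If $$K\cdot D(P\|Q)\to\infty\quad\text{and}\quad\liminf_{n\to\infty}\frac{(K-1)D(P\|Q)}{\log\frac nK}>2,\qquad(1)$$ then almost exact recovery is information-theoretically possible. 2. If, in addition to (1), $$\liminf_{n\to\infty}\frac{K\,E_Q\big(\frac1K\log\frac nK\big)}{\log n}>1,$$ then exact recovery is information-theoretically possible. 3. Conversely, if almost exact recovery is information-theoretically possible, then $$K\cdot D(P\|Q)\to\infty\quad\text{and}\quad\liminf_{n\to\infty}\frac{(K-1)D(P\|Q)}{\log\frac nK}\ge2.\qquad(2)$$ 4. If exact recovery is information-theoretically possible, then (2) holds and, in addition, $$\liminf_{n\to\infty}\frac{K\,E_Q\big(\frac1K\log\frac nK\big)}{\log n}\ge1.$$ (The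 limits inferior are taken in $[-\infty,\infty]$.) -/

import Mathlib

open MeasureTheory ProbabilityTheory Filter Topology

namespace SingleCommunity

noncomputable section

/-- The unordered pairs of distinct elements of `Fin n`, each listed in increasing order. -/
abbrev Pair (n : ℕ) : Type := {e : Fin n × Fin n // e.1 < e.2}

/-- The space of `n × n` real data matrices, with the product σ-algebra. -/
abbrev DataMatrix (n : ℕ) : Type := Fin n → Fin n → ℝ

/-- The symmetric matrix with zero diagonal whose entries above the diagonal are given by `x`. -/
def symmMatrix {n : ℕ} (x : Pair n → ℝ) : DataMatrix n :=
  fun i j =>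
    if h : i < j then x ⟨(i, j), h⟩ else if h : j < i then x ⟨(j, i), h⟩ else 0

/-- The law of the data matrix when the community is `{i | ξ i = true}`: the entries above the
diagonal are independent, with law `P` if both indices are in the community and `Q` otherwise. -/
def dataLaw {n : ℕ} (P Q : Measure ℝ) (ξ : Fin n → Bool) : Measure (DataMatrix n) :=
  (Measure.pi fun e : Pair n => if ξ e.1.1 = true ∧ ξ e.1.2 = true then P else Q).map symmMatrix

/-- The indicator vectors of the subsets of `Fin n` of cardinality `K`. -/
def communities (n K : ℕ) : Finset (Fin n → Bool) :=
  Finset.univ.filter fun ξ => (Finset.univ.filter fun i => ξ i = true).card = K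

/-- The joint law of the true community and of the data matrix: the community is uniform among
those of cardinality `K` and, given the community, the data matrix has law `dataLaw`. -/
def jointLaw (n K : ℕ) (P Q : Measure ℝ) :
    Measure ((Fin n → Bool) × DataMatrix n) :=
  ∑ ξ ∈ communities n K, ((communities n K).card : ENNReal)⁻¹ • (dataLaw P Q ξ).map (Prod.mk ξ)

/-- An estimator for each `n`, as a function of the data matrix. The parameters `K`, `P`, `Q` are
known to the estimator, which is therefore chosen after them. -/
abbrev Estimator : Type := ∀ n : ℕ, DataMatrix n → (Fin n → Bool)

/-- The Hamming distance between the estimate and the truth, divided by `K`, tends to zero in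
probability. -/
def AlmostExactlyRecovers (K : ℕ → ℕ) (P Q : ℕ → Measure ℝ) (est : Estimator) : Prop :=
  ∀ ε : ℝ, 0 < ε →
    Tendsto
      (fun n => jointLaw n (K n) (P n) (Q n)
        {z | ε < (hammingDist z.1 (est n z.2) : ℝ) / (K n : ℝ)})
      atTop (𝓝 0)

/-- The probability that the estimate differs from the truth tends to zero. -/
def ExactlyRecovers (K : ℕ → ℕ) (P Q : ℕ → Measure ℝ) (est : Estimator) : Prop :=
  Tendsto (fun n => jointLaw n (K n) (P n) (Q n) {z | z.1 ≠ est n z.2}) atTop (𝓝 0)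

/-- Almost exact recovery is information-theoretically possible. -/
def AlmostExactRecoveryPossible (K : ℕ → ℕ) (P Q : ℕ → Measure ℝ) : Prop :=
  ∃ est : Estimator, (∀ n, Measurable (est n)) ∧ AlmostExactlyRecovers K P Q est

/-- Exact recovery is information-theoretically possible. -/
def ExactRecoveryPossible (K : ℕ → ℕ) (P Q : ℕ → Measure ℝ) : Prop :=
  ∃ est : Estimator, (∀ n, Measurable (est n)) ∧ ExactlyRecovers K P Q est

/-- The Kullback–Leibler divergence `D(P‖Q)` as a real number (it is used only where it is
finite). -/
def kl (P Q : Measure ℝ) : ℝ := (InformationTheory.klDiv P Q).toReal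

/-- The large deviations exponent `E_Q(θ) = sup_t (t θ - log E_Q[exp (t L)])` with
`L = log (dP/dQ)`, as a value in the extended reals (for Bernoulli laws it is infinite when `θ` is
outside the range of `L`). It is used only where the moment generating function of `L` under `Q`
is finite everywhere. -/
def rateQ (P Q : Measure ℝ) (θ : ℝ) : EReal :=
  ⨆ t : ℝ, ((t * θ - cgf (llr P Q) Q t : ℝ) : EReal)

/-- `P = N(μ, 1)` and `Q = N(0, 1)`, where `μ ≠ 0` may depend on `n`. -/
def GaussianCase (P Q : ℕ → Measure ℝ) : Prop :=
  ∃ μ : ℕ → ℝ, ∀ n, μ n ≠ 0 ∧ P n = gaussianReal (μ n) 1 ∧ Q n = gaussianReal 0 1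

/-- `P = Bern(p)` and `Q = Bern(q)`, where `p ≠ q` in `(0, 1)` may depend on `n`, and
`log (p / q)` and `log ((1 - p) / (1 - q))` are bounded. -/
def BernoulliCase (P Q : ℕ → Measure ℝ) : Prop :=
  ∃ (p q : ℕ → unitInterval) (B : ℝ), ∀ n,
    (0 < p n ∧ p n < 1) ∧ (0 < q n ∧ q n < 1) ∧ p n ≠ q n ∧
    |Real.log ((p n : ℝ) / (q n : ℝ))| ≤ B ∧
    |Real.log ((1 - (p n : ℝ)) / (1 - (q n : ℝ)))| ≤ B ∧
    P n = bernoulliMeasure 1 0 (p n) ∧ Q n = bernoulliMeasure 1 0 (q n)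

/-- The ratio `(K - 1) D(P‖Q) / log (n / K)`. -/
def infoRatio (K : ℕ → ℕ) (P Q : ℕ → Measure ℝ) (n : ℕ) : EReal :=
  (((K n : ℝ) - 1) * kl (P n) (Q n) / Real.log ((n : ℝ) / (K n : ℝ)) : ℝ)

/-- The ratio `K E_Q((1 / K) log (n / K)) / log n`. -/
def votingRatio (K : ℕ → ℕ) (P Q : ℕ → Measure ℝ) (n : ℕ) : EReal :=
  ((K n : ℝ) : EReal) *
    rateQ (P n) (Q n) (1 / (K n : ℝ) * Real.log ((n : ℝ) / (K n : ℝ))) /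
      ((Real.log (n : ℝ) : ℝ) : EReal)

end

end SingleCommunity

open SingleCommunity

namespace SingleCommunity

/-! Write `L = log (dP/dQ)`, `ψ` for its cumulant generating function under `Q` (`logMgf`) and `D =
D(P‖Q)`. Since `P` is the exponential tilt of `Q` at parameter 1, every community law is a product
of tilts of `Q`, and the log-likelihood ratio of two communities is the difference of their scores,
the sums of `L` over the pairs inside them. One has `ψ 0 = ψ 1 = 0` and `ψ' 1 = D`. The Gaussian and
Bernoulli cases enter only through `RegularPair`: near `[0, 1]`, `ψ` exceeds its tangents by at most
`c D u²`, with `c` independent of `n`. Hence all Chernoff exponents are comparable to the number of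
pairs times `D`.

Sufficiency uses maximum likelihood. Let `C'` compete with the truth `C`, let `S = C \ C'`, `T = C'
\ C` and `m = |S| = |T|`; then `C'` loses and gains `N = m (2K - m - 1) / 2` pairs. If `m > ε K`,
either the lost pairs sum to less than `(1 - η) N D`, which is a large deviation counted over `S`
only, or the gained pairs exceed it, with probability at most `exp (-(1 - η) N D)`. As `N ≥ m (K -
1) / 2`, this beats the number of choices of `(S, T)`, of order `(n / K) ^ m` up to `exp (O m)`,
because the information ratio exceeds 2 (`law_real_exists_far_le`). If `m ≤ ε K`, the threshold is
`m log (n / K)`: the lost pairs are bounded by a union over `S`, the pairs between `T` and `C` by a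
union over `T`, and the few pairs inside `T` or between `T` and `S` are a small correction. Both
main terms are governed by `K E_Q`, which exceeds `log n` by a factor (`law_real_exists_near_le`).

Necessity of `K D → ∞`: swapping one member with one outsider changes the likelihood by a bounded
factor with high probability if `K D` is bounded, so a fixed share of such pairs is misclassified
(`le_jointLaw_of_bounded`). Necessity of the ratio 2 is a packing argument: relative to pure noise,
each community law puts mass at least about `exp (-(1 + η) D K (K - 1) / 2)` on the event that the
estimator is close to it, while a matrix is close to few of the at least `(n / K) ^ K` communities
(`mul_log_le_of_recovery`).

Necessity of the voting condition: below the threshold, among many nearly independent vertices there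
is a member of `C` weakly tied to `C` and an outsider strongly tied to it. Exchanging them raises
the score with probability at least 1/2 (`half_le_law_real_swapEvent`), and then no estimator can be
right (`sum_law_swapEvent_le`). -/

/-! ### Exponentially tilted product measures -/

section Tilting

variable {ι : Type*} [Fintype ι]

/-- A product of measures with densities has the product density. -/
lemma pi_withDensity {α : Type*} [MeasurableSpace α] (μ : ι → Measure α)
    [∀ i, IsProbabilityMeasure (μ i)] (g : ι → α → ENNReal) (hg : ∀ i, Measurable (g i))
    (h : ∀ i, IsProbabilityMeasure ((μ i).withDensity (g i))) :
    Measure.pi (fun i => (μ i).withDensity (g i)) =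
      (Measure.pi μ).withDensity (fun x => ∏ i, g i (x i)) := by
  have hσ : ∀ i, SigmaFinite ((μ i).withDensity (g i)) := fun i => inferInstance
  refine Measure.pi_eq (μ := fun i => (μ i).withDensity (g i)) fun s hs => ?_
  rw [withDensity_apply _ (MeasurableSet.univ_pi hs), ← lintegral_indicator
    (MeasurableSet.univ_pi hs)]
  have key : ∀ x : ι → α, (Set.univ.pi s).indicator (fun x => ∏ i, g i (x i)) x =
      ∏ i, (s i).indicator (g i) (x i) := by
    intro x
    by_cases hx : x ∈ Set.univ.pi s
    · rw [Set.indicator_of_mem hx]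
      exact Finset.prod_congr rfl fun i _ => (Set.indicator_of_mem (hx i trivial) _).symm
    · rw [Set.indicator_of_notMem hx]
      simp only [Set.mem_pi, Set.mem_univ, true_implies, not_forall] at hx
      obtain ⟨i, hi⟩ := hx
      exact (Finset.prod_eq_zero (Finset.mem_univ i) (Set.indicator_of_notMem hi _)).symm
  simp_rw [key]
  have hm : ∀ i, Measurable ((s i).indicator (g i)) := fun i => (hg i).indicator (hs i)
  have hind : iIndepFun (fun i (x : ι → α) => (s i).indicator (g i) (x i)) (Measure.pi μ) :=
    iIndepFun_pi fun i => (hm i).aemeasurable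
  rw [lintegral_prod_eq_prod_lintegral_of_indepFun Finset.univ _ hind
    fun i => (hm i).comp (measurable_pi_apply i)]
  refine Finset.prod_congr rfl fun i _ => ?_
  have := (measurePreserving_eval μ i).lintegral_comp (hm i)
  simp only [Function.eval] at this
  rw [this, lintegral_indicator (hs i), withDensity_apply _ (hs i)]

variable {Q : Measure ℝ} {L : ℝ → ℝ}

/-- The product of the exponential tilts of `Q` by `t e * L`. -/
noncomputable def tiltPi (Q : Measure ℝ) (L : ℝ → ℝ) (t : ι → ℝ) : Measure (ι → ℝ) :=
  Measure.pi fun e => Q.tilted fun x => t e * L x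

/-- Tilting by `s` and then by `t - s` is tilting by `t`. The normalising constants are exponentials
of the cumulant generating function, so the density is a single exponential, affine in `L` on the
log scale. -/
lemma tilted_mul_eq_withDensity [IsProbabilityMeasure Q]
    (hint : ∀ t : ℝ, Integrable (fun x => Real.exp (t * L x)) Q) (s t : ℝ) :
    Q.tilted (fun x => t * L x) = (Q.tilted fun x => s * L x).withDensity
      fun x => ENNReal.ofReal (Real.exp ((t - s) * L x - (cgf L Q t - cgf L Q s))) := by
  have h1 := tilted_tilted (hint s) (fun x => (t - s) * L x)
  have h2 : ((fun x => s * L x) + fun x => (t - s) * L x) = fun x => t * L x := by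
    ext x; simp only [Pi.add_apply]; ring
  rw [h2] at h1
  rw [← h1, Measure.tilted]
  congr 1
  ext x
  rw [integral_exp_tilted, h2]
  have e1 : ∫ x, Real.exp (t * L x) ∂Q = Real.exp (cgf L Q t) := (exp_cgf (hint t)).symm
  have e2 : ∫ x, Real.exp (s * L x) ∂Q = Real.exp (cgf L Q s) := (exp_cgf (hint s)).symm
  rw [e1, e2, ← Real.exp_sub, ← Real.exp_sub]

lemma isProbabilityMeasure_tilted_mul [IsProbabilityMeasure Q]
    (hint : ∀ t : ℝ, Integrable (fun x => Real.exp (t * L x)) Q) (t : ℝ) :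
    IsProbabilityMeasure (Q.tilted fun x => t * L x) :=
  isProbabilityMeasure_tilted (hint t)

lemma isProbabilityMeasure_tiltPi [IsProbabilityMeasure Q]
    (hint : ∀ t : ℝ, Integrable (fun x => Real.exp (t * L x)) Q) (t : ι → ℝ) :
    IsProbabilityMeasure (tiltPi Q L t) := by
  have := fun e => isProbabilityMeasure_tilted_mul hint (t e)
  unfold tiltPi
  infer_instance

/-- The log-likelihood ratio between two tilted product measures is affine in `L`. -/
lemma tiltPi_eq_withDensity [IsProbabilityMeasure Q] (hL : Measurable L)
    (hint : ∀ t : ℝ, Integrable (fun x => Real.exp (t * L x)) Q) (s t : ι → ℝ) :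
    tiltPi Q L t = (tiltPi Q L s).withDensity fun x => ENNReal.ofReal
      (Real.exp (∑ e, (t e - s e) * L (x e) - ∑ e, (cgf L Q (t e) - cgf L Q (s e)))) := by
  have hp := fun e => isProbabilityMeasure_tilted_mul hint (s e)
  have hp' := fun e => isProbabilityMeasure_tilted_mul hint (t e)
  have : ∀ e, IsProbabilityMeasure ((Q.tilted fun x => s e * L x).withDensity
      fun x => ENNReal.ofReal
        (Real.exp ((t e - s e) * L x - (cgf L Q (t e) - cgf L Q (s e))))) := by
    intro e; rw [← tilted_mul_eq_withDensity hint]; exact hp' e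
  have h := pi_withDensity (fun e => Q.tilted fun x => s e * L x)
    (fun e x => ENNReal.ofReal
      (Real.exp ((t e - s e) * L x - (cgf L Q (t e) - cgf L Q (s e)))))
    (fun e => by fun_prop) this
  simp only [← tilted_mul_eq_withDensity hint] at h
  rw [tiltPi, h, tiltPi]
  congr 1
  ext x
  rw [← ENNReal.ofReal_prod_of_nonneg fun e _ => (Real.exp_pos _).le, ← Real.exp_sum,
    Finset.sum_sub_distrib]

/-- Change of measure: a lower bound on the log-likelihood ratio on an event compares its
probabilities. -/
lemma exp_mul_tiltPi_le [IsProbabilityMeasure Q] (hL : Measurable L)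
    (hint : ∀ t : ℝ, Integrable (fun x => Real.exp (t * L x)) Q) (s t : ι → ℝ)
    {B : Set (ι → ℝ)} (hB : MeasurableSet B) (b : ℝ)
    (h : ∀ x ∈ B, b ≤ ∑ e, (t e - s e) * L (x e) - ∑ e, (cgf L Q (t e) - cgf L Q (s e))) :
    Real.exp b * (tiltPi Q L s).real B ≤ (tiltPi Q L t).real B := by
  have := isProbabilityMeasure_tiltPi hint s
  have := isProbabilityMeasure_tiltPi hint t
  have h1 : ENNReal.ofReal (Real.exp b) * tiltPi Q L s B ≤ tiltPi Q L t B := by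
    rw [tiltPi_eq_withDensity hL hint s t, withDensity_apply _ hB, ← setLIntegral_const]
    exact setLIntegral_mono' hB fun x hx =>
      ENNReal.ofReal_le_ofReal (Real.exp_le_exp.mpr (h x hx))
  have h2 := ENNReal.toReal_mono (measure_ne_top _ _) h1
  rwa [ENNReal.toReal_mul, ENNReal.toReal_ofReal (Real.exp_pos _).le] at h2

/-- Chernoff's bound for tilted product measures. -/
lemma tiltPi_real_le_exp [IsProbabilityMeasure Q] (hL : Measurable L)
    (hint : ∀ t : ℝ, Integrable (fun x => Real.exp (t * L x)) Q) (t c : ι → ℝ) (s : ℝ) :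
    (tiltPi Q L t).real {x | s ≤ ∑ e, c e * L (x e)} ≤
      Real.exp (∑ e, (cgf L Q (t e + c e) - cgf L Q (t e)) - s) := by
  have := isProbabilityMeasure_tiltPi hint (fun e => t e + c e)
  have hB : MeasurableSet {x : ι → ℝ | s ≤ ∑ e, c e * L (x e)} := by
    refine measurableSet_le measurable_const (Finset.measurable_sum _ fun e _ => ?_)
    fun_prop
  -- Chernoff's bound as a change of measure: on the event the tilt `t + c` has density at least the
  -- exponential of `s` minus the cumulants, and its total mass is at most 1.
  have h := exp_mul_tiltPi_le hL hint t (fun e => t e + c e) hB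
    (s - ∑ e, (cgf L Q (t e + c e) - cgf L Q (t e))) (fun x hx => by
      simp only [add_sub_cancel_left]; simp only [Set.mem_ofPred_eq] at hx; linarith)
  have h1 := h.trans measureReal_le_one
  rw [← neg_sub, Real.exp_neg, inv_mul_le_iff₀ (Real.exp_pos _), mul_one] at h1
  exact h1

/-- Chernoff's bound for a sum over a set of coordinates with a common tilt. -/
lemma tiltPi_real_sum_le_exp [IsProbabilityMeasure Q] (hL : Measurable L)
    (hint : ∀ t : ℝ, Integrable (fun x => Real.exp (t * L x)) Q) (t : ι → ℝ) (E : Finset ι)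
    (τ : ℝ) (hE : ∀ e ∈ E, t e = τ) (u s : ℝ) :
    (tiltPi Q L t).real {x | s ≤ u * ∑ e ∈ E, L (x e)} ≤
      Real.exp (E.card * (cgf L Q (τ + u) - cgf L Q τ) - s) := by
  classical
  have h := tiltPi_real_le_exp hL hint t (fun e => if e ∈ E then u else 0) s
  have h1 : ∀ x : ι → ℝ, ∑ e, (if e ∈ E then u else 0) * L (x e) = u * ∑ e ∈ E, L (x e) := by
    intro x
    simp [ite_mul, Finset.sum_ite_mem, Finset.mul_sum]
  have h2 : ∑ e, (cgf L Q (t e + if e ∈ E then u else 0) - cgf L Q (t e)) =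
      E.card * (cgf L Q (τ + u) - cgf L Q τ) := by
    rw [← nsmul_eq_mul, ← Finset.sum_const, ← Finset.sum_subset (Finset.subset_univ E)]
    · exact Finset.sum_congr rfl fun e he => by rw [if_pos he, hE e he]
    · intro e _ he
      rw [if_neg he]; simp
  rw [h2] at h
  simpa only [h1] using h

/-- If every point lies in at most `R` of the events, their probabilities add up to at most
`R`. -/
lemma sum_measureReal_le {Ω κ : Type*} [MeasurableSpace Ω] (μ : Measure Ω)
    [IsProbabilityMeasure μ] (s : Finset κ) (B : κ → Set Ω) (hB : ∀ k ∈ s, MeasurableSet (B k))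
    (R : ℝ) (h : ∀ x, ∑ k ∈ s, (B k).indicator (fun _ => (1 : ℝ)) x ≤ R) :
    ∑ k ∈ s, μ.real (B k) ≤ R := by
  have h1 : ∑ k ∈ s, μ.real (B k) = ∫ x, ∑ k ∈ s, (B k).indicator (fun _ => (1 : ℝ)) x ∂μ := by
    rw [integral_finsetSum]
    · exact Finset.sum_congr rfl fun k hk => by
        rw [integral_indicator (hB k hk)]; simp
    · exact fun k hk => (integrable_const _).indicator (hB k hk)
  rw [h1]
  calc _ ≤ ∫ _, R ∂μ := integral_mono
        (integrable_finsetSum _ fun k hk => (integrable_const _).indicator (hB k hk))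
        (integrable_const _) h
    _ = R := by simp

end Tilting

/-! ### Pairs of laws with a regular log-likelihood ratio -/

/-- The cumulant generating function of the log-likelihood ratio `log (dP/dQ)` under `Q`. -/
noncomputable abbrev logMgf (P Q : Measure ℝ) : ℝ → ℝ := cgf (llr P Q) Q

/-- Mutually absolutely continuous probability measures whose log-likelihood ratio has all
exponential moments and whose cumulant generating function has, along the segment `[0, 1]`, a
second-order bound proportional to the divergence. The constants `c` are uniform over families. -/
structure RegularPair (P Q : Measure ℝ) (c : ℝ → ℝ) : Prop where
  prob_left : IsProbabilityMeasure P
  prob_right : IsProbabilityMeasure Q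
  ac_left : P ≪ Q
  ac_right : Q ≪ P
  integrable_exp : ∀ t : ℝ, Integrable (fun x => Real.exp (t * llr P Q x)) Q
  kl_pos : 0 < kl P Q
  one_le : ∀ U, 1 ≤ c U
  logMgf_add_le : ∀ s ∈ Set.Icc (0 : ℝ) 1, ∀ U u : ℝ, |u| ≤ U →
    logMgf P Q (s + u) ≤ logMgf P Q s + u * deriv (logMgf P Q) s + c U * kl P Q * u ^ 2

section AbsolutelyContinuous

variable {P Q : Measure ℝ} [IsProbabilityMeasure P] [IsProbabilityMeasure Q]

lemma integrableExpSet_eq_univ {Q : Measure ℝ} {L : ℝ → ℝ}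
    (h : ∀ t : ℝ, Integrable (fun x => Real.exp (t * L x)) Q) (t : ℝ) :
    t ∈ interior (integrableExpSet L Q) := by
  have : integrableExpSet L Q = Set.univ := Set.eq_univ_of_forall h
  simp [this]

lemma integral_exp_llr (hPQ : P ≪ Q) (hQP : Q ≪ P) :
    ∫ x, Real.exp (llr P Q x) ∂Q = 1 := by
  rw [integral_congr_ae (exp_llr_of_ac' P Q hQP), Measure.integral_toReal_rnDeriv hPQ]
  simp

/-- `dP/dQ = exp L` already has `Q`-mean 1, so no normalisation is needed. This places all community
laws in the one family `tiltPi`, with tilts 0 and 1. -/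
lemma eq_tilted_llr (hPQ : P ≪ Q) (hQP : Q ≪ P) : P = Q.tilted fun x => 1 * llr P Q x := by
  simp only [one_mul, Measure.tilted, integral_exp_llr hPQ hQP, div_one]
  rw [← Measure.withDensity_rnDeriv_eq P Q hPQ]
  refine withDensity_congr_ae ?_
  rw [Measure.withDensity_rnDeriv_eq P Q hPQ]
  filter_upwards [exp_llr_of_ac' P Q hQP, Measure.rnDeriv_lt_top P Q] with x hx hx'
  rw [hx, ENNReal.ofReal_toReal hx'.ne]

lemma logMgf_one (hPQ : P ≪ Q) (hQP : Q ≪ P) : logMgf P Q 1 = 0 := by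
  simp [logMgf, cgf, mgf, integral_exp_llr hPQ hQP]

/-- The derivative of a cumulant generating function is the mean under the tilted law; the tilt at 1
is `P`, under which `L` has mean `D`. -/
lemma deriv_logMgf_one (hPQ : P ≪ Q) (hQP : Q ≪ P)
    (h : ∀ t : ℝ, Integrable (fun x => Real.exp (t * llr P Q x)) Q) :
    deriv (logMgf P Q) 1 = kl P Q := by
  rw [logMgf, ← integral_tilted_mul_self (integrableExpSet_eq_univ h 1),
    ← eq_tilted_llr hPQ hQP, kl, InformationTheory.toReal_klDiv_of_measure_eq hPQ (by simp)]

end AbsolutelyContinuous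

namespace RegularPair

variable {P Q : Measure ℝ} {c : ℝ → ℝ}

lemma eq_tilted (h : RegularPair P Q c) : P = Q.tilted fun x => 1 * llr P Q x := by
  have := h.prob_left; have := h.prob_right
  exact eq_tilted_llr h.ac_left h.ac_right

lemma integrable_mul_exp (h : RegularPair P Q c) (t : ℝ) :
    Integrable (fun x => llr P Q x * Real.exp (t * llr P Q x)) Q := by
  simpa using integrable_pow_mul_exp_of_mem_interior_integrableExpSet
    (integrableExpSet_eq_univ h.integrable_exp t) 1

lemma logMgf_zero (h : RegularPair P Q c) : logMgf P Q 0 = 0 := by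
  have := h.prob_right
  exact cgf_zero

lemma logMgf_one (h : RegularPair P Q c) : logMgf P Q 1 = 0 := by
  have := h.prob_left; have := h.prob_right
  exact SingleCommunity.logMgf_one h.ac_left h.ac_right

lemma deriv_logMgf_one (h : RegularPair P Q c) : deriv (logMgf P Q) 1 = kl P Q := by
  have := h.prob_left; have := h.prob_right
  exact SingleCommunity.deriv_logMgf_one h.ac_left h.ac_right h.integrable_exp

lemma integral_exp (h : RegularPair P Q c) : ∫ x, Real.exp (llr P Q x) ∂Q = 1 := by
  have := h.prob_left; have := h.prob_right
  exact integral_exp_llr h.ac_left h.ac_right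

lemma integrable_exp_one (h : RegularPair P Q c) :
    Integrable (fun x => Real.exp (llr P Q x)) Q := by
  simpa using h.integrable_exp 1

lemma exp_logMgf (h : RegularPair P Q c) (t : ℝ) :
    Real.exp (logMgf P Q t) = ∫ x, Real.exp (t * llr P Q x) ∂Q := by
  have := h.prob_right
  exact exp_cgf (h.integrable_exp t)

/-- Convexity of `exp` gives `exp (t L) ≤ t exp L + (1 - t)`, whose `Q`-mean is 1. -/
lemma logMgf_nonpos (h : RegularPair P Q c) {t : ℝ} (ht : t ∈ Set.Icc (0 : ℝ) 1) :
    logMgf P Q t ≤ 0 := by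
  have := h.prob_right
  rw [← Real.exp_le_exp, h.exp_logMgf, Real.exp_zero]
  have hi : Integrable (fun x => t * Real.exp (llr P Q x) + (1 - t)) Q :=
    (h.integrable_exp_one.const_mul t).add (integrable_const _)
  calc _ ≤ ∫ x, (t * Real.exp (llr P Q x) + (1 - t)) ∂Q := by
        refine integral_mono (h.integrable_exp t) hi fun x => ?_
        have := convexOn_exp.2 (Set.mem_univ (llr P Q x)) (Set.mem_univ 0) ht.1
          (sub_nonneg.mpr ht.2) (by ring)
        simpa using this
    _ = 1 := by
        rw [integral_add (h.integrable_exp_one.const_mul t) (integrable_const _),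
          integral_const_mul, h.integral_exp]
        simp

/-- For `t ≤ 0`, `exp (t L) ≥ 1 + t L ≥ 1 + t (exp L - 1)`, whose `Q`-mean is 1. -/
lemma logMgf_nonneg (h : RegularPair P Q c) {t : ℝ} (ht : t ≤ 0) : 0 ≤ logMgf P Q t := by
  have := h.prob_right
  rw [← Real.exp_le_exp, h.exp_logMgf, Real.exp_zero]
  have hi : Integrable (fun x => t * Real.exp (llr P Q x) + (1 - t)) Q :=
    (h.integrable_exp_one.const_mul t).add (integrable_const _)
  calc 1 = ∫ x, (t * Real.exp (llr P Q x) + (1 - t)) ∂Q := by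
        rw [integral_add (h.integrable_exp_one.const_mul t) (integrable_const _),
          integral_const_mul, h.integral_exp]
        simp
    _ ≤ _ := by
        refine integral_mono hi (h.integrable_exp t) fun x => ?_
        have h1 := Real.add_one_le_exp (t * llr P Q x)
        have h2 := mul_le_mul_of_nonpos_left (Real.add_one_le_exp (llr P Q x)) ht
        simp only
        linarith

/-- The convex function `ψ` lies above its tangent at 1. Concretely, `exp y ≥ 1 + y` with `y = (t -
1) (L - D)` is averaged under `P`, that is, under `Q` with weight `exp L`. -/
lemma sub_one_mul_le_logMgf (h : RegularPair P Q c) (t : ℝ) :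
    (t - 1) * kl P Q ≤ logMgf P Q t := by
  have := h.prob_right
  set D := kl P Q with hD
  have hL : ∫ x, llr P Q x * Real.exp (llr P Q x) ∂Q = D := by
    have h1 := deriv_cgf (integrableExpSet_eq_univ h.integrable_exp 1)
    rw [show deriv (cgf (llr P Q) Q) 1 = D from h.deriv_logMgf_one] at h1
    simp only [mgf, one_mul, h.integral_exp, div_one] at h1
    exact h1.symm
  have i1 := h.integrable_exp_one
  have i2 : Integrable (fun x => llr P Q x * Real.exp (llr P Q x)) Q := by
    simpa using h.integrable_mul_exp 1
  rw [← Real.exp_le_exp, h.exp_logMgf]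
  have hi : Integrable (fun x => Real.exp ((t - 1) * D) *
      ((1 - (t - 1) * D) * Real.exp (llr P Q x) +
        (t - 1) * (llr P Q x * Real.exp (llr P Q x)))) Q :=
    ((i1.const_mul _).add (i2.const_mul _)).const_mul _
  calc Real.exp ((t - 1) * D) = ∫ x, Real.exp ((t - 1) * D) *
      ((1 - (t - 1) * D) * Real.exp (llr P Q x) +
        (t - 1) * (llr P Q x * Real.exp (llr P Q x))) ∂Q := by
        rw [integral_const_mul, integral_add (i1.const_mul _) (i2.const_mul _),
          integral_const_mul, integral_const_mul, hL, h.integral_exp]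
        ring
    _ ≤ _ := by
        refine integral_mono hi (h.integrable_exp t) fun x => ?_
        have h1 := Real.add_one_le_exp ((t - 1) * llr P Q x - (t - 1) * D)
        have h2 : Real.exp (t * llr P Q x) = Real.exp ((t - 1) * D) *
            (Real.exp ((t - 1) * llr P Q x - (t - 1) * D) * Real.exp (llr P Q x)) := by
          rw [← Real.exp_add, ← Real.exp_add]; ring_nf
        simp only
        rw [h2]
        refine mul_le_mul_of_nonneg_left ?_ (Real.exp_pos _).le
        have := mul_le_mul_of_nonneg_right h1 (Real.exp_pos (llr P Q x)).le
        linarith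

lemma deriv_logMgf_zero_nonpos (h : RegularPair P Q c) : deriv (logMgf P Q) 0 ≤ 0 := by
  have := h.prob_right
  rw [logMgf, deriv_cgf_zero (integrableExpSet_eq_univ h.integrable_exp 0)]
  have i1 : Integrable (llr P Q) Q :=
    integrable_of_mem_interior_integrableExpSet (integrableExpSet_eq_univ h.integrable_exp 0)
  have : ∫ x, llr P Q x ∂Q ≤ ∫ x, (Real.exp (llr P Q x) - 1) ∂Q := by
    refine integral_mono i1 (h.integrable_exp_one.sub (integrable_const _)) fun x => ?_
    have := Real.add_one_le_exp (llr P Q x)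
    simp only
    linarith
  rw [integral_sub h.integrable_exp_one (integrable_const _), h.integral_exp] at this
  simpa using this

lemma continuous_deriv_logMgf (h : RegularPair P Q c) : Continuous (deriv (logMgf P Q)) := by
  rw [continuous_iff_continuousAt]
  exact fun t => (analyticAt_cgf (integrableExpSet_eq_univ h.integrable_exp t)).deriv.continuousAt

/-- The continuous `ψ'` is at most 0 at 0 and equals `D` at 1. The `t` found is the tilt under which
`L` has mean `θ`. -/
lemma exists_deriv_logMgf_eq (h : RegularPair P Q c) {θ : ℝ} (h0 : 0 ≤ θ) (h1 : θ ≤ kl P Q) :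
    ∃ t ∈ Set.Icc (0 : ℝ) 1, deriv (logMgf P Q) t = θ := by
  have := intermediate_value_Icc (zero_le_one (α := ℝ)) h.continuous_deriv_logMgf.continuousOn
  exact this ⟨h.deriv_logMgf_zero_nonpos.trans h0, h.deriv_logMgf_one ▸ h1⟩

/-- A crude bound for `logMgf` far from the segment `[0, 1]`. -/
lemma logMgf_le (h : RegularPair P Q c) (t : ℝ) :
    logMgf P Q t ≤ (|t - 1| + c |t - 1| * (t - 1) ^ 2) * kl P Q := by
  have h1 := h.logMgf_add_le 1 (by simp) |t - 1| (t - 1) le_rfl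
  rw [h.logMgf_one, h.deriv_logMgf_one] at h1
  have h2 := mul_le_mul_of_nonneg_right (le_abs_self (t - 1)) h.kl_pos.le
  have h3 : 1 + (t - 1) = t := by ring
  rw [h3] at h1
  linarith

lemma logMgf_one_sub_le (h : RegularPair P Q c) {u : ℝ} (h0 : 0 ≤ u) (h1 : u ≤ 1) :
    logMgf P Q (1 - u) ≤ -(u * kl P Q) + c 1 * kl P Q * u ^ 2 := by
  have h2 := h.logMgf_add_le 1 (by simp) 1 (-u) (by rw [abs_neg, abs_of_nonneg h0]; exact h1)
  rw [h.logMgf_one, h.deriv_logMgf_one] at h2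
  rw [sub_eq_add_neg]
  linarith [neg_sq u]

/-- The bound `-u D + c D u²` for `ψ (1 - u)` is least at `u = 1 / (2 c)`. It makes `E_Q` at least a
constant multiple of `D` for nonnegative arguments. -/
lemma exists_logMgf_le (h : RegularPair P Q c) :
    ∃ t ∈ Set.Icc (0 : ℝ) 1, logMgf P Q t ≤ -(kl P Q / (4 * c 1)) := by
  have hc := h.one_le 1
  have h0 : 0 ≤ 1 / (2 * c 1) := by positivity
  have h1 : 1 / (2 * c 1) ≤ 1 := by rw [div_le_one (by positivity)]; linarith
  refine ⟨1 - 1 / (2 * c 1), ⟨by linarith, by linarith⟩, (h.logMgf_one_sub_le h0 h1).trans ?_⟩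
  have : c 1 ≠ 0 := by positivity
  apply le_of_eq
  field_simp
  ring

end RegularPair

/-! ### Gaussian and Bernoulli laws -/

lemma exp_sub_one_sub_le {y B : ℝ} (h : |y| ≤ B) :
    Real.exp y ≤ 1 + y + y ^ 2 * Real.exp B := by
  have h1 : (Real.exp |y|) ≤ Real.exp B := Real.exp_le_exp.mpr h
  have key : Real.exp y - (1 + y) ≤ y ^ 2 * Real.exp |y| := by
    have := Complex.norm_exp_sub_sum_le_norm_mul_exp (y : ℂ) 2
    simp only [Finset.sum_range_succ, Finset.range_zero, Finset.sum_empty, pow_zero,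
      Nat.factorial_zero, Nat.cast_one, div_one, pow_one, Nat.factorial_one, zero_add] at this
    rw [Complex.norm_real, Real.norm_eq_abs, sq_abs, ← Complex.ofReal_exp,
      ← Complex.ofReal_one, ← Complex.ofReal_add, ← Complex.ofReal_sub, Complex.norm_real] at this
    exact (le_abs_self _).trans this
  nlinarith [mul_le_mul_of_nonneg_left h1 (sq_nonneg y)]

/-- For `y ≥ -2`, squaring `exp (y / 2) ≥ 1 + y / 2` yields the gain `y² / 4`; for `y < -2` the
linear term alone suffices. -/
lemma sq_div_le_exp_sub_one_sub {y B : ℝ} (hB : 2 ≤ B) (h : |y| ≤ B) :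
    y ^ 2 / (2 * B) ≤ Real.exp y - 1 - y := by
  rw [abs_le] at h
  rcases le_or_gt (-2) y with h2 | h2
  · have h3 : (1 + y / 2) ^ 2 ≤ Real.exp y := by
      have : Real.exp y = Real.exp (y / 2) ^ 2 := by rw [← Real.exp_nat_mul]; congr 1; ring
      rw [this]
      exact pow_le_pow_left₀ (by linarith) (by linarith [Real.add_one_le_exp (y / 2)]) 2
    have h4 : y ^ 2 / (2 * B) ≤ y ^ 2 / 4 := by gcongr; linarith
    nlinarith
  · have h3 : y ^ 2 / (2 * B) ≤ -y / 2 := by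
      rw [div_le_div_iff₀ (by linarith) (by norm_num)]
      nlinarith
    linarith [Real.exp_pos y]

/-- At `x = L` the last bracket has `Q`-mean `D`, so a bounded `L` has second moment at most a
constant times `D`. -/
lemma sq_le_of_abs_le {x B : ℝ} (hB : 2 ≤ B) (h : |x| ≤ B) :
    x ^ 2 ≤ 2 * B * Real.exp B * (x * Real.exp x - Real.exp x + 1) := by
  have h1 := sq_div_le_exp_sub_one_sub hB (y := -x) (by rwa [abs_neg])
  have h2 : x * Real.exp x - Real.exp x + 1 = Real.exp x * (Real.exp (-x) - 1 - -x) := by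
    have : Real.exp x * Real.exp (-x) = 1 := by rw [← Real.exp_add]; simp
    linear_combination -this
  have h3 : Real.exp B * Real.exp x ≥ 1 := by
    rw [← Real.exp_add, ge_iff_le, Real.one_le_exp_iff]
    linarith [(abs_le.mp h).1]
  rw [neg_sq, div_le_iff₀ (by linarith)] at h1
  have h0 : 0 ≤ Real.exp (-x) - 1 - -x := by linarith [Real.add_one_le_exp (-x)]
  calc x ^ 2 ≤ 1 * ((Real.exp (-x) - 1 - -x) * (2 * B)) := by linarith
    _ ≤ (Real.exp B * Real.exp x) * ((Real.exp (-x) - 1 - -x) * (2 * B)) :=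
        mul_le_mul_of_nonneg_right h3 (mul_nonneg h0 (by linarith))
    _ = _ := by rw [h2]; ring

lemma kl_pos_of_ne {P Q : Measure ℝ} [IsProbabilityMeasure P] [IsProbabilityMeasure Q]
    (hac : P ≪ Q) (hint : Integrable (llr P Q) P) (hne : P ≠ Q) : 0 < kl P Q :=
  ENNReal.toReal_pos (fun h => hne (InformationTheory.klDiv_eq_zero_iff.mp h))
    (InformationTheory.klDiv_ne_top hac hint)

lemma llr_ae_eq_of_eq_withDensity {P Q : Measure ℝ} [IsProbabilityMeasure P]
    [IsProbabilityMeasure Q] {l : ℝ → ℝ} (hl : Measurable l)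
    (h : P = Q.withDensity fun x => ENNReal.ofReal (Real.exp (l x))) :
    P ≪ Q ∧ Q ≪ P ∧ llr P Q =ᵐ[Q] l := by
  have hm : Measurable fun x => ENNReal.ofReal (Real.exp (l x)) := by fun_prop
  refine ⟨h ▸ withDensity_absolutelyContinuous _ _, ?_, ?_⟩
  · rw [h]
    refine withDensity_absolutelyContinuous' hm.aemeasurable (ae_of_all _ fun x => ?_)
    simp [Real.exp_pos]
  · have := Measure.rnDeriv_withDensity Q hm
    rw [← h] at this
    filter_upwards [this] with x hx
    simp only [llr_def]
    rw [hx, ENNReal.toReal_ofReal (Real.exp_pos _).le, Real.log_exp]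

/-- Distinct laws with a bounded log-likelihood ratio form a regular pair. -/
lemma regularPair_of_bounded {P Q : Measure ℝ} [IsProbabilityMeasure P] [IsProbabilityMeasure Q]
    (hPQ : P ≪ Q) (hQP : Q ≪ P) (hne : P ≠ Q) {B : ℝ} (hB : 2 ≤ B)
    (hL : ∀ᵐ x ∂Q, |llr P Q x| ≤ B) :
    RegularPair P Q fun U => 2 * B * Real.exp (3 * B + |U| * B) := by
  have hmL : Measurable (llr P Q) := measurable_llr P Q
  have hbd : ∀ f : ℝ → ℝ, Continuous f → Integrable (fun x => f (llr P Q x)) Q := by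
    intro f hf
    obtain ⟨C, hC⟩ := (isCompact_Icc (a := -B) (b := B)).exists_bound_of_continuousOn
      hf.continuousOn
    refine Integrable.of_bound (hf.measurable.comp hmL).aestronglyMeasurable C ?_
    filter_upwards [hL] with x hx
    exact hC _ (abs_le.mp hx)
  have hint : ∀ t : ℝ, Integrable (fun x => Real.exp (t * llr P Q x)) Q :=
    fun t => hbd (fun y => Real.exp (t * y)) (by fun_prop)
  have hderiv := deriv_logMgf_one hPQ hQP hint
  have hexp := integral_exp_llr hPQ hQP
  set V := ∫ x, llr P Q x ^ 2 ∂Q with hV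
  have hD : V ≤ 2 * B * Real.exp B * kl P Q := by
    have h1 := deriv_cgf (integrableExpSet_eq_univ hint 1)
    rw [show deriv (cgf (llr P Q) Q) 1 = kl P Q from hderiv] at h1
    simp only [mgf, one_mul, hexp, div_one] at h1
    have h2 : ∫ x, (llr P Q x * Real.exp (llr P Q x) - Real.exp (llr P Q x) + 1) ∂Q = kl P Q := by
      rw [integral_add, integral_sub, ← h1, hexp]
      · simp
      · exact hbd (fun y => y * Real.exp y) (by fun_prop)
      · exact hbd (fun y => Real.exp y) (by fun_prop)
      · exact hbd (fun y => y * Real.exp y - Real.exp y) (by fun_prop)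
      · exact integrable_const _
    rw [← h2, ← integral_const_mul]
    refine integral_mono_ae (hbd (fun y => y ^ 2) (by fun_prop))
      (hbd (fun y => 2 * B * Real.exp B * (y * Real.exp y - Real.exp y + 1)) (by fun_prop)) ?_
    filter_upwards [hL] with x hx
    exact sq_le_of_abs_le hB hx
  have hVnn : 0 ≤ V := integral_nonneg fun x => sq_nonneg _
  have hintP : Integrable (llr P Q) P := by
    have h1 : Integrable (llr P Q) (Q.tilted fun x => 1 * llr P Q x) := by
      rw [integrable_tilted_iff (hint 1)]
      exact hbd (fun y => Real.exp (1 * y) • y) (by fun_prop)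
    rwa [← eq_tilted_llr hPQ hQP] at h1
  refine ⟨inferInstance, inferInstance, hPQ, hQP, hint, kl_pos_of_ne hPQ hintP hne,
    fun U => ?_, ?_⟩
  · have : 1 ≤ Real.exp (3 * B + |U| * B) := Real.one_le_exp (by positivity)
    nlinarith
  -- The moment generating function is expanded to second order at `s`; the remainder is a multiple
  -- of `u² E_Q[L²]`, hence of `u² D`, and `log x ≤ x - 1` passes to its logarithm.
  · intro s hs U u hu
    have hU : 0 ≤ U := (abs_nonneg u).trans hu
    have hm0 : 0 < mgf (llr P Q) Q s := mgf_pos (hint s)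
    have hm1 : 0 < mgf (llr P Q) Q (s + u) := mgf_pos (hint _)
    have hlow : Real.exp (-B) ≤ mgf (llr P Q) Q s := by
      calc Real.exp (-B) = ∫ _, Real.exp (-B) ∂Q := by simp
        _ ≤ _ := by
          refine integral_mono_ae (integrable_const _) (hint s) ?_
          filter_upwards [hL] with x hx
          rw [abs_le] at hx
          refine Real.exp_le_exp.mpr ?_
          nlinarith [hs.1, hs.2]
    have hmain : mgf (llr P Q) Q (s + u) ≤ mgf (llr P Q) Q s +
        u * (∫ x, llr P Q x * Real.exp (s * llr P Q x) ∂Q) +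
          u ^ 2 * Real.exp (U * B) * Real.exp B * V := by
      have e1 : mgf (llr P Q) Q s + u * (∫ x, llr P Q x * Real.exp (s * llr P Q x) ∂Q) +
          u ^ 2 * Real.exp (U * B) * Real.exp B * V =
          ∫ x, (Real.exp (s * llr P Q x) + u * (llr P Q x * Real.exp (s * llr P Q x)) +
            u ^ 2 * Real.exp (U * B) * Real.exp B * llr P Q x ^ 2) ∂Q := by
        rw [integral_add, integral_add, integral_const_mul, integral_const_mul, mgf]
        · exact hint s
        · exact hbd (fun y => u * (y * Real.exp (s * y))) (by fun_prop)
        · exact hbd (fun y => Real.exp (s * y) + u * (y * Real.exp (s * y))) (by fun_prop)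
        · exact hbd (fun y => u ^ 2 * Real.exp (U * B) * Real.exp B * y ^ 2) (by fun_prop)
      rw [e1, mgf]
      refine integral_mono_ae (hint _) (hbd (fun y => Real.exp (s * y) +
        u * (y * Real.exp (s * y)) + u ^ 2 * Real.exp (U * B) * Real.exp B * y ^ 2)
        (by fun_prop)) ?_
      filter_upwards [hL] with x hx
      have h1 : |u * llr P Q x| ≤ U * B := by
        rw [abs_mul]; exact mul_le_mul hu hx (abs_nonneg _) hU
      have h2 := exp_sub_one_sub_le h1
      have h3 : Real.exp ((s + u) * llr P Q x) =
          Real.exp (s * llr P Q x) * Real.exp (u * llr P Q x) := by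
        rw [← Real.exp_add]; ring_nf
      have h4 : Real.exp (s * llr P Q x) ≤ Real.exp B := by
        rw [abs_le] at hx
        refine Real.exp_le_exp.mpr ?_
        nlinarith [hs.1, hs.2]
      have h5 := mul_le_mul_of_nonneg_left h2 (Real.exp_pos (s * llr P Q x)).le
      have h6 := mul_le_mul_of_nonneg_right h4
        (mul_nonneg (sq_nonneg (u * llr P Q x)) (Real.exp_pos (U * B)).le)
      simp only [h3]
      linarith
    have hcgf : logMgf P Q (s + u) - logMgf P Q s ≤
        mgf (llr P Q) Q (s + u) / mgf (llr P Q) Q s - 1 := by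
      rw [logMgf, cgf, cgf, ← Real.log_div hm1.ne' hm0.ne']
      exact Real.log_le_sub_one_of_pos (div_pos hm1 hm0)
    have hdiv : mgf (llr P Q) Q (s + u) / mgf (llr P Q) Q s - 1 ≤
        u * deriv (logMgf P Q) s +
          u ^ 2 * Real.exp (U * B) * Real.exp B * V / mgf (llr P Q) Q s := by
      rw [logMgf, deriv_cgf (integrableExpSet_eq_univ hint s), tsub_le_iff_right, div_le_iff₀ hm0]
      field_simp
      linarith
    have hlast : u ^ 2 * Real.exp (U * B) * Real.exp B * V / mgf (llr P Q) Q s ≤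
        2 * B * Real.exp (3 * B + |U| * B) * kl P Q * u ^ 2 := by
      rw [div_le_iff₀ hm0, abs_of_nonneg hU]
      have e2 : Real.exp (3 * B + U * B) =
          Real.exp (U * B) * Real.exp B * Real.exp B * Real.exp B := by
        rw [← Real.exp_add, ← Real.exp_add, ← Real.exp_add]; ring_nf
      have e3 : Real.exp B * Real.exp (-B) = 1 := by rw [← Real.exp_add]; simp
      have hk : 0 ≤ u ^ 2 * Real.exp (U * B) * Real.exp B := by positivity
      have hk2 : 0 ≤ 2 * B * Real.exp B * kl P Q := hVnn.trans hD
      calc _ ≤ u ^ 2 * Real.exp (U * B) * Real.exp B * (2 * B * Real.exp B * kl P Q) *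
            (Real.exp B * Real.exp (-B)) := by
              rw [e3, mul_one]; exact mul_le_mul_of_nonneg_left hD hk
        _ = (u ^ 2 * Real.exp (U * B) * Real.exp B * (2 * B * Real.exp B * kl P Q) *
            Real.exp B) * Real.exp (-B) := by ring
        _ ≤ (u ^ 2 * Real.exp (U * B) * Real.exp B * (2 * B * Real.exp B * kl P Q) *
            Real.exp B) * mgf (llr P Q) Q s := mul_le_mul_of_nonneg_left hlow
              (mul_nonneg (mul_nonneg hk hk2) (Real.exp_pos B).le)
        _ = _ := by rw [e2]; ring
    linarith

/-- `L` takes only two values, both bounded by `B`; the constants depend on `B` alone and so are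
uniform in `n`. The maximum with 2 meets the requirement of `regularPair_of_bounded`. -/
lemma regularPair_bernoulli {p q : unitInterval} {B : ℝ} (hp0 : 0 < p) (hp1 : p < 1)
    (hq0 : 0 < q) (hq1 : q < 1) (hpq : p ≠ q) (h1 : |Real.log ((p : ℝ) / q)| ≤ B)
    (h0 : |Real.log ((1 - (p : ℝ)) / (1 - q))| ≤ B) :
    RegularPair (bernoulliMeasure (1 : ℝ) 0 p) (bernoulliMeasure 1 0 q)
      fun U => 2 * max B 2 * Real.exp (3 * max B 2 + |U| * max B 2) := by
  have hp0' : (0 : ℝ) < p := hp0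
  have hp1' : (p : ℝ) < 1 := hp1
  have hq0' : (0 : ℝ) < q := hq0
  have hq1' : (q : ℝ) < 1 := hq1
  set l : ℝ → ℝ := fun x => if x = 1 then Real.log ((p : ℝ) / q) else
    Real.log ((1 - (p : ℝ)) / (1 - q)) with hl
  have hlm : Measurable l := Measurable.ite (measurableSet_singleton 1) measurable_const
    measurable_const
  have hne : bernoulliMeasure (1 : ℝ) 0 p ≠ bernoulliMeasure 1 0 q := by
    intro h
    have h2 := congrArg (fun ν => ν.real {(1 : ℝ)}) h
    classical
    simp only [bernoulliMeasure_real_apply _ (measurableSet_singleton (1 : ℝ))] at h2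
    simp at h2
    exact hpq (Subtype.ext h2)
  have hdens : bernoulliMeasure (1 : ℝ) 0 p = (bernoulliMeasure (1 : ℝ) 0 q).withDensity
      fun x => ENNReal.ofReal (Real.exp (l x)) := by
    have e1 : ENNReal.ofReal (Real.exp (l 1)) = ENNReal.ofReal ((p : ℝ) / q) := by
      simp only [hl, if_true]
      rw [Real.exp_log (div_pos hp0' hq0')]
    have e0 : ENNReal.ofReal (Real.exp (l 0)) = ENNReal.ofReal ((1 - (p : ℝ)) / (1 - q)) := by
      simp only [hl, zero_ne_one, if_false]
      rw [Real.exp_log (div_pos (by linarith) (by linarith))]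
    have hlm' : Measurable fun x => ENNReal.ofReal (Real.exp (l x)) := by fun_prop
    have hI : ∀ r : unitInterval,
        ((unitInterval.toNNReal r : NNReal) : ENNReal) = ENNReal.ofReal r := by
      intro r; rw [ENNReal.ofReal, Real.toNNReal_of_nonneg r.2.1]; rfl
    ext s hs
    rw [withDensity_apply _ hs, ← lintegral_indicator hs, bernoulliMeasure_def,
      bernoulliMeasure_def, lintegral_add_measure, lintegral_smul_measure, lintegral_smul_measure,
      lintegral_dirac' _ (hlm'.indicator hs), lintegral_dirac' _ (hlm'.indicator hs)]
    simp only [Measure.add_apply, Measure.smul_apply, Measure.dirac_apply' _ hs,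
      ENNReal.smul_def, smul_eq_mul, hI, unitInterval.coe_symm_eq]
    congr 1
    · by_cases h : (1 : ℝ) ∈ s
      · simp only [h, Set.indicator_of_mem, e1, Pi.one_apply, mul_one]
        rw [← ENNReal.ofReal_mul hq0'.le, mul_div_cancel₀ _ hq0'.ne']
      · simp [h]
    · by_cases h : (0 : ℝ) ∈ s
      · simp only [h, Set.indicator_of_mem, e0, Pi.one_apply, mul_one]
        rw [← ENNReal.ofReal_mul (by linarith), mul_div_cancel₀ _ (by linarith)]
      · simp [h]
  obtain ⟨hPQ, hQP, hllr⟩ := llr_ae_eq_of_eq_withDensity hlm hdens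
  refine regularPair_of_bounded hPQ hQP hne (le_max_right _ _) ?_
  filter_upwards [hllr] with x hx
  rw [hx]
  refine le_trans ?_ (le_max_left _ _)
  simp only [hl]
  split_ifs
  · exact h1
  · exact h0

/-- Here `ψ t = (t² - t) μ² / 2` and `D = μ² / 2`, so the second-order expansion is exact with
constant 1. -/
lemma regularPair_gaussian {μ : ℝ} (hμ : μ ≠ 0) :
    RegularPair (gaussianReal μ 1) (gaussianReal 0 1) fun _ => 1 := by
  have hdens : gaussianReal μ 1 = (gaussianReal 0 1).withDensity
      fun x => ENNReal.ofReal (Real.exp (μ * x - μ ^ 2 / 2)) := by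
    rw [gaussianReal_of_var_ne_zero μ one_ne_zero, gaussianReal_of_var_ne_zero 0 one_ne_zero,
      ← withDensity_mul _ (measurable_gaussianPDF _ _) (by fun_prop)]
    congr 1
    ext x
    simp only [Pi.mul_apply, gaussianPDF]
    rw [← ENNReal.ofReal_mul (gaussianPDFReal_nonneg _ _ _), gaussianPDFReal, gaussianPDFReal,
      mul_assoc (√(2 * Real.pi * ((1 : NNReal) : ℝ)))⁻¹, ← Real.exp_add]
    congr 3
    simp
    ring
  obtain ⟨hPQ, hQP, hllr⟩ := llr_ae_eq_of_eq_withDensity (by fun_prop) hdens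
  have hmgf : ∀ t, ∀ x : ℝ, Real.exp (t * (μ * x - μ ^ 2 / 2)) =
      Real.exp (-(t * μ ^ 2 / 2)) * Real.exp ((t * μ) * x) := by
    intro t x; rw [← Real.exp_add]; ring_nf
  have hint : ∀ t : ℝ, Integrable (fun x => Real.exp (t * llr (gaussianReal μ 1)
      (gaussianReal 0 1) x)) (gaussianReal 0 1) := by
    intro t
    have : Integrable (fun x => Real.exp (t * (μ * x - μ ^ 2 / 2))) (gaussianReal 0 1) := by
      simp_rw [hmgf]
      exact (integrable_exp_mul_gaussianReal _).const_mul _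
    refine this.congr ?_
    filter_upwards [hllr] with x hx
    rw [hx]
  have hψ : logMgf (gaussianReal μ 1) (gaussianReal 0 1) = fun t => (t ^ 2 - t) * (μ ^ 2 / 2) := by
    ext t
    rw [logMgf, cgf, mgf_congr hllr, mgf]
    simp_rw [hmgf]
    rw [integral_const_mul]
    have := congrFun (mgf_fun_id_gaussianReal (μ := 0) (v := 1)) (t * μ)
    rw [mgf] at this
    rw [this, ← Real.exp_add, Real.log_exp]
    simp
    ring
  have hd : ∀ t, deriv (logMgf (gaussianReal μ 1) (gaussianReal 0 1)) t =
      (2 * t - 1) * (μ ^ 2 / 2) := by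
    intro t
    rw [hψ]
    have : HasDerivAt (fun t : ℝ => (t ^ 2 - t) * (μ ^ 2 / 2)) ((2 * t - 1) * (μ ^ 2 / 2)) t := by
      simpa using ((hasDerivAt_pow 2 t).sub (hasDerivAt_id t)).mul_const (μ ^ 2 / 2)
    exact this.deriv
  have hkl : kl (gaussianReal μ 1) (gaussianReal 0 1) = μ ^ 2 / 2 := by
    rw [← deriv_logMgf_one hPQ hQP hint, hd]; ring
  refine ⟨inferInstance, inferInstance, hPQ, hQP, hint, ?_, fun _ => le_rfl, ?_⟩
  · rw [hkl]; positivity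
  · intro s _ U u _
    rw [hd, hψ, hkl]
    apply le_of_eq
    ring

lemma exists_regularPair {P Q : ℕ → Measure ℝ} (h : GaussianCase P Q ∨ BernoulliCase P Q) :
    ∃ c : ℝ → ℝ, ∀ n, RegularPair (P n) (Q n) c := by
  rcases h with ⟨μ, h⟩ | ⟨p, q, B, h⟩
  · refine ⟨fun _ => 1, fun n => ?_⟩
    rw [(h n).2.1, (h n).2.2]
    exact regularPair_gaussian (h n).1
  · refine ⟨fun U => 2 * max B 2 * Real.exp (3 * max B 2 + |U| * max B 2), fun n => ?_⟩
    obtain ⟨⟨hp0, hp1⟩, ⟨hq0, hq1⟩, hpq, h1, h0, hP, hQ⟩ := h n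
    rw [hP, hQ]
    exact regularPair_bernoulli hp0 hp1 hq0 hq1 hpq h1 h0

/-! ### Pairs of indices -/

section Pairs

variable {n : ℕ}

/-- The pairs inside `C`. -/
def edges (C : Finset (Fin n)) : Finset (Pair n) :=
  Finset.univ.filter fun e => e.1.1 ∈ C ∧ e.1.2 ∈ C

/-- The pairs with one index in `A` and the other one in `B`. -/
def cross (A B : Finset (Fin n)) : Finset (Pair n) :=
  Finset.univ.filter fun e => (e.1.1 ∈ A ∧ e.1.2 ∈ B) ∨ (e.1.1 ∈ B ∧ e.1.2 ∈ A)

@[simp] lemma mem_edges {C : Finset (Fin n)} {e : Pair n} :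
    e ∈ edges C ↔ e.1.1 ∈ C ∧ e.1.2 ∈ C := by simp [edges]

@[simp] lemma mem_cross {A B : Finset (Fin n)} {e : Pair n} :
    e ∈ cross A B ↔ (e.1.1 ∈ A ∧ e.1.2 ∈ B) ∨ (e.1.1 ∈ B ∧ e.1.2 ∈ A) := by simp [cross]

lemma card_cross {A B : Finset (Fin n)} (h : Disjoint A B) :
    (cross A B).card = A.card * B.card := by
  rw [← Finset.card_product]
  refine Finset.card_bij' (fun e _ => if e.1.1 ∈ A then (e.1.1, e.1.2) else (e.1.2, e.1.1))
    (fun p hp => if h' : p.1 < p.2 then ⟨(p.1, p.2), h'⟩ else ⟨(p.2, p.1), by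
      have hp := Finset.mem_product.mp hp
      have : p.1 ≠ p.2 := fun h2 => Finset.disjoint_left.mp h hp.1 (h2 ▸ hp.2)
      exact lt_of_le_of_ne (not_lt.mp h') this.symm⟩) ?_ ?_ ?_ ?_
  · rintro ⟨⟨i, j⟩, hij⟩ he
    simp only [mem_cross] at he
    have hd : ∀ k, k ∈ A → k ∉ B := fun k hk => Finset.disjoint_left.mp h hk
    have := hd i; have := hd j
    by_cases hi : i ∈ A <;> simp_all
  · rintro ⟨i, j⟩ hp
    have hp := Finset.mem_product.mp hp
    simp only at hp ⊢
    split_ifs <;> simp_all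
  · rintro ⟨⟨i, j⟩, hij⟩ he
    simp only at hij
    by_cases hi : i ∈ A <;> simp [hi, hij, hij.not_gt]
  · rintro ⟨i, j⟩ hp
    have hp := Finset.mem_product.mp hp
    have hj : j ∉ A := fun hj => Finset.disjoint_left.mp h hj hp.2
    simp only at hp ⊢
    split_ifs <;> simp_all

lemma edges_insert (a : Fin n) (s : Finset (Fin n)) :
    edges (insert a s) = edges s ∪ cross {a} s := by
  ext ⟨⟨i, j⟩, hij⟩
  simp only at hij
  simp only [mem_edges, Finset.mem_union, mem_cross, Finset.mem_insert, Finset.mem_singleton]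
  have : ¬ (i = a ∧ j = a) := fun h => by rw [h.1, h.2] at hij; exact lt_irrefl _ hij
  tauto

lemma disjoint_edges_cross_singleton {a : Fin n} {s : Finset (Fin n)} (ha : a ∉ s) :
    Disjoint (edges s) (cross {a} s) := by
  rw [Finset.disjoint_left]
  rintro ⟨⟨i, j⟩, hij⟩ h3 h4
  simp only [mem_edges, mem_cross, Finset.mem_singleton] at h3 h4
  rcases h4 with ⟨rfl, _⟩ | ⟨_, rfl⟩
  · exact ha h3.1
  · exact ha h3.2

lemma card_edges (C : Finset (Fin n)) : (edges C).card = C.card.choose 2 := by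
  induction C using Finset.induction_on with
  | empty => simp [edges]
  | insert a s ha ih =>
    rw [edges_insert, Finset.card_union_of_disjoint (disjoint_edges_cross_singleton ha), ih,
      card_cross (by simpa using ha), Finset.card_insert_of_notMem ha, Finset.card_singleton,
      Nat.choose_succ_succ', Nat.choose_one_right]
    ring

lemma edges_mono {A B : Finset (Fin n)} (h : A ⊆ B) : edges A ⊆ edges B := by
  intro e he
  rw [mem_edges] at he ⊢
  exact ⟨h he.1, h he.2⟩

/-- Given `C`, the lost pairs depend on `C'` only through `C \ C'`. Writing them so lets a union
bound run over the removed set alone. -/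
lemma edges_sdiff_edges (C C' : Finset (Fin n)) :
    edges C \ edges C' = edges C \ edges (C \ (C \ C')) := by
  ext e
  simp only [Finset.mem_sdiff, mem_edges, not_and, not_not]
  tauto

lemma edges_sdiff_edges_eq_union {C C' : Finset (Fin n)} :
    edges C' \ edges C = edges (C' \ C) ∪ cross (C' \ C) (C \ (C \ C')) := by
  ext e
  simp only [Finset.mem_sdiff, mem_edges, Finset.mem_union, mem_cross]
  tauto

lemma disjoint_edges_cross {A B : Finset (Fin n)} (h : Disjoint A B) :
    Disjoint (edges A) (cross A B) := by
  rw [Finset.disjoint_left]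
  intro e h1 h2
  rw [mem_edges] at h1
  rw [mem_cross] at h2
  rcases h2 with h2 | h2
  · exact Finset.disjoint_left.mp h h1.2 h2.2
  · exact Finset.disjoint_left.mp h h1.1 h2.1

lemma cross_eq_union {T C S : Finset (Fin n)} (hS : S ⊆ C) :
    cross T C = cross T (C \ S) ∪ cross T S := by
  ext e
  have h1 := @hS e.1.1
  have h2 := @hS e.1.2
  simp only [Finset.mem_sdiff, Finset.mem_union, mem_cross]
  tauto

lemma disjoint_cross_cross {T A B : Finset (Fin n)} (h : Disjoint A B) (hA : Disjoint T A)
    (hB : Disjoint T B) : Disjoint (cross T A) (cross T B) := by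
  rw [Finset.disjoint_left] at *
  intro e h1 h2
  simp only [mem_cross] at h1 h2
  have a1 := @h e.1.1; have a2 := @h e.1.2
  have b1 := @hA e.1.1; have b2 := @hA e.1.2
  have c1 := @hB e.1.1; have c2 := @hB e.1.2
  tauto

/-- The sum of the transformed entries over the pairs inside `C`. -/
def score (L : ℝ → ℝ) (C : Finset (Fin n)) (x : Pair n → ℝ) : ℝ := ∑ e ∈ edges C, L (x e)

lemma score_insert (L : ℝ → ℝ) {a : Fin n} {s : Finset (Fin n)} (ha : a ∉ s) (x : Pair n → ℝ) :
    score L (insert a s) x = score L s x + ∑ e ∈ cross {a} s, L (x e) := by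
  rw [score, edges_insert, Finset.sum_union (disjoint_edges_cross_singleton ha), score]

lemma score_sub_score (L : ℝ → ℝ) (C C' : Finset (Fin n)) (x : Pair n → ℝ) :
    score L C' x - score L C x =
      ∑ e ∈ edges C' \ edges C, L (x e) - ∑ e ∈ edges C \ edges C', L (x e) := by
  have h1 := Finset.sum_sdiff (Finset.inter_subset_left (s₁ := edges C) (s₂ := edges C'))
    (f := fun e => L (x e))
  have h2 := Finset.sum_sdiff (Finset.inter_subset_left (s₁ := edges C') (s₂ := edges C))
    (f := fun e => L (x e))
  rw [Finset.sdiff_inter_self_left] at h1 h2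
  rw [Finset.inter_comm] at h2
  simp only [score]
  linarith

/-- Given `C`, the first sum depends on `C' \ C` only; the bracket is a correction over few pairs
when `C'` is close to `C`. -/
lemma sum_edges_sdiff_edges (f : Pair n → ℝ) (C C' : Finset (Fin n)) :
    ∑ e ∈ edges C' \ edges C, f e = ∑ e ∈ cross (C' \ C) C, f e +
      (∑ e ∈ edges (C' \ C), f e - ∑ e ∈ cross (C' \ C) (C \ C'), f e) := by
  have hd : Disjoint (C' \ C) C := Finset.sdiff_disjoint
  rw [edges_sdiff_edges_eq_union, Finset.sum_union (disjoint_edges_cross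
      (hd.mono_right Finset.sdiff_subset)), cross_eq_union (S := C \ C') Finset.sdiff_subset,
    Finset.sum_union (disjoint_cross_cross Finset.sdiff_disjoint
      (hd.mono_right Finset.sdiff_subset) (hd.mono_right Finset.sdiff_subset))]
  ring

lemma card_edges_sdiff (C C' : Finset (Fin n)) :
    ((edges C \ edges C').card : ℝ) = ((C \ C').card : ℝ) *
      (2 * C.card - (C \ C').card - 1) / 2 := by
  rw [edges_sdiff_edges, Finset.cast_card_sdiff (edges_mono Finset.sdiff_subset), card_edges,
    card_edges, Nat.cast_choose_two, Nat.cast_choose_two,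
    Finset.cast_card_sdiff (Finset.sdiff_subset)]
  ring

end Pairs

/-! ### The law of the entries above the diagonal -/

section Law

variable {n : ℕ}

/-- The indicator vector of a set of pairs. -/
noncomputable def indic (E : Finset (Pair n)) : Pair n → ℝ := fun e => if e ∈ E then 1 else 0

/-- The law of the entries above the diagonal when the community is `C`. -/
noncomputable def law (P Q : Measure ℝ) (C : Finset (Fin n)) : Measure (Pair n → ℝ) :=
  tiltPi Q (llr P Q) (indic (edges C))

/-- The set with indicator vector `ξ`. -/
def supp (ξ : Fin n → Bool) : Finset (Fin n) := Finset.univ.filter fun i => ξ i = true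

@[simp] lemma mem_supp {ξ : Fin n → Bool} {i : Fin n} : i ∈ supp ξ ↔ ξ i = true := by simp [supp]

lemma supp_injective : Function.Injective (supp : (Fin n → Bool) → Finset (Fin n)) := by
  intro ξ ξ' h
  ext i
  have h1 : i ∈ supp ξ ↔ i ∈ supp ξ' := by rw [h]
  rw [mem_supp, mem_supp] at h1
  exact Bool.eq_iff_iff.mpr h1

lemma mem_communities {K : ℕ} {ξ : Fin n → Bool} : ξ ∈ communities n K ↔ (supp ξ).card = K := by
  simp [communities, supp]

lemma supp_decide (C : Finset (Fin n)) : supp (fun i => decide (i ∈ C)) = C := by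
  ext i; simp

lemma card_communities (n K : ℕ) : (communities n K).card = n.choose K := by
  have : (communities n K).card = (Finset.powersetCard K (Finset.univ : Finset (Fin n))).card := by
    refine Finset.card_bij (fun ξ _ => supp ξ) ?_ ?_ ?_
    · intro ξ h
      simpa [Finset.mem_powersetCard] using mem_communities.mp h
    · exact fun ξ _ ξ' _ h => supp_injective h
    · intro C hC
      exact ⟨fun i => decide (i ∈ C), mem_communities.mpr (by
        rw [supp_decide]; exact (Finset.mem_powersetCard.mp hC).2), supp_decide C⟩
  rw [this, Finset.card_powersetCard, Finset.card_univ, Fintype.card_fin]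

lemma hammingDist_eq (ξ ζ : Fin n → Bool) :
    hammingDist ξ ζ = (supp ξ \ supp ζ).card + (supp ζ \ supp ξ).card := by
  rw [← Finset.card_union_of_disjoint disjoint_sdiff_sdiff, hammingDist]
  congr 1
  ext i
  simp only [Finset.mem_filter, Finset.mem_univ, true_and, Finset.mem_union, Finset.mem_sdiff,
    mem_supp]
  cases ξ i <;> cases ζ i <;> simp

lemma measurable_symmMatrix : Measurable (symmMatrix (n := n)) := by
  refine measurable_pi_lambda _ fun i => measurable_pi_lambda _ fun j => ?_
  unfold symmMatrix
  split_ifs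
  · exact measurable_pi_apply _
  · exact measurable_pi_apply _
  · exact measurable_const

variable {P Q : Measure ℝ} {c : ℝ → ℝ}

lemma isProbabilityMeasure_law (h : RegularPair P Q c) (C : Finset (Fin n)) :
    IsProbabilityMeasure (law P Q C) := by
  have := h.prob_right
  exact isProbabilityMeasure_tiltPi h.integrable_exp _

lemma dataLaw_eq (h : RegularPair P Q c) (ξ : Fin n → Bool) :
    dataLaw P Q ξ = (law P Q (supp ξ)).map symmMatrix := by
  have := h.prob_right
  rw [dataLaw, law, tiltPi]
  congr 2
  ext1 e
  by_cases he : ξ e.1.1 = true ∧ ξ e.1.2 = true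
  · rw [if_pos he, indic, if_pos (by simpa using he)]
    exact h.eq_tilted
  · rw [if_neg he, indic, if_neg (by simpa using he)]
    simp

lemma jointLaw_real (h : RegularPair P Q c) (K : ℕ) {S : Set ((Fin n → Bool) × DataMatrix n)}
    (hS : MeasurableSet S) :
    (jointLaw n K P Q).real S = (∑ ξ ∈ communities n K,
      (law P Q (supp ξ)).real {x | (ξ, symmMatrix x) ∈ S}) / (communities n K).card := by
  have := fun C => isProbabilityMeasure_law (n := n) h C
  rw [measureReal_def, jointLaw, Measure.finsetSum_apply, ENNReal.toReal_sum, Finset.sum_div]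
  · refine Finset.sum_congr rfl fun ξ _ => ?_
    have hξ : MeasurableSet (Prod.mk ξ ⁻¹' S) := measurable_prodMk_left hS
    rw [Measure.smul_apply, Measure.map_apply measurable_prodMk_left hS, dataLaw_eq h,
      Measure.map_apply measurable_symmMatrix hξ, smul_eq_mul, ENNReal.toReal_mul,
      ENNReal.toReal_inv, ENNReal.toReal_natCast, measureReal_def, inv_mul_eq_div]
    rfl
  · intro ξ hξ
    have hξ' : MeasurableSet (Prod.mk ξ ⁻¹' S) := measurable_prodMk_left hS
    rw [Measure.smul_apply, Measure.map_apply measurable_prodMk_left hS, dataLaw_eq h,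
      Measure.map_apply measurable_symmMatrix hξ', smul_eq_mul]
    refine ENNReal.mul_ne_top (ENNReal.inv_ne_top.mpr ?_) (measure_ne_top _ _)
    exact_mod_cast (Finset.card_pos.mpr ⟨ξ, hξ⟩).ne'

lemma jointLaw_ne_top (h : RegularPair P Q c) (K : ℕ)
    (S : Set ((Fin n → Bool) × DataMatrix n)) : jointLaw n K P Q S ≠ ⊤ := by
  refine ne_top_of_le_ne_top ?_ (measure_mono (Set.subset_univ S))
  have := fun C => isProbabilityMeasure_law (n := n) h C
  rw [jointLaw, Measure.finsetSum_apply]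
  refine ENNReal.sum_ne_top.mpr fun ξ hξ => ?_
  rw [Measure.smul_apply, Measure.map_apply measurable_prodMk_left .univ, dataLaw_eq h,
    Set.preimage_univ, Measure.map_apply measurable_symmMatrix .univ, smul_eq_mul]
  refine ENNReal.mul_ne_top (ENNReal.inv_ne_top.mpr ?_) (measure_ne_top _ _)
  exact_mod_cast (Finset.card_pos.mpr ⟨ξ, hξ⟩).ne'

/-- Chernoff's bound for a linear combination of the sums over two disjoint sets of
coordinates. -/
lemma tiltPi_real_add_le_exp (h : RegularPair P Q c) (t : Pair n → ℝ) {E F : Finset (Pair n)}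
    (hEF : Disjoint E F) {τ σ : ℝ} (hE : ∀ e ∈ E, t e = τ) (hF : ∀ e ∈ F, t e = σ) (u v s : ℝ) :
    (tiltPi Q (llr P Q) t).real
        {x | s ≤ u * ∑ e ∈ E, llr P Q (x e) + v * ∑ e ∈ F, llr P Q (x e)} ≤
      Real.exp (E.card * (logMgf P Q (τ + u) - logMgf P Q τ) +
        F.card * (logMgf P Q (σ + v) - logMgf P Q σ) - s) := by
  have := h.prob_right
  have h0 := tiltPi_real_le_exp (measurable_llr P Q) h.integrable_exp t
    (fun e => (if e ∈ E then u else 0) + (if e ∈ F then v else 0)) s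
  have h1 : ∀ x : Pair n → ℝ, ∑ e, ((if e ∈ E then u else 0) + (if e ∈ F then v else 0)) *
      llr P Q (x e) = u * ∑ e ∈ E, llr P Q (x e) + v * ∑ e ∈ F, llr P Q (x e) := by
    intro x
    simp [add_mul, ite_mul, Finset.sum_ite_mem, Finset.mul_sum, Finset.sum_add_distrib]
  have h2 : ∑ e, (cgf (llr P Q) Q (t e + ((if e ∈ E then u else 0) + (if e ∈ F then v else 0))) -
      cgf (llr P Q) Q (t e)) = E.card * (logMgf P Q (τ + u) - logMgf P Q τ) +
        F.card * (logMgf P Q (σ + v) - logMgf P Q σ) := by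
    have h3 : ∀ e, cgf (llr P Q) Q (t e + ((if e ∈ E then u else 0) + (if e ∈ F then v else 0))) -
        cgf (llr P Q) Q (t e) = (if e ∈ E then (logMgf P Q (τ + u) - logMgf P Q τ) else 0) +
          (if e ∈ F then (logMgf P Q (σ + v) - logMgf P Q σ) else 0) := by
      intro e
      by_cases h4 : e ∈ E
      · have h5 : e ∉ F := Finset.disjoint_left.mp hEF h4
        simp [h4, h5, hE e h4]
      · by_cases h5 : e ∈ F
        · simp [h4, h5, hF e h5]
        · simp [h4, h5]
    simp_rw [h3]
    simp [Finset.sum_add_distrib, mul_sub]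
  rw [h2] at h0
  simpa only [h1] using h0

lemma law_real_le_of_subset (h : RegularPair P Q c) {C : Finset (Fin n)} {E : Finset (Pair n)}
    (hE : E ⊆ edges C) (u s : ℝ) :
    (law P Q C).real {x | s ≤ u * ∑ e ∈ E, llr P Q (x e)} ≤
      Real.exp (E.card * logMgf P Q (1 + u) - s) := by
  have := tiltPi_real_add_le_exp h (indic (edges C)) (Finset.disjoint_empty_right E) (τ := 1)
    (σ := 0) (fun e he => if_pos (hE he)) (by simp) u 0 s
  simpa [law, h.logMgf_one] using this

lemma law_real_le_of_disjoint (h : RegularPair P Q c) {C : Finset (Fin n)} {E : Finset (Pair n)}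
    (hE : Disjoint E (edges C)) (u s : ℝ) :
    (law P Q C).real {x | s ≤ u * ∑ e ∈ E, llr P Q (x e)} ≤
      Real.exp (E.card * logMgf P Q u - s) := by
  have := tiltPi_real_add_le_exp h (indic (edges C)) (Finset.disjoint_empty_right E) (τ := 0)
    (σ := 0) (fun e he => if_neg (Finset.disjoint_left.mp hE he)) (by simp) u 0 s
  simpa [law, h.logMgf_zero] using this

end Law

/-! ### Maximum likelihood -/

lemma exists_measurable_argmax {α β : Type*} [MeasurableSpace α] [MeasurableSpace β]
    {s : Finset β} (hs : s.Nonempty) (f : β → α → ℝ) (hf : ∀ b, Measurable (f b)) :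
    ∃ g : α → β, Measurable g ∧ ∀ a, g a ∈ s ∧ ∀ b ∈ s, f b a ≤ f (g a) a := by
  -- The running maximum is carried along as a measurable function, so that adding one candidate is
  -- a split along a measurable set.
  suffices h : ∃ (g : α → β) (m : α → ℝ), Measurable g ∧ Measurable m ∧
      ∀ a, g a ∈ s ∧ m a = f (g a) a ∧ ∀ b ∈ s, f b a ≤ m a by
    obtain ⟨g, m, hg, _, h⟩ := h
    exact ⟨g, hg, fun a => ⟨(h a).1, fun b hb => (h a).2.1 ▸ (h a).2.2 b hb⟩⟩
  induction hs using Finset.Nonempty.cons_induction with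
  | singleton b =>
    exact ⟨fun _ => b, f b, measurable_const, hf b, fun a => by simp⟩
  | cons b s hb hs ih =>
    obtain ⟨g, m, hg, hm, h⟩ := ih
    have hset : MeasurableSet {a | m a ≤ f b a} := measurableSet_le hm (hf b)
    refine ⟨fun a => if m a ≤ f b a then b else g a, fun a => if m a ≤ f b a then f b a else m a,
      Measurable.ite hset measurable_const hg, Measurable.ite hset (hf b) hm, fun a => ?_⟩
    obtain ⟨h1, h2, h3⟩ := h a
    by_cases hc : m a ≤ f b a
    · simp only [hc, if_true, Finset.mem_cons, true_or, true_and]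
      rintro b' (rfl | hb')
      · exact le_rfl
      · exact (h3 b' hb').trans hc
    · simp only [hc, if_false, Finset.mem_cons, h1, or_true, true_and]
      refine ⟨h2, ?_⟩
      rintro b' (rfl | hb')
      · exact (not_le.mp hc).le
      · exact h3 b' hb'

/-- A measurable maximum likelihood estimator exists. -/
lemma exists_mle {n K : ℕ} (hK : K ≤ n) {L : ℝ → ℝ} (hL : Measurable L) :
    ∃ g : DataMatrix n → (Fin n → Bool), Measurable g ∧ ∀ x : Pair n → ℝ,
      (supp (g (symmMatrix x))).card = K ∧ ∀ C : Finset (Fin n), C.card = K →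
        score L C x ≤ score L (supp (g (symmMatrix x))) x := by
  have hne : (communities n K).Nonempty := by
    rw [← Finset.card_pos, card_communities]
    exact Nat.choose_pos hK
  obtain ⟨g, hg, h⟩ := exists_measurable_argmax hne
    (fun ξ (A : DataMatrix n) => ∑ e ∈ edges (supp ξ), L (A e.1.1 e.1.2))
    (fun ξ => Finset.measurable_sum _ fun e _ => hL.comp
      ((measurable_pi_apply e.1.2).comp (measurable_pi_apply e.1.1)))
  have hs : ∀ (x : Pair n → ℝ) (e : Pair n), symmMatrix x e.1.1 e.1.2 = x e := by
    intro x e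
    rw [symmMatrix, dif_pos e.2]
  refine ⟨g, hg, fun x => ⟨mem_communities.mp (h _).1, fun C hC => ?_⟩⟩
  have := (h (symmMatrix x)).2 (fun i => decide (i ∈ C))
    (mem_communities.mpr (by rw [supp_decide]; exact hC))
  simpa only [supp_decide, hs, score] using this

/-! ### Union bounds over far and near competitors of the community. -/

section UnionBound

variable {n : ℕ}

/-- The event of a competitor is covered by one depending on the removed set, one on the added set
and one on both. Each pays only for its own number of choices; the full product is charged to `B`
alone. -/
lemma real_exists_le {Ω : Type*} [MeasurableSpace Ω] (μ : Measure Ω) [IsProbabilityMeasure μ]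
    (C : Finset (Fin n)) (s : Finset ℕ) (G : Finset (Fin n) → Set Ω)
    (A D : Finset (Fin n) → Set Ω) (B : Finset (Fin n) → Finset (Fin n) → Set Ω)
    (hG : ∀ C', C'.card = C.card → (C \ C').card ∈ s →
      G C' ⊆ A (C \ C') ∪ (D (C' \ C) ∪ B (C \ C') (C' \ C)))
    (a d b : ℕ → ℝ) (hA : ∀ m ∈ s, ∀ S ⊆ C, S.card = m → μ.real (A S) ≤ a m)
    (hD : ∀ m ∈ s, ∀ T, Disjoint T C → T.card = m → μ.real (D T) ≤ d m)
    (hB : ∀ m ∈ s, ∀ S ⊆ C, ∀ T, Disjoint T C → S.card = m → T.card = m →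
      μ.real (B S T) ≤ b m) :
    μ.real {x | ∃ C', C'.card = C.card ∧ (C \ C').card ∈ s ∧ x ∈ G C'} ≤
      ∑ m ∈ s, ((C.card.choose m : ℝ) * a m + ((n - C.card).choose m : ℝ) * d m +
        (C.card.choose m : ℝ) * ((n - C.card).choose m : ℝ) * b m) := by
  have hcompl : Cᶜ.card = n - C.card := by rw [Finset.card_compl, Fintype.card_fin]
  have hsub : {x | ∃ C', C'.card = C.card ∧ (C \ C').card ∈ s ∧ x ∈ G C'} ⊆
      ⋃ m ∈ s, ((⋃ S ∈ Finset.powersetCard m C, A S) ∪ ((⋃ T ∈ Finset.powersetCard m Cᶜ, D T) ∪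
        ⋃ S ∈ Finset.powersetCard m C, ⋃ T ∈ Finset.powersetCard m Cᶜ, B S T)) := by
    rintro x ⟨C', h1, h2, h3⟩
    have hS : C \ C' ∈ Finset.powersetCard (C \ C').card C :=
      Finset.mem_powersetCard.mpr ⟨Finset.sdiff_subset, rfl⟩
    have hT : C' \ C ∈ Finset.powersetCard (C \ C').card Cᶜ :=
      Finset.mem_powersetCard.mpr ⟨fun i hi => Finset.mem_compl.mpr (Finset.mem_sdiff.mp hi).2,
        Finset.card_sdiff_comm h1⟩
    refine Set.mem_biUnion h2 ?_
    rcases hG C' h1 h2 h3 with h | h | h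
    · exact Or.inl (Set.mem_biUnion hS h)
    · exact Or.inr (Or.inl (Set.mem_biUnion hT h))
    · exact Or.inr (Or.inr (Set.mem_biUnion hS (Set.mem_biUnion hT h)))
  have hdisj : ∀ {m} {T : Finset (Fin n)}, T ∈ Finset.powersetCard m Cᶜ →
      Disjoint T C ∧ T.card = m := by
    intro m T hT
    rw [Finset.mem_powersetCard] at hT
    exact ⟨Finset.disjoint_left.mpr fun i hi => Finset.mem_compl.mp (hT.1 hi), hT.2⟩
  refine (measureReal_mono hsub (measure_ne_top _ _)).trans
    ((measureReal_biUnion_finset_le _ _).trans ?_)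
  refine Finset.sum_le_sum fun m hm => ?_
  refine (measureReal_union_le _ _).trans ?_
  rw [add_assoc]
  refine add_le_add ?_ ((measureReal_union_le _ _).trans (add_le_add ?_ ?_))
  · refine (measureReal_biUnion_finset_le _ _).trans ?_
    refine (Finset.sum_le_card_nsmul _ _ (a m) fun S hS => ?_).trans_eq ?_
    · rw [Finset.mem_powersetCard] at hS
      exact hA m hm S hS.1 hS.2
    · rw [Finset.card_powersetCard, nsmul_eq_mul]
  · refine (measureReal_biUnion_finset_le _ _).trans ?_
    refine (Finset.sum_le_card_nsmul _ _ (d m) fun T hT => ?_).trans_eq ?_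
    · exact hD m hm T (hdisj hT).1 (hdisj hT).2
    · rw [Finset.card_powersetCard, nsmul_eq_mul, hcompl]
  · refine (measureReal_biUnion_finset_le _ _).trans ?_
    refine (Finset.sum_le_card_nsmul _ _ (((n - C.card).choose m : ℝ) * b m)
      fun S hS => ?_).trans_eq ?_
    · rw [Finset.mem_powersetCard] at hS
      refine (measureReal_biUnion_finset_le _ _).trans ?_
      refine (Finset.sum_le_card_nsmul _ _ (b m) fun T hT => ?_).trans_eq ?_
      · exact hB m hm S hS.1 T (hdisj hT).1 hS.2 (hdisj hT).2
      · rw [Finset.card_powersetCard, nsmul_eq_mul, hcompl]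
    · rw [Finset.card_powersetCard, nsmul_eq_mul]
      ring

variable {P Q : Measure ℝ} {c : ℝ → ℝ}

lemma law_real_sum_le (h : RegularPair P Q c) {C : Finset (Fin n)} {E : Finset (Pair n)}
    (hE : E ⊆ edges C) {u : ℝ} (hu : 0 ≤ u) (a : ℝ) :
    (law P Q C).real {x | ∑ e ∈ E, llr P Q (x e) ≤ a} ≤
      Real.exp (E.card * logMgf P Q (1 - u) + u * a) := by
  have := isProbabilityMeasure_law h C
  refine (measureReal_mono ?_).trans ((law_real_le_of_subset h hE (-u) (-(u * a))).trans_eq ?_)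
  · intro x hx
    have hx : ∑ e ∈ E, llr P Q (x e) ≤ a := hx
    have := mul_le_mul_of_nonneg_left hx hu
    change -(u * a) ≤ -u * ∑ e ∈ E, llr P Q (x e)
    linarith
  · rw [sub_neg_eq_add, ← sub_eq_add_neg]

lemma law_real_le_sum (h : RegularPair P Q c) {C : Finset (Fin n)} {E : Finset (Pair n)}
    (hE : Disjoint E (edges C)) {u : ℝ} (hu : 0 ≤ u) (a : ℝ) :
    (law P Q C).real {x | a ≤ ∑ e ∈ E, llr P Q (x e)} ≤
      Real.exp (E.card * logMgf P Q u - u * a) := by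
  have := isProbabilityMeasure_law h C
  refine (measureReal_mono ?_).trans (law_real_le_of_disjoint h hE u (u * a))
  intro x hx
  exact mul_le_mul_of_nonneg_left hx hu

/-- Combines `N ^ m / m!` with `m ^ m / m! ≤ e ^ m`. Replacing `m` by the lower bound `a` frees the
base from `m`, so the sums over `m` become geometric. -/
lemma choose_le_exp_div_pow {N m : ℕ} {a : ℝ} (ha : 0 < a) (h : a ≤ m) :
    (N.choose m : ℝ) ≤ (Real.exp 1 * N / a) ^ m := by
  have h1 : (N.choose m : ℝ) ≤ (N : ℝ) ^ m / m.factorial := Nat.choose_le_pow_div m N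
  have hm : (0 : ℝ) < m := ha.trans_le h
  have h2 : (m : ℝ) ^ m / m.factorial ≤ Real.exp 1 ^ m := by
    rw [← Real.exp_nat_mul, mul_one]
    exact Real.pow_div_factorial_le_exp _ hm.le m
  calc (N.choose m : ℝ) ≤ (N : ℝ) ^ m / m.factorial := h1
    _ = (N / m : ℝ) ^ m * ((m : ℝ) ^ m / m.factorial) := by
      rw [div_pow]; field_simp
    _ ≤ (N / m : ℝ) ^ m * Real.exp 1 ^ m := by gcongr
    _ = (Real.exp 1 * N / m) ^ m := by rw [← mul_pow]; ring
    _ ≤ _ := by gcongr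

lemma sum_pow_le {y : ℝ} (h0 : 0 ≤ y) (h1 : y ≤ 1 / 2) {s : Finset ℕ} (hs : ∀ m ∈ s, 1 ≤ m) :
    ∑ m ∈ s, y ^ m ≤ 2 * y := by
  have hsum : Summable fun m : ℕ => y * y ^ m :=
    (summable_geometric_of_lt_one h0 (by linarith)).mul_left y
  have : ∑ m ∈ s, y ^ m = ∑ m ∈ s.image (fun m => m - 1), y * y ^ m := by
    rw [Finset.sum_image]
    · refine Finset.sum_congr rfl fun m hm => ?_
      rw [← pow_succ', Nat.sub_add_cancel (hs m hm)]
    · intro a ha b hb hab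
      have := hs a ha; have := hs b hb
      simp only at hab
      omega
  rw [this]
  refine (hsum.sum_le_tsum _ fun m _ => by positivity).trans ?_
  rw [tsum_mul_left, tsum_geometric_of_lt_one h0 (by linarith), mul_comm]
  refine mul_le_mul_of_nonneg_right ?_ h0
  rw [inv_le_comm₀ (by linarith) (by norm_num)]
  linarith

/-- A set far away from the community rarely beats its score. -/
lemma law_real_exists_far_le (h : RegularPair P Q c) {C : Finset (Fin n)} (hC : 1 ≤ C.card)
    {ε η : ℝ} (hε : 0 < ε) (hη0 : 0 ≤ η) (hη1 : η ≤ 1) {x₁ x₂ : ℝ}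
    (hx₁ : x₁ = Real.exp 1 / ε *
      Real.exp (-((C.card - 1) / 2 * (kl P Q * η ^ 2 / (4 * c 1)))))
    (hx₂ : x₂ = Real.exp 1 / ε * (Real.exp 1 / ε) * (n / C.card) *
      Real.exp (-((C.card - 1) / 2 * ((1 - η) * kl P Q))))
    (h₁ : x₁ ≤ 1 / 2) (h₂ : x₂ ≤ 1 / 2) :
    (law P Q C).real {x | ∃ C', C'.card = C.card ∧ ε * C.card < (C \ C').card ∧
      score (llr P Q) C x ≤ score (llr P Q) C' x} ≤ 2 * x₁ + 2 * x₂ := by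
  have := isProbabilityMeasure_law h C
  set K := C.card with hK
  set D := kl P Q with hD
  set ψ := logMgf P Q with hψ
  have hK0 : (1 : ℝ) ≤ K := by exact_mod_cast hC
  have hc := h.one_le 1
  have hDpos : 0 < D := h.kl_pos
  set N : ℕ → ℝ := fun m => (m : ℝ) * (2 * K - m - 1) / 2 with hN
  set s := (Finset.range (K + 1)).filter fun m : ℕ => ε * K < m with hs
  -- The minimiser of `-u η D + c D u²`, with minimum `-D η² / (4 c)`.
  set u := η / (2 * c 1) with hu
  have hu0 : 0 ≤ u := by positivity
  have hu1 : u ≤ 1 := by rw [hu, div_le_one (by positivity)]; linarith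
  have hms : ∀ m ∈ s, ε * K < m ∧ m ≤ K := by
    intro m hm
    rw [hs, Finset.mem_filter, Finset.mem_range] at hm
    exact ⟨hm.2, by omega⟩
  have hNm : ∀ m ∈ s, (m : ℝ) * ((K - 1) / 2) ≤ N m := by
    intro m hm
    have h1 : (m : ℝ) ≤ K := by exact_mod_cast (hms m hm).2
    have h0 : (0 : ℝ) ≤ m := Nat.cast_nonneg m
    simp only [hN]
    nlinarith
  have hψu : ψ (1 - u) + u * ((1 - η) * D) ≤ -(D * η ^ 2 / (4 * c 1)) := by
    have h1 := h.logMgf_one_sub_le hu0 hu1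
    have : -(u * D) + c 1 * D * u ^ 2 + u * ((1 - η) * D) = -(D * η ^ 2 / (4 * c 1)) := by
      rw [hu]; field_simp; ring
    linarith
  -- Both sums are compared with `(1 - η) N D`, just below the mean `N D` of the lost pairs. No
  -- event depending on the added set alone is needed. The gained pairs are tilted by 1, where `ψ`
  -- vanishes, which gives the full exponent `(1 - η) N D`.
  have key := real_exists_le (law P Q C) C s
    (fun C' => {x | score (llr P Q) C x ≤ score (llr P Q) C' x})
    (fun S => {x | ∑ e ∈ edges C \ edges (C \ S), llr P Q (x e) ≤ N S.card * ((1 - η) * D)})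
    (fun _ => ∅)
    (fun S T => {x | N S.card * ((1 - η) * D) ≤
      ∑ e ∈ edges T ∪ cross T (C \ S), llr P Q (x e)})
    (by
      intro C' hC' _ x hx
      have hx : score (llr P Q) C x ≤ score (llr P Q) C' x := hx
      have h1 := score_sub_score (llr P Q) C C' x
      rw [edges_sdiff_edges C C', edges_sdiff_edges_eq_union] at h1
      rcases le_total (∑ e ∈ edges C \ edges (C \ (C \ C')), llr P Q (x e))
        (N (C \ C').card * ((1 - η) * D)) with h2 | h2
      · exact Or.inl h2
      · refine Or.inr (Or.inr ?_)
        change N (C \ C').card * ((1 - η) * D) ≤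
          ∑ e ∈ edges (C' \ C) ∪ cross (C' \ C) (C \ (C \ C')), llr P Q (x e)
        linarith)
    (fun m => Real.exp (-((K - 1) / 2 * (D * η ^ 2 / (4 * c 1)))) ^ m) (fun _ => 0)
    (fun m => Real.exp (-((K - 1) / 2 * ((1 - η) * D))) ^ m)
    (by
      intro m hm S hS hSm
      refine (law_real_sum_le h Finset.sdiff_subset hu0 _).trans ?_
      have hcard : ((edges C \ edges (C \ S)).card : ℝ) = N m := by
        rw [card_edges_sdiff, Finset.sdiff_sdiff_eq_self hS, hSm]
      rw [hcard, hSm, ← Real.exp_nat_mul, Real.exp_le_exp]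
      have h1 := mul_le_mul_of_nonneg_left hψu ((by positivity :
        (0 : ℝ) ≤ m * ((K - 1) / 2)).trans (hNm m hm) |>.trans_eq rfl)
      have h2 := mul_le_mul_of_nonneg_right (hNm m hm)
        (by positivity : 0 ≤ D * η ^ 2 / (4 * c 1))
      linarith)
    (by intro m _ T _ _; simp)
    (by
      intro m hm S hS T hT hSm hTm
      have hdis : Disjoint (edges T ∪ cross T (C \ S)) (edges C) := by
        rw [Finset.disjoint_left] at hT ⊢
        intro e he he'
        simp only [Finset.mem_union, mem_edges, mem_cross] at he he'
        have h1 := @hT e.1.1; have h2 := @hT e.1.2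
        tauto
      refine (law_real_le_sum h hdis zero_le_one _).trans ?_
      rw [h.logMgf_one, mul_zero, zero_sub, one_mul, hSm, ← Real.exp_nat_mul, Real.exp_le_exp]
      have h2 := mul_le_mul_of_nonneg_right (hNm m hm)
        (mul_nonneg (sub_nonneg.mpr hη1) hDpos.le)
      linarith)
  have hsub : {x | ∃ C', C'.card = K ∧ ε * K < (C \ C').card ∧
      score (llr P Q) C x ≤ score (llr P Q) C' x} ⊆
      {x | ∃ C', C'.card = K ∧ (C \ C').card ∈ s ∧
        x ∈ {x | score (llr P Q) C x ≤ score (llr P Q) C' x}} := by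
    rintro x ⟨C', h1, h2, h3⟩
    refine ⟨C', h1, ?_, h3⟩
    rw [hs, Finset.mem_filter, Finset.mem_range, Nat.lt_succ_iff]
    exact ⟨Finset.card_le_card Finset.sdiff_subset, h2⟩
  refine (measureReal_mono hsub).trans (key.trans ?_)
  have hx₁0 : 0 ≤ x₁ := by rw [hx₁]; positivity
  have hx₂0 : 0 ≤ x₂ := by rw [hx₂]; positivity
  have hs1 : ∀ m ∈ s, 1 ≤ m := by
    intro m hm
    have : (0 : ℝ) < m := lt_of_le_of_lt (by positivity) (hms m hm).1
    exact_mod_cast this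
  refine (Finset.sum_le_sum (g := fun m => x₁ ^ m + x₂ ^ m) fun m hm => ?_).trans ?_
  · have hεK : 0 < ε * K := by positivity
    have h1 : (K.choose m : ℝ) ≤ (Real.exp 1 / ε) ^ m := by
      refine (choose_le_exp_div_pow hεK (hms m hm).1.le).trans_eq ?_
      congr 1
      field_simp
    have h2 : ((n - K).choose m : ℝ) ≤ (Real.exp 1 / ε * (n / K)) ^ m := by
      refine (choose_le_exp_div_pow hεK (hms m hm).1.le).trans ?_
      gcongr
      rw [div_mul_div_comm]
      gcongr
      exact_mod_cast Nat.sub_le n K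
    rw [mul_zero, add_zero, hx₁, hx₂, mul_pow, mul_pow, mul_assoc (Real.exp 1 / ε), mul_pow]
    gcongr
  · rw [Finset.sum_add_distrib]
    exact add_le_add (sum_pow_le hx₁0 h₁ hs1) (sum_pow_le hx₂0 h₂ hs1)

set_option maxHeartbeats 1000000 in
/-- A set close to the community, but different from it, rarely reaches its score. -/
lemma law_real_exists_near_le (h : RegularPair P Q c) {C : Finset (Fin n)} (hC : 1 ≤ C.card)
    {t θ r c₀ G η ε y : ℝ} (ht : t ∈ Set.Icc (0 : ℝ) 1) (hθ : C.card * θ = Real.log (n / C.card))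
    (hr : 1 < r) (hW₁ : r * Real.log n ≤ C.card * (t * θ - logMgf P Q t))
    (hW₂ : c₀ * (C.card * kl P Q) ≤ C.card * (t * θ - logMgf P Q t))
    (hW₃ : C.card * (t * θ - logMgf P Q t) ≤ C.card * kl P Q)
    (hη : 0 < η) (hε : 0 < ε) (hc₀ : ε + η ≤ (r - 1) / (2 * r) * c₀)
    (hG : logMgf P Q (4 / η) ≤ G * kl P Q) (hG' : logMgf P Q (-(4 / η)) ≤ G * kl P Q)
    (hG0 : 0 ≤ G) (hεG : 2 * ε * G ≤ 1) (hy : y = Real.exp (-((r - 1) / 2 * Real.log n)))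
    (hy' : y ≤ 1 / 2) :
    (law P Q C).real {x | ∃ C', C'.card = C.card ∧ (1 ≤ (C \ C').card ∧
      ((C \ C').card : ℝ) ≤ ε * C.card) ∧
      score (llr P Q) C x ≤ score (llr P Q) C' x} ≤ 6 * y := by
  have := isProbabilityMeasure_law h C
  set K := C.card with hK
  set D := kl P Q with hD
  set ψ := logMgf P Q with hψ
  set W := (K : ℝ) * (t * θ - ψ t) with hW
  have hK0 : (1 : ℝ) ≤ K := by exact_mod_cast hC
  have hDpos : 0 < D := h.kl_pos
  have hn1 : 1 ≤ n := hC.trans ((Finset.card_le_univ C).trans_eq (Fintype.card_fin n))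
  have hn0 : (1 : ℝ) ≤ n := by exact_mod_cast hn1
  have hlogn : 0 ≤ Real.log n := Real.log_nonneg hn0
  have hW0 : 0 ≤ W := le_trans (by positivity) hW₁
  rw [Real.log_div (by positivity) (by positivity)] at hθ
  -- A share `(r - 1) / (2 r)` of `W` pays for the losses in `ε` and `η`; the rest is still at least
  -- `(r + 1) / 2 * log n`.
  have hmain : Real.log n - W + (ε + η) * (K * D) ≤ -((r - 1) / 2 * Real.log n) := by
    have h1 : (ε + η) * (K * D) ≤ (r - 1) / (2 * r) * W := by
      calc (ε + η) * (K * D) ≤ (r - 1) / (2 * r) * c₀ * (K * D) := by gcongr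
        _ = (r - 1) / (2 * r) * (c₀ * (K * D)) := by ring
        _ ≤ _ := mul_le_mul_of_nonneg_left hW₂ (div_nonneg (by linarith) (by linarith))
    have h2 : (1 - (r - 1) / (2 * r)) * (r * Real.log n) ≤ (1 - (r - 1) / (2 * r)) * W := by
      refine mul_le_mul_of_nonneg_left hW₁ ?_
      rw [sub_nonneg, div_le_one (by linarith)]; linarith
    have h3 : (1 - (r - 1) / (2 * r)) * (r * Real.log n) =
        Real.log n + (r - 1) / 2 * Real.log n := by
      have : r ≠ 0 := by linarith
      field_simp; ring
    linarith
  set s := (Finset.range (n + 1)).filter fun m : ℕ => 1 ≤ m ∧ (m : ℝ) ≤ ε * K with hs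
  have hms : ∀ m ∈ s, (1 : ℝ) ≤ m ∧ (m : ℝ) ≤ ε * K := by
    intro m hm
    rw [hs, Finset.mem_filter] at hm
    exact ⟨by exact_mod_cast hm.2.1, hm.2.2⟩
  have ht0 := ht.1
  have ht1 := ht.2
  have hψ0 : ψ t ≤ 0 := h.logMgf_nonpos ht
  have hψ1 : -ψ t ≤ D := by
    have := h.sub_one_mul_le_logMgf t
    nlinarith
  -- Three thresholds: `m (K θ + η K D)` for the lost pairs, `m K θ` for the pairs between the added
  -- set and `C`, and the gap `m η K D` for the correction. The last is scaled by the tilt `4 / η`,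
  -- so that the gap is worth `4 m K D`.
  have key := real_exists_le (law P Q C) C s
    (fun C' => {x | score (llr P Q) C x ≤ score (llr P Q) C' x})
    (fun S => {x | ∑ e ∈ edges C \ edges (C \ S), llr P Q (x e) ≤
      S.card * (K * θ + η * (K * D))})
    (fun T => {x | T.card * (K * θ) ≤ ∑ e ∈ cross T C, llr P Q (x e)})
    (fun S T => {x | 4 / η * (S.card * (η * (K * D))) ≤
      4 / η * ∑ e ∈ edges T, llr P Q (x e) + -(4 / η) * ∑ e ∈ cross T S, llr P Q (x e)})
    (by
      intro C' hC' _ x hx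
      have hx : score (llr P Q) C x ≤ score (llr P Q) C' x := hx
      have h1 := score_sub_score (llr P Q) C C' x
      rw [edges_sdiff_edges C C', sum_edges_sdiff_edges] at h1
      rcases le_total (∑ e ∈ edges C \ edges (C \ (C \ C')), llr P Q (x e))
        ((C \ C').card * (K * θ + η * (K * D))) with h2 | h2
      · exact Or.inl h2
      · rcases le_total (((C' \ C).card : ℝ) * (K * θ))
          (∑ e ∈ cross (C' \ C) C, llr P Q (x e)) with h3 | h3
        · exact Or.inr (Or.inl h3)
        · refine Or.inr (Or.inr ?_)
          change 4 / η * ((C \ C').card * (η * (K * D))) ≤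
            4 / η * ∑ e ∈ edges (C' \ C), llr P Q (x e) +
              -(4 / η) * ∑ e ∈ cross (C' \ C) (C \ C'), llr P Q (x e)
          rw [Finset.card_sdiff_comm hC'] at h3
          rw [neg_mul, ← sub_eq_add_neg, ← mul_sub]
          refine mul_le_mul_of_nonneg_left ?_ (by positivity)
          linarith)
    -- `K θ = log n - log K`; the term `-log K` cancels the at most `K ^ m` choices of the removed
    -- set.
    (fun m => Real.exp (Real.log n - W + (ε + η) * (K * D) - Real.log K) ^ m)
    (fun m => Real.exp (-W) ^ m)
    (fun m => Real.exp (-(3 * (K * D))) ^ m)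
    (by
      intro m hm S hS hSm
      obtain ⟨hm1, hm2⟩ := hms m hm
      refine (law_real_sum_le h Finset.sdiff_subset (sub_nonneg.mpr ht1) _).trans ?_
      rw [card_edges_sdiff, Finset.sdiff_sdiff_eq_self hS, hSm, ← Real.exp_nat_mul,
        Real.exp_le_exp, sub_sub_cancel]
      change (m : ℝ) * (2 * K - m - 1) / 2 * ψ t + _ ≤ _
      have h1 : (m : ℝ) * (2 * K - m - 1) / 2 * ψ t ≤ m * (K * ψ t + ε * (K * D)) := by
        have h2 : (m : ℝ) * ((m + 1) / 2 * -ψ t) ≤ m * (ε * K * D) := by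
          refine mul_le_mul_of_nonneg_left ?_ (by linarith)
          exact mul_le_mul (by linarith) hψ1 (by linarith) (by positivity)
        linarith
      have h3 : (1 - t) * (m * (K * θ + η * (K * D))) ≤
          m * (K * θ - t * (K * θ) + η * (K * D)) := by
        have : 0 ≤ (m : ℝ) * (t * (η * (K * D))) := by positivity
        linarith
      have h4 : (m : ℝ) * (K * ψ t + ε * (K * D)) + m * (K * θ - t * (K * θ) + η * (K * D)) =
          m * (Real.log n - W + (ε + η) * (K * D) - Real.log K) := by
        rw [hW]; linear_combination (m : ℝ) * hθ
      linarith)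
    (by
      intro m hm T hT hTm
      have hdis : Disjoint (cross T C) (edges C) := by
        rw [Finset.disjoint_left] at hT ⊢
        intro e he he'
        simp only [mem_edges, mem_cross] at he he'
        have h1 := @hT e.1.1; have h2 := @hT e.1.2
        tauto
      refine (law_real_le_sum h hdis ht0 _).trans_eq ?_
      rw [card_cross hT, hTm, ← Real.exp_nat_mul]
      congr 1
      push_cast
      rw [hW]
      ring)
    (by
      intro m hm S hS T hT hSm hTm
      obtain ⟨hm1, hm2⟩ := hms m hm
      have hTS : Disjoint T S := hT.mono_right hS
      have h1 := tiltPi_real_add_le_exp h (indic (edges C)) (disjoint_edges_cross hTS)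
        (τ := 0) (σ := 0) (by
          intro e he
          refine if_neg fun he' => ?_
          rw [mem_edges] at he he'
          exact Finset.disjoint_left.mp hT he.1 he'.1)
        (by
          intro e he
          refine if_neg fun he' => ?_
          rw [mem_cross] at he
          rw [mem_edges] at he'
          rcases he with he | he
          · exact Finset.disjoint_left.mp hT he.1 he'.1
          · exact Finset.disjoint_left.mp hT he.2 he'.2)
        (4 / η) (-(4 / η)) (4 / η * (S.card * (η * (K * D))))
      refine h1.trans ?_
      rw [card_cross hTS, card_edges, hSm, hTm, ← Real.exp_nat_mul, Real.exp_le_exp, zero_add,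
        zero_add, h.logMgf_zero, sub_zero, sub_zero]
      have hch : ((m.choose 2 : ℕ) : ℝ) ≤ (m : ℝ) * m := by
        have := Nat.choose_le_pow m 2
        rw [← sq]; exact_mod_cast this
      have h2 : ((m.choose 2 : ℕ) : ℝ) * logMgf P Q (4 / η) ≤ m * m * (G * D) :=
        (mul_le_mul_of_nonneg_left hG (Nat.cast_nonneg _)).trans
          (mul_le_mul_of_nonneg_right hch (by positivity))
      have h3 : ((m * m : ℕ) : ℝ) * logMgf P Q (-(4 / η)) ≤ m * m * (G * D) := by
        rw [Nat.cast_mul]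
        exact mul_le_mul_of_nonneg_left hG' (by positivity)
      -- There are at most `2 m²` correction pairs; by `m ≤ ε K` and `2 ε G ≤ 1` their cumulants use
      -- up one of the four units `m K D`.
      have h4 : (m : ℝ) * m * (G * D) * 2 ≤ m * (K * D) := by
        calc (m : ℝ) * m * (G * D) * 2 ≤ m * (ε * K) * (G * D) * 2 := by gcongr
          _ = m * (K * D) * (2 * ε * G) := by ring
          _ ≤ m * (K * D) * 1 := by gcongr
          _ = _ := mul_one _
      have h5 : 4 / η * (m * (η * (K * D))) = 4 * (m * (K * D)) := by field_simp
      rw [h5]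
      linarith)
  have hsub : {x | ∃ C', C'.card = K ∧ (1 ≤ (C \ C').card ∧ ((C \ C').card : ℝ) ≤ ε * K) ∧
      score (llr P Q) C x ≤ score (llr P Q) C' x} ⊆
      {x | ∃ C', C'.card = K ∧ (C \ C').card ∈ s ∧
        x ∈ {x | score (llr P Q) C x ≤ score (llr P Q) C' x}} := by
    rintro x ⟨C', h1, h2, h3⟩
    refine ⟨C', h1, ?_, h3⟩
    rw [hs, Finset.mem_filter, Finset.mem_range, Nat.lt_succ_iff]
    exact ⟨(Finset.card_le_univ _).trans_eq (Fintype.card_fin n), h2⟩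
  refine (measureReal_mono hsub).trans (key.trans ?_)
  have hy0 : 0 ≤ y := by rw [hy]; positivity
  have hs1 : ∀ m ∈ s, 1 ≤ m := fun m hm => by exact_mod_cast (hms m hm).1
  refine (Finset.sum_le_sum (g := fun m => y ^ m + y ^ m + y ^ m) fun m hm => ?_).trans ?_
  · have e1 : (K.choose m : ℝ) ≤ Real.exp (Real.log K) ^ m := by
      rw [Real.exp_log (by positivity)]
      exact_mod_cast Nat.choose_le_pow K m
    have e2 : ((n - K).choose m : ℝ) ≤ Real.exp (Real.log n) ^ m := by
      rw [Real.exp_log (by positivity)]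
      have h1 : ((n - K).choose m : ℝ) ≤ ((n - K : ℕ) : ℝ) ^ m := by
        exact_mod_cast Nat.choose_le_pow (n - K) m
      refine h1.trans ?_
      gcongr
      exact Nat.sub_le n K
    have hlogK : Real.log K ≤ Real.log n :=
      Real.log_le_log (by positivity) (by
        exact_mod_cast (Finset.card_le_univ C).trans_eq (Fintype.card_fin n))
    refine add_le_add (add_le_add ?_ ?_) ?_
    · refine (mul_le_mul_of_nonneg_right e1 (by positivity)).trans ?_
      rw [← mul_pow, ← Real.exp_add, hy]
      gcongr
      linarith
    · refine (mul_le_mul_of_nonneg_right e2 (by positivity)).trans ?_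
      rw [← mul_pow, ← Real.exp_add, hy]
      gcongr
      have : 0 ≤ (ε + η) * (K * D) := by positivity
      linarith
    · refine (mul_le_mul_of_nonneg_right (mul_le_mul e1 e2 (by positivity) (by positivity))
        (by positivity)).trans ?_
      rw [← mul_pow, ← mul_pow, ← Real.exp_add, ← Real.exp_add, hy]
      gcongr
      have : 0 ≤ (r - 1) * Real.log n := mul_nonneg (by linarith) hlogn
      linarith
  · rw [Finset.sum_add_distrib, Finset.sum_add_distrib]
    have := sum_pow_le hy0 hy' hs1
    linarith

end UnionBound

/-! ### Recovery -/

section Joint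

variable {n : ℕ} {P Q : Measure ℝ} {c : ℝ → ℝ}

lemma measurableSet_est {g : DataMatrix n → (Fin n → Bool)} (hg : Measurable g)
    (p : (Fin n → Bool) → Prop) : MeasurableSet {x : Pair n → ℝ | p (g (symmMatrix x))} :=
  (hg.comp measurable_symmMatrix) (MeasurableSet.of_discrete (s := {ζ | p ζ}))

lemma jointLaw_real_est (h : RegularPair P Q c) (K : ℕ) {g : DataMatrix n → (Fin n → Bool)}
    (hg : Measurable g) (p : (Fin n → Bool) → (Fin n → Bool) → Prop) :
    (jointLaw n K P Q).real {z | p z.1 (g z.2)} = (∑ ξ ∈ communities n K,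
      (law P Q (supp ξ)).real {x | p ξ (g (symmMatrix x))}) / (communities n K).card :=
  jointLaw_real h K ((measurable_fst.prodMk (hg.comp measurable_snd))
    (MeasurableSet.of_discrete (s := {w : (Fin n → Bool) × (Fin n → Bool) | p w.1 w.2})))

lemma jointLaw_real_est_le (h : RegularPair P Q c) (K : ℕ) {g : DataMatrix n → (Fin n → Bool)}
    (hg : Measurable g) (p : (Fin n → Bool) → (Fin n → Bool) → Prop) {b : ℝ} (hb : 0 ≤ b)
    (hp : ∀ ξ ∈ communities n K, (law P Q (supp ξ)).real {x | p ξ (g (symmMatrix x))} ≤ b) :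
    (jointLaw n K P Q).real {z | p z.1 (g z.2)} ≤ b := by
  rw [jointLaw_real_est h K hg]
  refine div_le_of_le_mul₀ (Nat.cast_nonneg _) hb ?_
  refine (Finset.sum_le_card_nsmul _ _ b hp).trans_eq ?_
  rw [nsmul_eq_mul, mul_comm]

end Joint

lemma tendsto_jointLaw_iff {K : ℕ → ℕ} {P Q : ℕ → Measure ℝ} {c : ℝ → ℝ}
    (h : ∀ n, RegularPair (P n) (Q n) c) (S : ∀ n, Set ((Fin n → Bool) × DataMatrix n)) :
    Tendsto (fun n => jointLaw n (K n) (P n) (Q n) (S n)) atTop (𝓝 0) ↔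
      Tendsto (fun n => (jointLaw n (K n) (P n) (Q n)).real (S n)) atTop (𝓝 0) := by
  rw [← ENNReal.tendsto_toReal_iff (fun n => jointLaw_ne_top (h n) _ _) ENNReal.zero_ne_top]
  rfl

/-- A possibly infinite supremum above a real bound is witnessed by one real tilt, so the rest of
the argument stays in the reals. -/
lemma lt_votingRatio {K : ℕ → ℕ} {P Q : ℕ → Measure ℝ} {n : ℕ} (hn : 0 < Real.log n)
    (hK : 0 < K n) {r : ℝ} (h : (r : EReal) < votingRatio K P Q n) :
    ∃ t : ℝ, r * Real.log n < K n * (t * (1 / (K n : ℝ) * Real.log ((n : ℝ) / (K n : ℝ))) -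
      logMgf (P n) (Q n) t) := by
  by_contra! hcon
  have hK' : (0 : ℝ) < K n := by exact_mod_cast hK
  rw [votingRatio, EReal.lt_div_iff (by exact_mod_cast hn) (EReal.coe_ne_top _)] at h
  refine absurd h (not_lt.mpr ?_)
  have h1 : rateQ (P n) (Q n) (1 / (K n : ℝ) * Real.log ((n : ℝ) / (K n : ℝ))) ≤
      ((r * Real.log n / K n : ℝ) : EReal) := by
    refine iSup_le fun t => ?_
    rw [EReal.coe_le_coe_iff, le_div_iff₀ hK', mul_comm]
    exact hcon t
  calc _ ≤ ((K n : ℝ) : EReal) * ((r * Real.log n / K n : ℝ) : EReal) :=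
        mul_le_mul_of_nonneg_left h1 (by exact_mod_cast hK'.le)
    _ = _ := by
      rw [← EReal.coe_mul, ← EReal.coe_mul, mul_div_cancel₀ _ hK'.ne']

lemma le_of_votingRatio_lt {K : ℕ → ℕ} {P Q : ℕ → Measure ℝ} {n : ℕ} (hn : 0 < Real.log n)
    {r : ℝ} (h : votingRatio K P Q n < r) (t : ℝ) :
    K n * (t * (1 / (K n : ℝ) * Real.log ((n : ℝ) / (K n : ℝ))) -
      logMgf (P n) (Q n) t) ≤ r * Real.log n := by
  rw [votingRatio, EReal.div_lt_iff (by exact_mod_cast hn) (EReal.coe_ne_top _)] at h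
  have h1 : ((t * (1 / (K n : ℝ) * Real.log ((n : ℝ) / (K n : ℝ))) -
      logMgf (P n) (Q n) t : ℝ) : EReal) ≤
      rateQ (P n) (Q n) (1 / (K n : ℝ) * Real.log ((n : ℝ) / (K n : ℝ))) :=
    le_iSup (fun t : ℝ => ((t * (1 / (K n : ℝ) * Real.log ((n : ℝ) / (K n : ℝ))) -
      logMgf (P n) (Q n) t : ℝ) : EReal)) t
  have h2 := (mul_le_mul_of_nonneg_left h1
    (by exact_mod_cast (Nat.cast_nonneg (K n) : (0 : ℝ) ≤ K n) : (0 : EReal) ≤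
      ((K n : ℝ) : EReal))).trans h.le
  rw [← EReal.coe_mul, ← EReal.coe_mul, EReal.coe_le_coe_iff] at h2
  exact h2

/-- Near-maximizers of the large deviations exponent may be taken in `[0, 1]`. -/
lemma RegularPair.exists_rate {P Q : Measure ℝ} {c : ℝ → ℝ} (h : RegularPair P Q c)
    {θ k a : ℝ} (hk : 0 < k) (hθ0 : 0 ≤ θ) (hθ1 : θ ≤ kl P Q)
    (ha : ∃ t, a < k * (t * θ - logMgf P Q t)) :
    ∃ t ∈ Set.Icc (0 : ℝ) 1, a ≤ k * (t * θ - logMgf P Q t) ∧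
      1 / (4 * c 1) * (k * kl P Q) ≤ k * (t * θ - logMgf P Q t) ∧
      k * (t * θ - logMgf P Q t) ≤ k * kl P Q := by
  have hup : ∀ t ∈ Set.Icc (0 : ℝ) 1, k * (t * θ - logMgf P Q t) ≤ k * kl P Q := by
    intro t ht
    refine mul_le_mul_of_nonneg_left ?_ hk.le
    have h1 := h.sub_one_mul_le_logMgf t
    have h2 := mul_le_mul_of_nonneg_left hθ1 ht.1
    linarith
  have h1 : ∃ t ∈ Set.Icc (0 : ℝ) 1, a ≤ k * (t * θ - logMgf P Q t) := by
    -- For `t < 0`, `ψ t ≥ 0` and `θ ≥ 0` make `0` no worse; for `t > 1`, the tangent of `ψ` at 1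
    -- and `θ ≤ D` make `1` no worse.
    obtain ⟨t, ht⟩ := ha
    rcases lt_or_ge t 0 with ht0 | ht0
    · refine ⟨0, by simp, ht.le.trans (mul_le_mul_of_nonneg_left ?_ hk.le)⟩
      have := h.logMgf_nonneg ht0.le
      rw [h.logMgf_zero]
      nlinarith
    · rcases lt_or_ge 1 t with ht1 | ht1
      · refine ⟨1, by simp, ht.le.trans (mul_le_mul_of_nonneg_left ?_ hk.le)⟩
        have := h.sub_one_mul_le_logMgf t
        rw [h.logMgf_one]
        nlinarith
      · exact ⟨t, ⟨ht0, ht1⟩, ht.le⟩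
  obtain ⟨t, ht, hat⟩ := h1
  -- A second candidate with value at least `k D / (4 c)`; the better of the two satisfies both
  -- lower bounds.
  obtain ⟨s, hs, hs'⟩ := h.exists_logMgf_le
  have hsW : 1 / (4 * c 1) * (k * kl P Q) ≤ k * (s * θ - logMgf P Q s) := by
    have h2 : 0 ≤ s * θ := mul_nonneg hs.1 hθ0
    calc 1 / (4 * c 1) * (k * kl P Q) = k * (kl P Q / (4 * c 1)) := by ring
      _ ≤ _ := mul_le_mul_of_nonneg_left (by linarith) hk.le
  rcases le_total (k * (t * θ - logMgf P Q t)) (k * (s * θ - logMgf P Q s)) with h3 | h3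
  · exact ⟨s, hs, hat.trans h3, hsW, hup s hs⟩
  · exact ⟨t, ht, hat, hsW.trans h3, hup t ht⟩

/-- The standing assumptions on the community sizes. -/
structure SizeBound (K : ℕ → ℕ) (κ : ℝ) : Prop where
  pos : 0 < κ
  lt_one : κ < 1
  eventually : ∀ᶠ n in atTop, 2 ≤ K n ∧ (K n : ℝ) ≤ κ * n ∧ 2 ≤ n

lemma exists_sizeBound {K : ℕ → ℕ} (hK : ∀ᶠ n in atTop, 2 ≤ K n)
    (hKn : ∃ c : ℝ, c < 1 ∧ ∀ᶠ n in atTop, (K n : ℝ) / (n : ℝ) ≤ c) : ∃ κ, SizeBound K κ := by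
  obtain ⟨c, hc, h⟩ := hKn
  refine ⟨max c (1 / 2), ⟨by positivity, max_lt hc (by norm_num), ?_⟩⟩
  filter_upwards [hK, h, eventually_ge_atTop 2] with n h1 h2 h3
  have h4 : (0 : ℝ) < n := by exact_mod_cast (by omega : 0 < n)
  rw [div_le_iff₀ h4] at h2
  exact ⟨h1, h2.trans (mul_le_mul_of_nonneg_right (le_max_left _ _) h4.le), h3⟩

lemma SizeBound.log_div_ge {κ : ℝ} {k n : ℕ} (h0 : 0 < κ) (hk : 2 ≤ k)
    (h : (k : ℝ) ≤ κ * n) : Real.log (1 / κ) ≤ Real.log (n / k) := by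
  have hk' : (0 : ℝ) < k := by exact_mod_cast (by omega : 0 < k)
  refine Real.log_le_log (by positivity) ?_
  rw [div_le_div_iff₀ h0 hk']
  linarith

lemma SizeBound.le_of_le {κ : ℝ} {k n : ℕ} (h1 : κ < 1) (h : (k : ℝ) ≤ κ * n) : k ≤ n := by
  have : (k : ℝ) ≤ n := h.trans (by nlinarith [(Nat.cast_nonneg n : (0 : ℝ) ≤ n)])
  exact_mod_cast this

/-! ### Recovery by maximum likelihood. -/

section Achievability

variable {K : ℕ → ℕ} {P Q : ℕ → Measure ℝ} {c : ℝ → ℝ} {κ : ℝ}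

lemma exists_info_bound (hs : SizeBound K κ) {a : ℝ}
    (h : (a : EReal) < liminf (infoRatio K P Q) atTop) :
    ∃ r > a, ∀ᶠ n in atTop, r * Real.log (n / K n) ≤ ((K n : ℝ) - 1) * kl (P n) (Q n) := by
  obtain ⟨r, hr1, hr2⟩ := EReal.lt_iff_exists_real_btwn.mp h
  refine ⟨r, by exact_mod_cast hr1, ?_⟩
  filter_upwards [eventually_lt_of_lt_liminf hr2, hs.eventually] with n h1 ⟨h2, h3, _⟩
  have hlog := SizeBound.log_div_ge hs.pos h2 h3
  -- `K ≤ κ n` keeps `log (n / K)` away from 0, so the quotient is genuine.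
  have hlog0 : 0 < Real.log (1 / κ) := Real.log_pos (by
    rw [lt_div_iff₀ hs.pos]; linarith [hs.lt_one])
  rw [infoRatio, EReal.coe_lt_coe_iff, lt_div_iff₀ (hlog0.trans_le hlog)] at h1
  exact h1.le

/-- The bound of `law_real_exists_far_le` tends to zero. -/
lemma exists_far_bound (h : ∀ n, RegularPair (P n) (Q n) c) (hs : SizeBound K κ)
    (hKD : Tendsto (fun n => (K n : ℝ) * kl (P n) (Q n)) atTop atTop)
    (hinfo : 2 < liminf (infoRatio K P Q) atTop) {ε : ℝ} (hε : 0 < ε) :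
    ∃ b : ℕ → ℝ, Tendsto b atTop (𝓝 0) ∧ (∀ n, 0 ≤ b n) ∧
      ∀ᶠ n in atTop, ∀ C : Finset (Fin n), C.card = K n →
      (law (P n) (Q n) C).real {x | ∃ C', C'.card = C.card ∧ ε * C.card < (C \ C').card ∧
        score (llr (P n) (Q n)) C x ≤ score (llr (P n) (Q n)) C' x} ≤ b n := by
  obtain ⟨r, hr, hinf⟩ := exists_info_bound (a := 2) hs (by exact_mod_cast hinfo)
  -- Chosen so that `(1 - 2 η) r = 2`: the part `1 - 2 η` of the exponent cancels `n / K`, and the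
  -- remaining `η` sends the bound to 0.
  set η := (1 - 2 / r) / 2 with hη
  have hr0 : 0 < r := by linarith
  have h2r : 2 / r < 1 := by rw [div_lt_one hr0]; linarith
  have h2r0 : 0 < 2 / r := by positivity
  have hη0 : 0 < η := by rw [hη]; linarith
  have hη1 : η ≤ 1 := by rw [hη]; linarith
  have hc1 := (h 0).one_le 1
  set y₁ : ℕ → ℝ := fun n => Real.exp 1 / ε *
    Real.exp (-(((K n : ℝ) - 1) / 2 * (kl (P n) (Q n) * η ^ 2 / (4 * c 1)))) with hy₁
  set y₂ : ℕ → ℝ := fun n => Real.exp 1 / ε * (Real.exp 1 / ε) * (n / K n) *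
    Real.exp (-(((K n : ℝ) - 1) / 2 * ((1 - η) * kl (P n) (Q n)))) with hy₂
  have hD : Tendsto (fun n => ((K n : ℝ) - 1) / 2 * kl (P n) (Q n)) atTop atTop := by
    refine tendsto_atTop_mono' _ ?_ (hKD.const_mul_atTop (by norm_num : (0 : ℝ) < 1 / 4))
    filter_upwards [hs.eventually] with n ⟨h1, _, _⟩
    have : (2 : ℝ) ≤ K n := by exact_mod_cast h1
    have := (h n).kl_pos
    nlinarith
  have ht₁ : Tendsto y₁ atTop (𝓝 0) := by
    have h1 : Tendsto (fun n => -(((K n : ℝ) - 1) / 2 * (kl (P n) (Q n) * η ^ 2 / (4 * c 1))))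
        atTop atBot := by
      rw [tendsto_neg_atBot_iff]
      refine (hD.atTop_mul_const (by positivity : 0 < η ^ 2 / (4 * c 1))).congr fun n => ?_
      ring
    simpa using (Real.tendsto_exp_atBot.comp h1).const_mul (Real.exp 1 / ε)
  have ht₂ : Tendsto y₂ atTop (𝓝 0) := by
    have h1 : Tendsto (fun n => -(((K n : ℝ) - 1) / 2 * kl (P n) (Q n) * η)) atTop atBot := by
      rw [tendsto_neg_atBot_iff]
      exact hD.atTop_mul_const hη0
    have h2 : Tendsto (fun n => Real.exp 1 / ε * (Real.exp 1 / ε) *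
        Real.exp (-(((K n : ℝ) - 1) / 2 * kl (P n) (Q n) * η))) atTop (𝓝 0) := by
      simpa using (Real.tendsto_exp_atBot.comp h1).const_mul (Real.exp 1 / ε * (Real.exp 1 / ε))
    refine squeeze_zero' (Eventually.of_forall fun n => by positivity) ?_ h2
    filter_upwards [hinf, hs.eventually] with n h3 ⟨h4, h5, h6⟩
    have hK : (0 : ℝ) < K n := by exact_mod_cast (by omega : 0 < K n)
    have hn : (0 : ℝ) < n := by exact_mod_cast (by omega : 0 < n)
    simp only [hy₂]
    rw [mul_assoc (Real.exp 1 / ε * (Real.exp 1 / ε))]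
    refine mul_le_mul_of_nonneg_left ?_ (by positivity)
    rw [← Real.exp_log (div_pos hn hK), ← Real.exp_add, Real.exp_le_exp]
    have h7 : (1 - 2 * η) * r = 2 := by rw [hη]; field_simp; ring
    have h8 : (1 - 2 * η) * (r * Real.log (n / K n)) ≤
        (1 - 2 * η) * (((K n : ℝ) - 1) * kl (P n) (Q n)) :=
      mul_le_mul_of_nonneg_left h3 (by rw [hη]; linarith)
    rw [← mul_assoc, h7] at h8
    linarith
  refine ⟨fun n => 2 * y₁ n + 2 * y₂ n, ?_, fun n => by positivity, ?_⟩
  · simpa using (ht₁.const_mul 2).add (ht₂.const_mul 2)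
  · filter_upwards [ht₁.eventually_le_const (by norm_num : (0 : ℝ) < 1 / 2),
      ht₂.eventually_le_const (by norm_num : (0 : ℝ) < 1 / 2), hs.eventually] with
      n h1 h2 ⟨h3, _, _⟩ C hC
    refine law_real_exists_far_le (h n) (by omega) hε hη0.le hη1 ?_ ?_ h1 h2
    · rw [hC]
    · rw [hC]

/-- The maximum likelihood estimators. -/
lemma exists_mle_seq (K : ℕ → ℕ) (P Q : ℕ → Measure ℝ) :
    ∃ est : Estimator, (∀ n, Measurable (est n)) ∧ ∀ n, K n ≤ n → ∀ x : Pair n → ℝ,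
      (supp (est n (symmMatrix x))).card = K n ∧ ∀ C : Finset (Fin n), C.card = K n →
        score (llr (P n) (Q n)) C x ≤
          score (llr (P n) (Q n)) (supp (est n (symmMatrix x))) x := by
  have : ∀ n, ∃ g : DataMatrix n → (Fin n → Bool), Measurable g ∧ (K n ≤ n → ∀ x : Pair n → ℝ,
      (supp (g (symmMatrix x))).card = K n ∧ ∀ C : Finset (Fin n), C.card = K n →
        score (llr (P n) (Q n)) C x ≤ score (llr (P n) (Q n)) (supp (g (symmMatrix x))) x) := by
    intro n
    by_cases hn : K n ≤ n
    · obtain ⟨g, hg, h⟩ := exists_mle hn (measurable_llr (P n) (Q n))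
      exact ⟨g, hg, fun _ => h⟩
    -- There is no community when `K n > n`, and any measurable value will do.
    · exact ⟨fun _ _ => false, measurable_const, fun h => absurd h hn⟩
  choose est h1 h2 using this
  exact ⟨est, h1, h2⟩

lemma almostExactRecoveryPossible (h : ∀ n, RegularPair (P n) (Q n) c) (hs : SizeBound K κ)
    (hKD : Tendsto (fun n => (K n : ℝ) * kl (P n) (Q n)) atTop atTop)
    (hinfo : 2 < liminf (infoRatio K P Q) atTop) : AlmostExactRecoveryPossible K P Q := by
  obtain ⟨est, hmeas, hest⟩ := exists_mle_seq K P Q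
  refine ⟨est, hmeas, fun ε hε => ?_⟩
  rw [tendsto_jointLaw_iff h]
  -- For sets of equal size the Hamming distance is twice the number of lost vertices, hence `ε /
  -- 2`.
  obtain ⟨b, hb, hb0, hbound⟩ := exists_far_bound h hs hKD hinfo (half_pos hε)
  refine squeeze_zero' (Eventually.of_forall fun n => measureReal_nonneg) ?_ hb
  filter_upwards [hbound, hs.eventually] with n h1 ⟨h2, h3, _⟩
  have hKn := SizeBound.le_of_le hs.lt_one h3
  refine jointLaw_real_est_le (h n) (K n) (hmeas n)
    (fun ξ ζ => ε < (hammingDist ξ ζ : ℝ) / (K n : ℝ)) (hb0 n) fun ξ hξ => ?_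
  rw [mem_communities] at hξ
  have := isProbabilityMeasure_law (h n) (supp ξ)
  refine (measureReal_mono ?_).trans (h1 (supp ξ) hξ)
  intro x hx
  obtain ⟨h4, h5⟩ := hest n hKn x
  refine ⟨supp (est n (symmMatrix x)), h4.trans hξ.symm, ?_, h5 _ hξ⟩
  have hx : ε < (hammingDist ξ (est n (symmMatrix x)) : ℝ) / (K n : ℝ) := hx
  rw [lt_div_iff₀ (by exact_mod_cast (by omega : 0 < K n)), hammingDist_eq,
    Finset.card_sdiff_comm (h4.trans hξ.symm)] at hx
  push_cast at hx
  rw [hξ]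
  linarith

lemma exactRecoveryPossible (h : ∀ n, RegularPair (P n) (Q n) c) (hs : SizeBound K κ)
    (hKD : Tendsto (fun n => (K n : ℝ) * kl (P n) (Q n)) atTop atTop)
    (hinfo : 2 < liminf (infoRatio K P Q) atTop)
    (hvote : 1 < liminf (votingRatio K P Q) atTop) : ExactRecoveryPossible K P Q := by
  obtain ⟨est, hmeas, hest⟩ := exists_mle_seq K P Q
  refine ⟨est, hmeas, ?_⟩
  rw [ExactlyRecovers, tendsto_jointLaw_iff h]
  obtain ⟨r, hr1, hr2⟩ := EReal.lt_iff_exists_real_btwn.mp hvote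
  have hr : 1 < r := by exact_mod_cast hr1
  obtain ⟨r', hr', hinf⟩ := exists_info_bound (a := 2) hs (by exact_mod_cast hinfo)
  have hc1 := (h 0).one_le 1
  set c₀ := 1 / (4 * c 1) with hc₀
  set β := (r - 1) / (2 * r) with hβ
  have hβ0 : 0 < β := div_pos (by linarith) (by linarith)
  have hc₀0 : 0 < c₀ := by positivity
  -- `η` and `ε` share the affordable loss `β c₀` equally. The bound `G` for `ψ (± 4 / η) / D`
  -- depends on `η`, so `ε` is chosen last, small also relative to `1 / G`.
  set η := β * c₀ / 2 with hη
  have hη0 : 0 < η := by positivity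
  set G := max (|4 / η - 1| + c |4 / η - 1| * (4 / η - 1) ^ 2)
    (|-(4 / η) - 1| + c |-(4 / η) - 1| * (-(4 / η) - 1) ^ 2) with hG
  have hG0 : 0 ≤ G := by
    refine le_trans ?_ (le_max_left _ _)
    have := (h 0).one_le |4 / η - 1|
    positivity
  set ε := min (β * c₀ / 2) (1 / (2 * (G + 1))) with hε
  have hε0 : 0 < ε := by positivity
  have hεG : 2 * ε * G ≤ 1 := by
    calc 2 * ε * G ≤ 2 * (1 / (2 * (G + 1))) * G := by gcongr; exact min_le_right _ _
      _ = G / (G + 1) := by field_simp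
      _ ≤ 1 := by rw [div_le_one (by linarith)]; linarith
  obtain ⟨b, hb, hb0, hbound⟩ := exists_far_bound h hs hKD hinfo hε0
  set y : ℕ → ℝ := fun n => Real.exp (-((r - 1) / 2 * Real.log n)) with hy
  have hty : Tendsto y atTop (𝓝 0) := by
    have h1 : Tendsto (fun n : ℕ => -((r - 1) / 2 * Real.log n)) atTop atBot := by
      rw [tendsto_neg_atBot_iff]
      exact (Real.tendsto_log_atTop.comp tendsto_natCast_atTop_atTop).const_mul_atTop
        (by linarith)
    exact Real.tendsto_exp_atBot.comp h1
  have hsum : Tendsto (fun n => b n + 6 * y n) atTop (𝓝 0) := by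
    simpa using hb.add (hty.const_mul 6)
  refine squeeze_zero' (Eventually.of_forall fun n => measureReal_nonneg) ?_ hsum
  filter_upwards [hbound, hs.eventually, hinf, eventually_lt_of_lt_liminf hr2,
    hty.eventually_le_const (by norm_num : (0 : ℝ) < 1 / 2)] with n h1 ⟨h2, h3, h4⟩ h5 h6 h7
  have hKn := SizeBound.le_of_le hs.lt_one h3
  have hK0 : (2 : ℝ) ≤ K n := by exact_mod_cast h2
  have hn0 : 0 < Real.log n := Real.log_pos (by exact_mod_cast (by omega : 1 < n))
  have hDpos := (h n).kl_pos
  refine jointLaw_real_est_le (h n) (K n) (hmeas n) (fun ξ ζ => ξ ≠ ζ)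
    (by have := hb0 n; positivity) fun ξ hξ => ?_
  rw [mem_communities] at hξ
  set θ := 1 / (K n : ℝ) * Real.log ((n : ℝ) / (K n : ℝ)) with hθ
  have hKθ : K n * θ = Real.log ((n : ℝ) / (K n : ℝ)) := by
    rw [hθ]; field_simp
  have hlog0 : 0 ≤ Real.log ((n : ℝ) / (K n : ℝ)) :=
    Real.log_nonneg ((one_le_div (by linarith)).mpr (by exact_mod_cast hKn))
  have hθ0 : 0 ≤ θ := mul_nonneg (by positivity) hlog0
  have hθ1 : θ ≤ kl (P n) (Q n) := by
    have : K n * θ ≤ K n * kl (P n) (Q n) := by nlinarith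
    exact le_of_mul_le_mul_left this (by linarith)
  obtain ⟨t, ht, ht1, ht2, ht3⟩ := (h n).exists_rate (by linarith : (0 : ℝ) < K n) hθ0 hθ1
    (lt_votingRatio hn0 (by omega) h6)
  have := isProbabilityMeasure_law (h n) (supp ξ)
  have hnear := law_real_exists_near_le (h n) (C := supp ξ) (by omega) (t := t) (θ := θ) (r := r)
    (c₀ := c₀) (G := G) (η := η) (ε := ε) (y := y n) ht (by rw [hξ]; exact hKθ) hr
    (by rw [hξ]; exact ht1) (by rw [hξ]; exact ht2) (by rw [hξ]; exact ht3) hη0 hε0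
    (by have := min_le_left (β * c₀ / 2) (1 / (2 * (G + 1))); rw [← hβ]; linarith)
    (((h n).logMgf_le _).trans (mul_le_mul_of_nonneg_right (le_max_left _ _) hDpos.le))
    (((h n).logMgf_le _).trans (mul_le_mul_of_nonneg_right (le_max_right _ _) hDpos.le))
    hG0 hεG rfl h7
  refine (measureReal_mono ?_).trans ((measureReal_union_le _ _).trans
    (add_le_add (h1 (supp ξ) hξ) hnear))
  intro x hx
  have hx : ξ ≠ est n (symmMatrix x) := hx
  obtain ⟨h8, h9⟩ := hest n hKn x
  have hcard := h8.trans hξ.symm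
  rcases lt_or_ge (ε * (supp ξ).card) ((supp ξ \ supp (est n (symmMatrix x))).card : ℝ)
    with h10 | h10
  · exact Or.inl ⟨_, hcard, h10, h9 _ hξ⟩
  · refine Or.inr ⟨_, hcard, ⟨?_, h10⟩, h9 _ hξ⟩
    rw [Nat.one_le_iff_ne_zero, ne_eq, Finset.card_eq_zero, Finset.sdiff_eq_empty_iff_subset]
    intro hsub
    exact hx (supp_injective (Finset.eq_of_subset_of_card_le hsub hcard.le))

end Achievability

/-! ### Necessary conditions for almost exact recovery -/

section ChangeOfMeasure

variable {n : ℕ} {P Q : Measure ℝ} {c : ℝ → ℝ}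

lemma measurable_score (L : ℝ → ℝ) (hL : Measurable L) (C : Finset (Fin n)) :
    Measurable (score L C) := by
  unfold score
  exact Finset.measurable_sum _ fun e _ => hL.comp (measurable_pi_apply e)

lemma sum_indic_mul (E F : Finset (Pair n)) (f : Pair n → ℝ) :
    ∑ e, (indic E e - indic F e) * f e = ∑ e ∈ E, f e - ∑ e ∈ F, f e := by
  simp [indic, sub_mul, ite_mul, Finset.sum_sub_distrib]

lemma RegularPair.logMgf_indic (h : RegularPair P Q c) (E : Finset (Pair n)) (e : Pair n) :
    logMgf P Q (indic E e) = 0 := by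
  unfold indic
  split_ifs
  · exact h.logMgf_one
  · exact h.logMgf_zero

/-- The log-likelihood ratio between two communities is the difference of their scores. -/
lemma law_eq_withDensity (h : RegularPair P Q c) (C C' : Finset (Fin n)) :
    law P Q C' = (law P Q C).withDensity fun x => ENNReal.ofReal
      (Real.exp (score (llr P Q) C' x - score (llr P Q) C x)) := by
  have := h.prob_right
  rw [law, tiltPi_eq_withDensity (measurable_llr P Q) h.integrable_exp (indic (edges C))
    (indic (edges C')), law]
  congr 1
  ext x
  rw [sum_indic_mul _ _ fun e => llr P Q (x e)]
  simp [h.logMgf_indic, score]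

/-- A comparison of the probabilities of an event under two communities. -/
lemma exp_neg_mul_le_law_real (h : RegularPair P Q c) (C C' : Finset (Fin n))
    {B : Set (Pair n → ℝ)} (hB : MeasurableSet B) (b : ℝ) :
    Real.exp (-b) * ((law P Q C).real B -
      (law P Q C).real {x | b ≤ score (llr P Q) C x - score (llr P Q) C' x}) ≤
      (law P Q C').real B := by
  have := isProbabilityMeasure_law h C
  have := isProbabilityMeasure_law h C'
  have := h.prob_right
  set A := {x | b ≤ score (llr P Q) C x - score (llr P Q) C' x} with hA
  have hAm : MeasurableSet A := measurableSet_le measurable_const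
    ((measurable_score _ (measurable_llr P Q) C).sub (measurable_score _ (measurable_llr P Q) C'))
  have h1 := exp_mul_tiltPi_le (measurable_llr P Q) h.integrable_exp (indic (edges C))
    (indic (edges C')) (hB.diff hAm) (-b) (by
      intro x hx
      have h2 : ¬ b ≤ score (llr P Q) C x - score (llr P Q) C' x := hx.2
      rw [sum_indic_mul _ _ fun e => llr P Q (x e)]
      have h3 : ∀ e, cgf (llr P Q) Q (indic (edges C') e) -
          cgf (llr P Q) Q (indic (edges C) e) = 0 := fun e => by
        have e1 := h.logMgf_indic (edges C') e
        have e2 := h.logMgf_indic (edges C) e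
        linarith
      simp only [h3, Finset.sum_const_zero, sub_zero]
      change -b ≤ score (llr P Q) C' x - score (llr P Q) C x
      linarith)
  have h2 : (law P Q C).real B - (law P Q C).real A ≤ (law P Q C).real (B \ A) :=
    le_measureReal_sdiff
  calc _ ≤ Real.exp (-b) * (law P Q C).real (B \ A) :=
        mul_le_mul_of_nonneg_left h2 (Real.exp_pos _).le
    _ ≤ (law P Q C').real (B \ A) := h1
    _ ≤ _ := measureReal_mono Set.sdiff_subset

/-- A uniform factor for the moment generating function at `2` and at `-1`. -/
noncomputable def swapConst (c : ℝ → ℝ) : ℝ := (1 + c 1) + (2 + 4 * c 2)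

/-- These are the cumulants of the score difference under the true community: its exponential moves
the tilt from 1 to 2 on lost pairs and from 0 to -1 on gained pairs. -/
lemma RegularPair.logMgf_two_add_le (h : RegularPair P Q c) :
    logMgf P Q 2 + logMgf P Q (-1) ≤ swapConst c * kl P Q := by
  have h1 := h.logMgf_le 2
  have h2 := h.logMgf_le (-1)
  norm_num at h1 h2
  rw [swapConst]
  linarith

lemma RegularPair.swapConst_pos (h : RegularPair P Q c) : 0 < swapConst c := by
  have h1 := h.one_le 1
  have h2 := h.one_le 2
  rw [swapConst]
  linarith

/-- The log-likelihood ratio between two neighbouring communities is bounded in probability. -/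
lemma law_real_le_score_sub_le (h : RegularPair P Q c) {C C' : Finset (Fin n)}
    (hcard : C.card = C'.card) (h1 : (C \ C').card = 1) (b : ℝ) :
    (law P Q C).real {x | b ≤ score (llr P Q) C x - score (llr P Q) C' x} ≤
      Real.exp (C.card * (swapConst c * kl P Q) - b) := by
  have hd : Disjoint (edges C \ edges C') (edges C' \ edges C) := disjoint_sdiff_sdiff
  have h2 := tiltPi_real_add_le_exp h (indic (edges C)) hd (τ := 1) (σ := 0)
    (fun e he => if_pos (Finset.mem_sdiff.mp he).1)
    (fun e he => if_neg (Finset.mem_sdiff.mp he).2) 1 (-1) b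
  have h3 : ∀ x, 1 * ∑ e ∈ edges C \ edges C', llr P Q (x e) +
      -1 * ∑ e ∈ edges C' \ edges C, llr P Q (x e) =
        score (llr P Q) C x - score (llr P Q) C' x := by
    intro x
    have := score_sub_score (llr P Q) C C' x
    linarith
  simp only [h3] at h2
  refine h2.trans ?_
  have hC1 : (1 : ℝ) ≤ C.card := by
    exact_mod_cast h1 ▸ Finset.card_le_card (Finset.sdiff_subset (s := C) (t := C'))
  rw [card_edges_sdiff, card_edges_sdiff, ← Finset.card_sdiff_comm hcard, h1, ← hcard,
    h.logMgf_one, h.logMgf_zero, Real.exp_le_exp, show (1 : ℝ) + 1 = 2 by norm_num, zero_add]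
  push_cast
  have h4 := h.logMgf_two_add_le
  have h5 := mul_le_mul_of_nonneg_left h4 (sub_nonneg.mpr hC1)
  have h6 := mul_pos h.swapConst_pos h.kl_pos
  linarith

end ChangeOfMeasure

/-! ### Pairwise tests by swapping a member with an outsider: necessity of `K D → ∞`. -/

section Swap

variable {n K : ℕ} {P Q : Measure ℝ} {c : ℝ → ℝ}

lemma card_supp_comp (ξ : Fin n → Bool) (σ : Equiv.Perm (Fin n)) :
    (supp (ξ ∘ σ)).card = (supp ξ).card := by
  refine Finset.card_bij (fun i _ => σ i) (fun i hi => by simpa using hi)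
    (fun i _ j _ hij => σ.injective hij) (fun j hj => ⟨σ.symm j, by simpa using hj, by simp⟩)

lemma supp_sdiff_supp_swap {ξ : Fin n → Bool} {i j : Fin n} (hi : ξ i = true)
    (hj : ξ j = false) : supp ξ \ supp (ξ ∘ Equiv.swap i j) = {i} := by
  ext k
  simp only [Finset.mem_sdiff, mem_supp, Function.comp_apply, Finset.mem_singleton]
  rcases eq_or_ne k i with rfl | hki
  · simp [hi, hj]
  · rcases eq_or_ne k j with rfl | hkj
    · simp [hj, hki]
    · simp [Equiv.swap_apply_of_ne_of_ne hki hkj, hki]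

/-- The number of misclassified pairs is controlled by the Hamming distance. -/
lemma sum_law_real_pairs_le (h : RegularPair P Q c) (hK : 1 ≤ K)
    {g : DataMatrix n → (Fin n → Bool)} (hg : Measurable g) {ε : ℝ} (hε : 0 < ε)
    {ξ : Fin n → Bool} (hξ : (supp ξ).card = K) :
    ∑ p ∈ supp ξ ×ˢ (supp ξ)ᶜ, (law P Q (supp ξ)).real
      {x | ¬ (g (symmMatrix x) p.1 = true ∧ g (symmMatrix x) p.2 = false)} ≤
      ε * n * K + K * (n - K) * (law P Q (supp ξ)).real
        {x | ε < (hammingDist ξ (g (symmMatrix x)) : ℝ) / (K : ℝ)} := by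
  have := isProbabilityMeasure_law h (supp ξ)
  set bad := {x : Pair n → ℝ | ε < (hammingDist ξ (g (symmMatrix x)) : ℝ) / (K : ℝ)} with hbad
  set B : Fin n × Fin n → Set (Pair n → ℝ) := fun p =>
    {x | ¬ (g (symmMatrix x) p.1 = true ∧ g (symmMatrix x) p.2 = false)} with hB
  have hbadm : MeasurableSet bad :=
    measurableSet_est hg fun ζ => ε < (hammingDist ξ ζ : ℝ) / (K : ℝ)
  have hBm : ∀ p, MeasurableSet (B p) := fun p =>
    measurableSet_est hg fun ζ => ¬ (ζ p.1 = true ∧ ζ p.2 = false)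
  have hKn : K ≤ n := hξ ▸ (Finset.card_le_univ _).trans_eq (Fintype.card_fin n)
  have hcompl : ((supp ξ)ᶜ.card : ℝ) = n - K := by
    rw [Finset.card_compl, Fintype.card_fin, hξ, Nat.cast_sub hKn]
  have hK0 : (0 : ℝ) < K := by exact_mod_cast hK
  have hKn' : (K : ℝ) ≤ n := by exact_mod_cast hKn
  have h1 : ∀ p ∈ supp ξ ×ˢ (supp ξ)ᶜ, (law P Q (supp ξ)).real (B p) ≤
      (law P Q (supp ξ)).real (B p \ bad) + (law P Q (supp ξ)).real bad := by
    intro p _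
    rw [← measureReal_sdiff_add_inter hbadm (s := B p)]
    exact add_le_add le_rfl (measureReal_mono Set.inter_subset_right)
  have h2 : ∑ p ∈ supp ξ ×ˢ (supp ξ)ᶜ, (law P Q (supp ξ)).real (B p \ bad) ≤ ε * n * K := by
    refine sum_measureReal_le _ _ _ (fun p _ => (hBm p).diff hbadm) _ fun x => ?_
    by_cases hx : x ∈ bad
    · have : ∀ p, (B p \ bad).indicator (fun _ => (1 : ℝ)) x = 0 := fun p =>
        Set.indicator_of_notMem (fun hp => hp.2 hx) _
      simp only [this, Finset.sum_const_zero]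
      positivity
    -- A misclassified pair has a missed member or a falsely included outsider; each missed member
    -- spoils at most `n - K` pairs and each false inclusion at most `K`.
    · set Z := supp (g (symmMatrix x)) with hZ
      have h3 : ∀ p ∈ supp ξ ×ˢ (supp ξ)ᶜ, (B p \ bad).indicator (fun _ => (1 : ℝ)) x ≤
          (if p.1 ∈ supp ξ \ Z then 1 else 0) + (if p.2 ∈ Z \ supp ξ then 1 else 0) := by
        intro p hp
        rw [Finset.mem_product, Finset.mem_compl] at hp
        by_cases hpB : x ∈ B p \ bad
        · rw [Set.indicator_of_mem hpB]
          have h4 : ¬ (g (symmMatrix x) p.1 = true ∧ g (symmMatrix x) p.2 = false) := hpB.1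
          by_cases h5 : g (symmMatrix x) p.1 = true
          · have h6 : g (symmMatrix x) p.2 = true := by simpa [h5] using h4
            have h7 : p.2 ∈ Z \ supp ξ := Finset.mem_sdiff.mpr ⟨mem_supp.mpr h6, hp.2⟩
            rw [if_pos h7]
            split_ifs <;> norm_num
          · have h7 : p.1 ∈ supp ξ \ Z := Finset.mem_sdiff.mpr ⟨hp.1, fun h => h5 (mem_supp.mp h)⟩
            rw [if_pos h7]
            split_ifs <;> norm_num
        · rw [Set.indicator_of_notMem hpB]
          split_ifs <;> norm_num
      refine (Finset.sum_le_sum h3).trans ?_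
      rw [Finset.sum_add_distrib, Finset.sum_product, Finset.sum_product_right]
      have hsum : ∀ s t u : Finset (Fin n), ∑ i ∈ s, ∑ _ ∈ t, (if i ∈ u then (1 : ℝ) else 0) =
          t.card * (s ∩ u).card := fun s t u => by
        simp only [Finset.sum_const, nsmul_eq_mul, ← Finset.mul_sum, Finset.sum_ite_mem, mul_one]
      simp only [hsum, hξ, hcompl]
      have h4 : ((supp ξ ∩ (supp ξ \ Z)).card : ℝ) ≤ (supp ξ \ Z).card := by
        exact_mod_cast Finset.card_le_card Finset.inter_subset_right
      have h5 : (((supp ξ)ᶜ ∩ (Z \ supp ξ)).card : ℝ) ≤ (Z \ supp ξ).card := by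
        exact_mod_cast Finset.card_le_card Finset.inter_subset_right
      have h6 : (hammingDist ξ (g (symmMatrix x)) : ℝ) ≤ ε * K := by
        have : ¬ ε < (hammingDist ξ (g (symmMatrix x)) : ℝ) / (K : ℝ) := hx
        rwa [not_lt, div_le_iff₀ hK0] at this
      rw [hammingDist_eq, ← hZ] at h6
      push_cast at h6
      have h7 := mul_le_mul_of_nonneg_left h4 (sub_nonneg.mpr hKn')
      have h8 := mul_le_mul_of_nonneg_left h5 hK0.le
      have a1 : (0 : ℝ) ≤ (supp ξ \ Z).card := Nat.cast_nonneg _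
      have a2 : (0 : ℝ) ≤ (Z \ supp ξ).card := Nat.cast_nonneg _
      nlinarith
  refine (Finset.sum_le_sum h1).trans ?_
  rw [Finset.sum_add_distrib, Finset.sum_const, Finset.card_product, nsmul_eq_mul, Nat.cast_mul,
    hcompl, hξ]
  linarith

/-- If `K D(P‖Q)` is bounded then no estimator is accurate. -/
lemma le_jointLaw_of_bounded (h : RegularPair P Q c) (hK : 1 ≤ K) (hKn : K ≤ n) {M : ℝ}
    (hM : K * kl P Q ≤ M) {g : DataMatrix n → (Fin n → Bool)} (hg : Measurable g) {ε : ℝ}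
    (hε : 0 < ε) :
    (n - K) * (3 / 4 * Real.exp (-(swapConst c * M + Real.log 4))) ≤
      2 * (ε * n + (n - K) *
        (jointLaw n K P Q).real {z | ε < (hammingDist z.1 (g z.2) : ℝ) / (K : ℝ)}) := by
  rw [jointLaw_real_est h K hg fun ξ ζ => ε < (hammingDist ξ ζ : ℝ) / (K : ℝ)]
  set b := swapConst c * M + Real.log 4 with hb
  have hb0 : 0 ≤ b := add_nonneg (mul_nonneg h.swapConst_pos.le
    (le_trans (mul_nonneg (Nat.cast_nonneg K) h.kl_pos.le) hM)) (Real.log_nonneg (by norm_num))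
  set g₀ := 3 / 4 * Real.exp (-b) with hg₀
  set B : Fin n × Fin n → Set (Pair n → ℝ) := fun p =>
    {x | ¬ (g (symmMatrix x) p.1 = true ∧ g (symmMatrix x) p.2 = false)} with hB
  have hBm : ∀ p, MeasurableSet (B p) := fun p =>
    measurableSet_est hg fun ζ => ¬ (ζ p.1 = true ∧ ζ p.2 = false)
  set F : (Σ _ : Fin n → Bool, Fin n × Fin n) → ℝ :=
    fun w => (law P Q (supp w.1)).real (B w.2) with hF
  set T := (communities n K).sigma fun ξ => supp ξ ×ˢ (supp ξ)ᶜ with hT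
  -- An involution exchanging a community with its swapped copy; summing the two-point bound over it
  -- turns `F w + F (σ w)` into twice `F`.
  set σ : (Σ _ : Fin n → Bool, Fin n × Fin n) → (Σ _ : Fin n → Bool, Fin n × Fin n) :=
    fun w => ⟨w.1 ∘ Equiv.swap w.2.1 w.2.2, (w.2.2, w.2.1)⟩ with hσ
  have hmem : ∀ w, w ∈ T ↔ (supp w.1).card = K ∧ w.1 w.2.1 = true ∧ w.1 w.2.2 = false := by
    intro w
    simp [hT, mem_communities]
  have hσT : ∀ w ∈ T, σ w ∈ T := by
    intro w hw
    rw [hmem] at hw ⊢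
    simp only [hσ]
    rw [card_supp_comp]
    simpa using ⟨hw.1, hw.2.1, hw.2.2⟩
  have hσσ : ∀ w ∈ T, σ (σ w) = w := by
    rintro ⟨ξ, i, j⟩ _
    simp only [hσ]
    congr 1
    rw [Function.comp_assoc, Equiv.swap_comm j i, ← Equiv.coe_trans, Equiv.swap_swap]
    simp
  -- Classifying `(i, j)` correctly for `ξ` is an error for the swapped community, and the two laws
  -- differ by a factor at most `exp b` outside an event of probability 1/4.
  have hstep1 : ∀ w ∈ T, g₀ ≤ F w + F (σ w) := by
    rintro ⟨ξ, i, j⟩ hw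
    rw [hmem] at hw
    obtain ⟨hw1, hw2, hw3⟩ := hw
    simp only at hw1 hw2 hw3
    have := isProbabilityMeasure_law h (supp ξ)
    have := isProbabilityMeasure_law h (supp (ξ ∘ Equiv.swap i j))
    have hs := supp_sdiff_supp_swap hw2 hw3
    have e1 := exp_neg_mul_le_law_real h (supp ξ) (supp (ξ ∘ Equiv.swap i j))
      (hBm (i, j)).compl b
    have e2 := law_real_le_score_sub_le h (C := supp ξ) (C' := supp (ξ ∘ Equiv.swap i j))
      (by rw [card_supp_comp]) (by rw [hs]; simp) b
    have e3 : Real.exp ((supp ξ).card * (swapConst c * kl P Q) - b) ≤ 1 / 4 := by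
      have : (supp ξ).card * (swapConst c * kl P Q) - b ≤ -Real.log 4 := by
        rw [hw1, hb]
        have := mul_le_mul_of_nonneg_left hM h.swapConst_pos.le
        linarith
      refine (Real.exp_le_exp.mpr this).trans_eq ?_
      rw [Real.exp_neg, Real.exp_log (by norm_num)]
      norm_num
    have e4 : (law P Q (supp (ξ ∘ Equiv.swap i j))).real (B (i, j))ᶜ ≤
        (law P Q (supp (ξ ∘ Equiv.swap i j))).real (B (j, i)) := by
      refine measureReal_mono fun x hx => ?_
      simp only [hB, Set.mem_compl_iff, Set.mem_ofPred_eq, not_not] at hx ⊢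
      simp [hx.1, hx.2]
    rw [measureReal_compl (hBm (i, j)), probReal_univ] at e1
    have e5 : Real.exp (-b) ≤ 1 := Real.exp_le_one_iff.mpr (by linarith)
    have e6 : 0 ≤ (law P Q (supp ξ)).real (B (i, j)) := measureReal_nonneg
    have e7 : 0 < Real.exp (-b) := Real.exp_pos _
    have e8 : Real.exp (-b) * (law P Q (supp ξ)).real (B (i, j)) ≤
        (law P Q (supp ξ)).real (B (i, j)) := mul_le_of_le_one_left e6 e5
    have e9 := mul_le_mul_of_nonneg_left (e2.trans e3) e7.le
    simp only [hF, hσ, hg₀]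
    linarith
  have hstep2 : ∑ w ∈ T, F (σ w) = ∑ w ∈ T, F w :=
    Finset.sum_nbij' σ σ hσT hσT hσσ hσσ fun w _ => rfl
  have hstep3 : ∑ w ∈ T, g₀ ≤ 2 * ∑ w ∈ T, F w := by
    refine (Finset.sum_le_sum hstep1).trans_eq ?_
    rw [Finset.sum_add_distrib, hstep2]; ring
  have hK0 : (0 : ℝ) < K := by exact_mod_cast hK
  have hcompl : ∀ ξ ∈ communities n K, ((supp ξ ×ˢ (supp ξ)ᶜ).card : ℝ) = K * (n - K) := by
    intro ξ hξ
    rw [Finset.card_product, Finset.card_compl, Fintype.card_fin, mem_communities.mp hξ,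
      Nat.cast_mul, Nat.cast_sub hKn]
  have hN : (0 : ℝ) < (communities n K).card := by
    rw [card_communities]; exact_mod_cast Nat.choose_pos hKn
  rw [hT, Finset.sum_sigma, Finset.sum_sigma] at hstep3
  have hl : ∑ ξ ∈ communities n K, ∑ _ ∈ supp ξ ×ˢ (supp ξ)ᶜ, g₀ =
      (communities n K).card * (K * (n - K) * g₀) := by
    rw [Finset.sum_congr rfl (g := fun _ => K * (n - K) * g₀) fun ξ hξ => by
      rw [Finset.sum_const, nsmul_eq_mul, hcompl ξ hξ], Finset.sum_const, nsmul_eq_mul]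
  rw [hl] at hstep3
  have hr := Finset.sum_le_sum fun ξ (hξ : ξ ∈ communities n K) =>
    sum_law_real_pairs_le h hK hg hε (mem_communities.mp hξ)
  rw [Finset.sum_add_distrib, Finset.sum_const, nsmul_eq_mul, ← Finset.mul_sum] at hr
  have hfin := hstep3.trans (mul_le_mul_of_nonneg_left hr (by norm_num))
  have : (communities n K).card * K * ((n - K) * g₀) ≤ (communities n K).card * K *
      (2 * (ε * n + (n - K) * ((∑ ξ ∈ communities n K, (law P Q (supp ξ)).real
        {x | ε < (hammingDist ξ (g (symmMatrix x)) : ℝ) / (K : ℝ)}) /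
          (communities n K).card))) := by
    refine le_trans (by linarith) (hfin.trans_eq ?_)
    field_simp
  exact le_of_mul_le_mul_left this (by positivity)

end Swap

/-! ### A packing argument: necessity of the information ratio 2. -/

section Counting

/-- The binomial coefficient is the product of the factors `(n - i) / (K - i)`, each at least `n /
K`. -/
lemma div_pow_le_choose {n K : ℕ} (h : K ≤ n) : ((n : ℝ) / K) ^ K ≤ n.choose K := by
  induction K generalizing n with
  | zero => simp
  | succ K ih =>
    obtain ⟨m, rfl⟩ : ∃ m, n = m + 1 := ⟨n - 1, by omega⟩
    have hm : K ≤ m := by omega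
    have h1 : ((m + 1).choose (K + 1) : ℝ) = ((m + 1 : ℕ) : ℝ) / (K + 1 : ℕ) * m.choose K := by
      have := Nat.add_one_mul_choose_eq m K
      rw [div_mul_eq_mul_div, eq_div_iff (by positivity)]
      exact_mod_cast this.symm
    rw [h1, pow_succ']
    refine mul_le_mul_of_nonneg_left ?_ (by positivity)
    refine le_trans ?_ (ih hm)
    rcases Nat.eq_zero_or_pos K with rfl | hK
    · simp
    · gcongr ?_ ^ K
      rw [div_le_div_iff₀ (by positivity) (by positivity)]
      push_cast
      have : (K : ℝ) ≤ m := by exact_mod_cast hm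
      nlinarith

/-- Each counted set has weight `s ^ |T| ≥ s ^ a`, while all weights add up to `(1 + s) ^ |U| ≤ exp
(s |U|)`. -/
lemma card_filter_powerset_le {α : Type*} [DecidableEq α] (U : Finset α) {a s : ℝ} (hs : 0 < s)
    (hs1 : s ≤ 1) : ((U.powerset.filter fun T => (T.card : ℝ) ≤ a).card : ℝ) ≤
      Real.exp (a * Real.log (1 / s) + s * U.card) := by
  have h1 : ∑ T ∈ U.powerset, s ^ T.card = (s + 1) ^ U.card := by
    rw [← Finset.sum_pow_mul_eq_add_pow]; simp
  have hw : 0 ≤ Real.log (1 / s) := Real.log_nonneg ((one_le_div hs).mpr hs1)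
  have h2 : ∀ T ∈ U.powerset.filter (fun T => (T.card : ℝ) ≤ a),
      1 ≤ Real.exp (a * Real.log (1 / s)) * s ^ T.card := by
    intro T hT
    have hT := (Finset.mem_filter.mp hT).2
    have : s ^ T.card = Real.exp (-(T.card * Real.log (1 / s))) := by
      rw [one_div, Real.log_inv, mul_neg, neg_neg, Real.exp_nat_mul, Real.exp_log hs]
    rw [this, ← Real.exp_add, Real.one_le_exp_iff]
    nlinarith
  calc ((U.powerset.filter fun T => (T.card : ℝ) ≤ a).card : ℝ)
      = ∑ T ∈ U.powerset.filter (fun T => (T.card : ℝ) ≤ a), (1 : ℝ) := by simp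
    _ ≤ ∑ T ∈ U.powerset.filter (fun T => (T.card : ℝ) ≤ a),
        Real.exp (a * Real.log (1 / s)) * s ^ T.card := Finset.sum_le_sum h2
    _ ≤ ∑ T ∈ U.powerset, Real.exp (a * Real.log (1 / s)) * s ^ T.card :=
        Finset.sum_le_sum_of_subset_of_nonneg (Finset.filter_subset _ _)
          fun T _ _ => by positivity
    _ = Real.exp (a * Real.log (1 / s)) * (s + 1) ^ U.card := by rw [← Finset.mul_sum, h1]
    _ ≤ Real.exp (a * Real.log (1 / s)) * Real.exp s ^ U.card := by
        gcongr; exact Real.add_one_le_exp s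
    _ = _ := by rw [← Real.exp_nat_mul, ← Real.exp_add]; ring_nf

variable {n K : ℕ}

/-- The number of communities in a Hamming ball. -/
lemma card_communities_near_le (hK : 1 ≤ K) (hKn : K ≤ n) {ε : ℝ} (hε : 0 < ε) (hε1 : ε ≤ 1)
    (ζ : Fin n → Bool) :
    (((communities n K).filter fun ξ => (hammingDist ξ ζ : ℝ) ≤ ε * K).card : ℝ) ≤
      Real.exp (ε * K * (Real.log (n / K) + 2 * Real.log (1 / ε) + 2)) := by
  rcases Finset.eq_empty_or_nonempty
    ((communities n K).filter fun ξ => (hammingDist ξ ζ : ℝ) ≤ ε * K) with he | ⟨ξ₀, h₀⟩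
  · rw [he]; simp only [Finset.card_empty, Nat.cast_zero]; positivity
  have hK0 : (0 : ℝ) < K := by exact_mod_cast hK
  have hn0 : (0 : ℝ) < n := by exact_mod_cast hK.trans hKn
  have hKn' : (K : ℝ) ≤ n := by exact_mod_cast hKn
  rw [Finset.mem_filter, mem_communities] at h₀
  -- The ball is recentred at a community it contains. The distance doubles, but between sets of
  -- equal size it is twice each one-sided difference, so these remain at most `ε K`.
  set C := supp ξ₀ with hC
  have hle : ((communities n K).filter fun ξ => (hammingDist ξ ζ : ℝ) ≤ ε * K).card ≤
      ((C.powerset.filter fun T => (T.card : ℝ) ≤ ε * K) ×ˢ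
        ((Finset.univ : Finset (Fin n)).powerset.filter fun T => (T.card : ℝ) ≤ ε * K)).card := by
    refine Finset.card_le_card_of_injOn (fun ξ => (C \ supp ξ, supp ξ \ C)) ?_ ?_
    · intro ξ hξ
      rw [Finset.mem_coe, Finset.mem_filter, mem_communities] at hξ
      have h1 : (hammingDist ξ₀ ξ : ℝ) ≤ 2 * (ε * K) := by
        have := hammingDist_triangle_right ξ₀ ξ ζ
        have : (hammingDist ξ₀ ξ : ℝ) ≤ hammingDist ξ₀ ζ + hammingDist ξ ζ := by
          exact_mod_cast this
        linarith [h₀.2, hξ.2]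
      have h2 : (C \ supp ξ).card = (supp ξ \ C).card :=
        Finset.card_sdiff_comm (h₀.1.trans hξ.1.symm)
      rw [hammingDist_eq, ← hC, ← h2] at h1
      push_cast at h1
      rw [Finset.mem_coe, Finset.mem_product, Finset.mem_filter, Finset.mem_filter,
        Finset.mem_powerset, Finset.mem_powerset]
      refine ⟨⟨Finset.sdiff_subset, by simp only; linarith⟩, ⟨Finset.subset_univ _, ?_⟩⟩
      simp only
      rw [← h2]
      linarith
    · intro ξ _ ξ' _ hξξ'
      simp only [Prod.mk.injEq] at hξξ'
      apply supp_injective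
      ext i
      have h1 : i ∈ C \ supp ξ ↔ i ∈ C \ supp ξ' := by rw [hξξ'.1]
      have h2 : i ∈ supp ξ \ C ↔ i ∈ supp ξ' \ C := by rw [hξξ'.2]
      rw [Finset.mem_sdiff, Finset.mem_sdiff] at h1 h2
      tauto
  have h1 := card_filter_powerset_le C (a := ε * K) hε hε1
  -- The weights `ε` for subsets of `C` and `ε K / n` for subsets of all indices make both linear
  -- terms equal to `ε K`.
  have h2 := card_filter_powerset_le (Finset.univ : Finset (Fin n)) (a := ε * K)
    (s := ε * K / n) (by positivity) (by rw [div_le_one hn0]; nlinarith)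
  rw [Finset.card_product] at hle
  have hle' : (((communities n K).filter fun ξ => (hammingDist ξ ζ : ℝ) ≤ ε * K).card : ℝ) ≤ _ :=
    Nat.cast_le.mpr hle
  rw [Nat.cast_mul] at hle'
  refine hle'.trans ((mul_le_mul h1 h2 (Nat.cast_nonneg _) (Real.exp_pos _).le).trans_eq ?_)
  rw [← Real.exp_add, h₀.1, Finset.card_univ, Fintype.card_fin]
  congr 1
  have h3 : (1 : ℝ) / (ε * K / n) = 1 / ε * (n / K) := by field_simp
  rw [h3, Real.log_mul (by positivity) (by positivity)]
  field_simp
  ring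

variable {P Q : Measure ℝ} {c : ℝ → ℝ}

/-- Counting: accurate estimators need enough divergence. -/
lemma mul_log_le_of_recovery (h : RegularPair P Q c) (hK : 1 ≤ K) (hKn : K ≤ n) {η ε : ℝ}
    (hη : 0 < η) (hη1 : η ≤ 1) (hε : 0 < ε) (hε1 : ε ≤ 1)
    (hconc : Real.log 4 ≤ K * (K - 1) / 2 * kl P Q * (η ^ 2 / (4 * c 1)))
    {g : DataMatrix n → (Fin n → Bool)} (hg : Measurable g)
    (hp : (jointLaw n K P Q).real {z | ε < (hammingDist z.1 (g z.2) : ℝ) / (K : ℝ)} ≤ 1 / 2) :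
    K * Real.log (n / K) ≤ (1 + η) * (K * (K - 1) / 2 * kl P Q) + Real.log 4 +
      ε * K * (Real.log (n / K) + 2 * Real.log (1 / ε) + 2) := by
  have hK0 : (1 : ℝ) ≤ K := by exact_mod_cast hK
  have hDpos := h.kl_pos
  have hc1 := h.one_le 1
  have hN : (0 : ℝ) < (communities n K).card := by
    rw [card_communities]; exact_mod_cast Nat.choose_pos hKn
  set N : ℝ := ((communities n K).card : ℝ) with hNdef
  set A := (K : ℝ) * (K - 1) / 2 * kl P Q with hA
  have hA0 : 0 ≤ A := by
    have : (0 : ℝ) ≤ K - 1 := by linarith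
    positivity
  set b := (1 + η) * A with hb
  set G : (Fin n → Bool) → Set (Pair n → ℝ) := fun ξ =>
    {x | ¬ ε < (hammingDist ξ (g (symmMatrix x)) : ℝ) / (K : ℝ)} with hG
  have hGm : ∀ ξ, MeasurableSet (G ξ) := fun ξ =>
    measurableSet_est hg fun ζ => ¬ ε < (hammingDist ξ ζ : ℝ) / (K : ℝ)
  -- Change of measure to pure noise, the law of the empty community: under `ξ` its score exceeds
  -- `b`, which is `1 + η` times its mean, with probability at most 1/4.
  have h1 : ∀ ξ ∈ communities n K, Real.exp (-b) * (3 / 4 - (law P Q (supp ξ)).real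
      {x | ε < (hammingDist ξ (g (symmMatrix x)) : ℝ) / (K : ℝ)}) ≤
        (law P Q (∅ : Finset (Fin n))).real (G ξ) := by
    intro ξ hξ
    rw [mem_communities] at hξ
    have := isProbabilityMeasure_law h (supp ξ)
    refine le_trans (mul_le_mul_of_nonneg_left ?_ (Real.exp_pos _).le)
      (exp_neg_mul_le_law_real h (supp ξ) ∅ (hGm ξ) b)
    have e0 : ∀ x : Pair n → ℝ, score (llr P Q) (supp ξ) x - score (llr P Q) ∅ x =
        ∑ e ∈ edges (supp ξ), llr P Q (x e) := by
      intro x; simp [score, edges]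
    simp only [e0]
    set u := η / (2 * c 1) with hu
    have hu0 : 0 < u := by positivity
    have hu1 : u ≤ 1 := by rw [hu, div_le_one (by positivity)]; linarith
    have e1 : (law P Q (supp ξ)).real {x | b ≤ ∑ e ∈ edges (supp ξ), llr P Q (x e)} ≤ 1 / 4 := by
      have e2 := law_real_le_of_subset h (subset_refl (edges (supp ξ))) u (u * b)
      have e3 : {x : Pair n → ℝ | b ≤ ∑ e ∈ edges (supp ξ), llr P Q (x e)} ⊆
          {x | u * b ≤ u * ∑ e ∈ edges (supp ξ), llr P Q (x e)} :=
        fun x hx => mul_le_mul_of_nonneg_left hx hu0.le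
      refine (measureReal_mono e3).trans (e2.trans ?_)
      have e4 := h.logMgf_add_le 1 (by simp) 1 u (by rwa [abs_of_pos hu0])
      rw [h.logMgf_one, h.deriv_logMgf_one, zero_add] at e4
      rw [card_edges, hξ, Nat.cast_choose_two]
      have e5 : (K : ℝ) * (K - 1) / 2 * logMgf P Q (1 + u) ≤
          (K : ℝ) * (K - 1) / 2 * (u * kl P Q + c 1 * kl P Q * u ^ 2) :=
        mul_le_mul_of_nonneg_left e4 (by
          have : (0 : ℝ) ≤ K - 1 := by linarith
          positivity)
      have e6 : (K : ℝ) * (K - 1) / 2 * (u * kl P Q + c 1 * kl P Q * u ^ 2) - u * b =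
          -(A * (η ^ 2 / (4 * c 1))) := by
        rw [hb, hA, hu]
        field_simp
        ring
      calc _ ≤ Real.exp (-Real.log 4) := Real.exp_le_exp.mpr (by linarith)
        _ = 1 / 4 := by rw [Real.exp_neg, Real.exp_log (by norm_num)]; norm_num
    have e2 : (law P Q (supp ξ)).real (G ξ) = 1 - (law P Q (supp ξ)).real
        {x | ε < (hammingDist ξ (g (symmMatrix x)) : ℝ) / (K : ℝ)} := by
      rw [← probReal_univ (μ := law P Q (supp ξ)), ← measureReal_compl
        (measurableSet_est hg fun ζ => ε < (hammingDist ξ ζ : ℝ) / (K : ℝ))]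
      rfl
    linarith
  have h2 := Finset.sum_le_sum h1
  rw [← Finset.mul_sum, Finset.sum_sub_distrib, Finset.sum_const, nsmul_eq_mul] at h2
  rw [jointLaw_real_est h K hg fun ξ ζ => ε < (hammingDist ξ ζ : ℝ) / (K : ℝ),
    div_le_iff₀ hN] at hp
  set V := Real.exp (ε * K * (Real.log (n / K) + 2 * Real.log (1 / ε) + 2)) with hV
  -- For each matrix, the communities within distance `ε K` of the estimate lie in one Hamming ball.
  have h3 : ∑ ξ ∈ communities n K, (law P Q (∅ : Finset (Fin n))).real (G ξ) ≤ V := by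
    have := isProbabilityMeasure_law h (∅ : Finset (Fin n))
    refine sum_measureReal_le _ _ _ (fun ξ _ => hGm ξ) _ fun x => ?_
    refine le_trans (le_of_eq ?_) (card_communities_near_le hK hKn hε hε1 (g (symmMatrix x)))
    rw [Finset.card_filter, Nat.cast_sum]
    refine Finset.sum_congr rfl fun ξ _ => ?_
    by_cases hx : x ∈ G ξ
    · rw [Set.indicator_of_mem hx, if_pos, Nat.cast_one]
      have : ¬ ε < (hammingDist ξ (g (symmMatrix x)) : ℝ) / (K : ℝ) := hx
      rwa [not_lt, div_le_iff₀ (by linarith)] at this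
    · rw [Set.indicator_of_notMem hx, if_neg, Nat.cast_zero]
      have : ¬ ¬ ε < (hammingDist ξ (g (symmMatrix x)) : ℝ) / (K : ℝ) := hx
      rwa [not_not, lt_div_iff₀ (by linarith), ← not_le] at this
  have h4 : Real.exp (-b) * (N / 4) ≤ V := by
    refine le_trans (mul_le_mul_of_nonneg_left ?_ (Real.exp_pos _).le) (h2.trans h3)
    linarith
  have h5 : ((n : ℝ) / K) ^ K ≤ N := by
    rw [hNdef, card_communities]; exact div_pow_le_choose hKn
  have hnK : (0 : ℝ) < n / K := by
    have : (0 : ℝ) < n := by exact_mod_cast hK.trans hKn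
    positivity
  have h6 : Real.exp (K * Real.log (n / K)) ≤ Real.exp (b + Real.log 4 +
      ε * K * (Real.log (n / K) + 2 * Real.log (1 / ε) + 2)) := by
    rw [Real.exp_nat_mul, Real.exp_log hnK, Real.exp_add, Real.exp_add,
      Real.exp_log (by norm_num), ← hV]
    refine h5.trans ?_
    have h7 : Real.exp b * Real.exp (-b) = 1 := by rw [← Real.exp_add]; simp
    calc N = Real.exp b * Real.exp (-b) * N := by rw [h7, one_mul]
      _ = Real.exp b * 4 * (Real.exp (-b) * (N / 4)) := by ring
      _ ≤ _ := mul_le_mul_of_nonneg_left h4 (by positivity)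
  exact Real.exp_le_exp.mp h6

end Counting

section Necessary

variable {K : ℕ → ℕ} {P Q : ℕ → Measure ℝ} {c : ℝ → ℝ} {κ : ℝ}

lemma SizeBound.log_pos (hs : SizeBound K κ) : 0 < Real.log (1 / κ) :=
  Real.log_pos (by rw [lt_div_iff₀ hs.pos]; linarith [hs.lt_one])

lemma SizeBound.tendsto_mul_log (hs : SizeBound K κ) :
    Tendsto (fun n => (K n : ℝ) * Real.log (n / K n)) atTop atTop := by
  rw [tendsto_atTop]
  intro M
  have h1 : Tendsto (fun n : ℕ => √(n : ℝ) * Real.log (1 / κ)) atTop atTop :=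
    (Real.tendsto_sqrt_atTop.comp tendsto_natCast_atTop_atTop).atTop_mul_const hs.log_pos
  have h2 : Tendsto (fun n : ℕ => Real.log n) atTop atTop :=
    Real.tendsto_log_atTop.comp tendsto_natCast_atTop_atTop
  filter_upwards [h1.eventually_ge_atTop M, h2.eventually_ge_atTop M, hs.eventually] with
    n h3 h4 ⟨h5, h6, h7⟩
  have hlog := SizeBound.log_div_ge hs.pos h5 h6
  have hK : (2 : ℝ) ≤ K n := by exact_mod_cast h5
  have hn : (0 : ℝ) < n := by exact_mod_cast (by omega : 0 < n)
  -- Either `K ≥ √n` with logarithm at least `log (1 / κ)`, or `n / K ≥ √n`, so that the logarithm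
  -- is at least `log n / 2` and `K ≥ 2`.
  rcases le_total (√(n : ℝ)) (K n) with h8 | h8
  · exact h3.trans (mul_le_mul h8 hlog hs.log_pos.le (by linarith))
  · have h9 : √(n : ℝ) ≤ n / K n := by
      rw [le_div_iff₀ (by linarith)]
      calc √(n : ℝ) * K n ≤ √(n : ℝ) * √(n : ℝ) :=
            mul_le_mul_of_nonneg_left h8 (Real.sqrt_nonneg _)
        _ = n := Real.mul_self_sqrt hn.le
    have h10 := Real.log_le_log (Real.sqrt_pos.mpr hn) h9
    rw [Real.log_sqrt hn.le] at h10
    have h11 : 0 ≤ Real.log (n / K n) := hs.log_pos.le.trans hlog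
    nlinarith

lemma tendsto_mul_kl_of_recovery (h : ∀ n, RegularPair (P n) (Q n) c) (hs : SizeBound K κ)
    (hrec : AlmostExactRecoveryPossible K P Q) :
    Tendsto (fun n => (K n : ℝ) * kl (P n) (Q n)) atTop atTop := by
  obtain ⟨est, hmeas, hest⟩ := hrec
  rw [tendsto_atTop]
  intro M
  set g := 3 / 4 * Real.exp (-(swapConst c * M + Real.log 4)) with hg
  have hg0 : 0 < g := by positivity
  have hκ : 0 < 1 - κ := by linarith [hs.lt_one]
  -- With this accuracy and error probability at most `g / 8`, `le_jointLaw_of_bounded` would give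
  -- `(n - K) g ≤ (n - K) g / 2`.
  have hp := (tendsto_jointLaw_iff h _).mp (hest ((1 - κ) * g / 8) (by positivity))
  filter_upwards [hp.eventually_le_const (by positivity : 0 < g / 8), hs.eventually] with
    n h1 ⟨h2, h3, h4⟩
  by_contra! hcon
  have h5 := le_jointLaw_of_bounded (h n) (by omega : 1 ≤ K n) (SizeBound.le_of_le hs.lt_one h3)
    hcon.le (hmeas n) (ε := (1 - κ) * g / 8) (by positivity)
  rw [← hg] at h5
  have hn : (0 : ℝ) < n := by exact_mod_cast (by omega : 0 < n)
  have h6 : (1 - κ) * n ≤ n - K n := by linarith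
  have h7 : 0 < (n : ℝ) - K n := (mul_pos hκ hn).trans_le h6
  have h8 := mul_le_mul_of_nonneg_left h1 h7.le
  have h9 := mul_le_mul_of_nonneg_left h6 hg0.le
  have h10 := mul_pos h7 hg0
  linarith

lemma two_le_liminf_of_recovery (h : ∀ n, RegularPair (P n) (Q n) c) (hs : SizeBound K κ)
    (hrec : AlmostExactRecoveryPossible K P Q) :
    2 ≤ liminf (infoRatio K P Q) atTop := by
  have hKD := tendsto_mul_kl_of_recovery h hs hrec
  obtain ⟨est, hmeas, hest⟩ := hrec
  refine EReal.ge_of_forall_gt_iff_ge.mp fun a ha => ?_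
  have ha2 : a < 2 := EReal.coe_lt_coe_iff.mp ha
  set η := min (1 / 2) ((2 - a) / 8) with hη
  have hη0 : 0 < η := lt_min (by norm_num) (by linarith)
  have hη1 : η ≤ 1 / 2 := min_le_left _ _
  have hη2 : η ≤ (2 - a) / 8 := min_le_right _ _
  have hℓ := hs.log_pos
  -- The accuracy is `δ²`, so that the entropy term `δ² log (1 / δ²)` is of order `δ`; it is
  -- absorbed by `η log (n / K)`, which is at least `η log (1 / κ)`.
  set δ := min η (η * Real.log (1 / κ) / 4) with hδ
  have hδ0 : 0 < δ := lt_min hη0 (by positivity)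
  have hδη : δ ≤ η := min_le_left _ _
  have hδℓ : 4 * δ ≤ η * Real.log (1 / κ) := by linarith [min_le_right η (η * Real.log (1 / κ) / 4)]
  have hδε : δ ^ 2 ≤ δ := by nlinarith
  have hent : δ ^ 2 * (2 * Real.log (1 / δ ^ 2) + 2) ≤ 4 * δ := by
    have h1 : Real.log (1 / δ ^ 2) = 2 * Real.log (1 / δ) := by
      rw [← one_div_pow, Real.log_pow]; norm_num
    have h2 := Real.log_le_sub_one_of_pos (x := 1 / δ) (by positivity)
    rw [h1]
    calc δ ^ 2 * (2 * (2 * Real.log (1 / δ)) + 2) ≤ δ ^ 2 * (2 * (2 * (1 / δ - 1)) + 2) := by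
          gcongr
      _ = 4 * δ - 2 * δ ^ 2 := by field_simp; ring
      _ ≤ _ := by nlinarith [sq_nonneg δ]
  have hc1 := (h 0).one_le 1
  have hp := (tendsto_jointLaw_iff h _).mp (hest (δ ^ 2) (by positivity))
  refine le_liminf_of_le ?_ ?_
  · isBoundedDefault
  filter_upwards [hp.eventually_le_const (by norm_num : (0 : ℝ) < 1 / 2), hs.eventually,
    hKD.eventually_ge_atTop (2 * Real.log 4 / (η ^ 2 / (4 * c 1))),
    hs.tendsto_mul_log.eventually_ge_atTop (Real.log 4 / η)] with n h1 ⟨h2, h3, h4⟩ h5 h6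
  have hK : (2 : ℝ) ≤ K n := by exact_mod_cast h2
  have hD := (h n).kl_pos
  have hlog := SizeBound.log_div_ge hs.pos h2 h3
  have hlog0 := hs.log_pos.trans_le hlog
  rw [div_le_iff₀ (by positivity)] at h5 h6
  have h7 := mul_log_le_of_recovery (h n) (by omega : 1 ≤ K n)
    (SizeBound.le_of_le hs.lt_one h3) hη0 (by linarith) (ε := δ ^ 2) (by positivity)
    (by linarith) (by
      have : K n * kl (P n) (Q n) ≤ 2 * (K n * (K n - 1) / 2 * kl (P n) (Q n)) := by
        have := mul_pos (by linarith : (0 : ℝ) < K n) hD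
        nlinarith
      have := mul_le_mul_of_nonneg_right this (by positivity : 0 ≤ η ^ 2 / (4 * c 1))
      linarith) (hmeas n) h1
  set ℓ := Real.log (n / K n) with hℓdef
  have h8 : δ ^ 2 * (ℓ + 2 * Real.log (1 / δ ^ 2) + 2) ≤ 2 * η * ℓ := by
    have e1 : δ ^ 2 * ℓ ≤ η * ℓ := mul_le_mul_of_nonneg_right (hδε.trans hδη) hlog0.le
    have e2 : η * Real.log (1 / κ) ≤ η * ℓ := mul_le_mul_of_nonneg_left hlog hη0.le
    linarith
  have h9 := mul_le_mul_of_nonneg_left h8 (by linarith : (0 : ℝ) ≤ K n)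
  have h10 : K n * ((1 - 3 * η) * ℓ) ≤ K n * ((1 + η) * ((K n - 1) * kl (P n) (Q n) / 2)) := by
    linarith
  have h11 := le_of_mul_le_mul_left h10 (by linarith)
  rw [infoRatio, EReal.coe_le_coe_iff, le_div_iff₀ hlog0]
  have h12 : a * (1 + η) ≤ 2 * (1 - 3 * η) := by nlinarith
  have h13 := mul_le_mul_of_nonneg_right h12 hlog0.le
  have h14 : (1 + η) * (a * ℓ) ≤ (1 + η) * ((K n - 1) * kl (P n) (Q n)) := by linarith
  exact le_of_mul_le_mul_left h14 (by linarith)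

lemma ExactRecoveryPossible.almostExact (h : ExactRecoveryPossible K P Q) :
    AlmostExactRecoveryPossible K P Q := by
  obtain ⟨est, hmeas, hest⟩ := h
  refine ⟨est, hmeas, fun ε hε => tendsto_of_tendsto_of_tendsto_of_le_of_le tendsto_const_nhds
    hest (fun _ => zero_le) fun n => measure_mono fun z hz heq => ?_⟩
  have hz : ε < (hammingDist z.1 (est n z.2) : ℝ) / (K n : ℝ) := hz
  rw [← heq, hammingDist_self, Nat.cast_zero, zero_div] at hz
  exact absurd hz (not_lt.mpr hε.le)

end Necessary

/-! ### Necessary conditions for exact recovery -/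

section Coordinates

variable {ι : Type*}

/-- The σ-algebra of the events that depend only on the coordinates in `S`. -/
abbrev coordMeas (S : Finset ι) : MeasurableSpace (ι → ℝ) :=
  MeasurableSpace.comap (fun x (i : S) => x i) inferInstance

lemma coordMeas_le (S : Finset ι) : coordMeas S ≤ MeasurableSpace.pi :=
  Measurable.comap_le (f := fun (x : ι → ℝ) (i : S) => x i)
    (measurable_pi_lambda _ fun i => measurable_pi_apply (i : ι))

lemma measurable_coord {S : Finset ι} {e : ι} (he : e ∈ S) :
    Measurable[coordMeas S] fun x : ι → ℝ => x e := by
  have h1 : Measurable[coordMeas S] fun (x : ι → ℝ) (i : S) => x i := comap_measurable _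
  exact (measurable_pi_apply (⟨e, he⟩ : S)).comp h1

lemma coordMeas_mono {S T : Finset ι} (h : S ⊆ T) : coordMeas S ≤ coordMeas T := by
  refine Measurable.comap_le ?_
  exact @measurable_pi_lambda _ _ _ (coordMeas T) _ _ fun i => measurable_coord (h i.2)

lemma measurable_sum_coord {L : ℝ → ℝ} (hL : Measurable L) {S F : Finset ι} (h : F ⊆ S) :
    Measurable[coordMeas S] fun x : ι → ℝ => ∑ e ∈ F, L (x e) :=
  Finset.measurable_sum _ fun _ he => hL.comp (measurable_coord (h he))

variable [Fintype ι]

lemma indep_coordMeas (μ : ι → Measure ℝ) [∀ i, IsProbabilityMeasure (μ i)] {S T : Finset ι}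
    (h : Disjoint S T) : Indep (coordMeas S) (coordMeas T) (Measure.pi μ) := by
  have h1 : iIndepFun (fun i (x : ι → ℝ) => x i) (Measure.pi μ) :=
    iIndepFun_pi (X := fun _ x => x) fun i => aemeasurable_id
  exact h1.indepFun_finset S T h fun i => measurable_pi_apply i

/-- Some of many independent events occurs. -/
lemma one_sub_exp_le_biUnion [DecidableEq ι] (μ : ι → Measure ℝ)
    [∀ i, IsProbabilityMeasure (μ i)] {κ : Type*} (s : Finset κ) (F : κ → Finset ι)
    (hF : ∀ k ∈ s, ∀ l ∈ s, k ≠ l → Disjoint (F k) (F l)) (A : κ → Set (ι → ℝ))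
    (hA : ∀ k ∈ s, MeasurableSet[coordMeas (F k)] (A k)) {p : ℝ}
    (hp : ∀ k ∈ s, p ≤ (Measure.pi μ).real (A k)) :
    1 - Real.exp (-(p * s.card)) ≤ (Measure.pi μ).real (⋃ k ∈ s, A k) := by
  classical
  have key : ∀ t : Finset κ, t ⊆ s → MeasurableSet[coordMeas (t.biUnion F)] (⋃ k ∈ t, A k) ∧
      (Measure.pi μ).real (⋃ k ∈ t, A k)ᶜ ≤ Real.exp (-(p * t.card)) := by
    intro t
    induction t using Finset.induction_on with
    | empty => intro _; simp
    | insert a t ha ih =>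
      intro hts
      obtain ⟨h1, h2⟩ := ih ((Finset.subset_insert a t).trans hts)
      have has := hts (Finset.mem_insert_self a t)
      have hm := hA a has
      have hd : Disjoint (F a) (t.biUnion F) := by
        rw [Finset.disjoint_biUnion_right]
        exact fun k hk => hF a has k (hts (Finset.mem_insert_of_mem hk)) fun hak => ha (hak ▸ hk)
      have hind := (Indep_iff _ _ _).mp (indep_coordMeas μ hd) _ _ hm.compl h1.compl
      rw [Finset.set_biUnion_insert, Finset.biUnion_insert]
      refine ⟨MeasurableSet.union (coordMeas_mono Finset.subset_union_left _ hm)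
        (coordMeas_mono Finset.subset_union_right _ h1), ?_⟩
      rw [Set.compl_union, measureReal_def, hind, ENNReal.toReal_mul, ← measureReal_def,
        ← measureReal_def, Finset.card_insert_of_notMem ha,
        show -(p * ((t.card + 1 : ℕ) : ℝ)) = -p + -(p * t.card) by push_cast; ring, Real.exp_add,
        probReal_compl_eq_one_sub (coordMeas_le _ _ hm)]
      refine mul_le_mul ?_ h2 measureReal_nonneg (Real.exp_pos _).le
      have := Real.add_one_le_exp (-p)
      linarith [hp a has]
  obtain ⟨h1, h2⟩ := key s (subset_refl s)
  rw [probReal_compl_eq_one_sub (coordMeas_le _ _ h1)] at h2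
  linarith

/-- If one of the events `A k` occurs, then it does so together with an independent likely
event. -/
lemma mul_biUnion_le {Ω κ : Type*} {m₁ m₂ : MeasurableSpace Ω} {m : MeasurableSpace Ω}
    (μ : Measure Ω) [IsProbabilityMeasure μ] (h₁ : m₁ ≤ m) (h₂ : m₂ ≤ m) (hind : Indep m₁ m₂ μ)
    (s : Finset κ) (A B : κ → Set Ω) (hA : ∀ k ∈ s, MeasurableSet[m₁] (A k))
    (hB : ∀ k ∈ s, MeasurableSet[m₂] (B k)) {q : ℝ} (hq0 : 0 ≤ q)
    (hq : ∀ k ∈ s, q ≤ μ.real (B k)) :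
    q * μ.real (⋃ k ∈ s, A k) ≤ μ.real (⋃ k ∈ s, A k ∩ B k) := by
  classical
  induction s using Finset.induction_on generalizing A with
  | empty => simp
  | insert a s ha ih =>
    have hAa := hA a (Finset.mem_insert_self a s)
    have hBa := hB a (Finset.mem_insert_self a s)
    -- Removing `A a` keeps the events in `m₁` and makes the pieces disjoint; this is why the
    -- induction generalises over `A`.
    have h1 := ih (fun k => A k \ A a)
      (fun k hk => (hA k (Finset.mem_insert_of_mem hk)).diff hAa)
      (fun k hk => hB k (Finset.mem_insert_of_mem hk))
      (fun k hk => hq k (Finset.mem_insert_of_mem hk))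
    have h2 : μ.real (A a ∩ B a) = μ.real (A a) * μ.real (B a) := by
      rw [measureReal_def, (Indep_iff _ _ _).mp hind _ _ hAa hBa, ENNReal.toReal_mul]; rfl
    have h3 : μ.real (⋃ k ∈ insert a s, A k) ≤ μ.real (A a) +
        μ.real (⋃ k ∈ s, A k \ A a) := by
      refine (measureReal_mono ?_).trans (measureReal_union_le _ _)
      intro x hx
      simp only [Set.mem_iUnion, Finset.mem_insert, exists_prop, Set.mem_union,
        Set.mem_sdiff] at hx ⊢
      obtain ⟨k, rfl | hk, hxk⟩ := hx
      · exact Or.inl hxk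
      · by_cases hxa : x ∈ A a
        · exact Or.inl hxa
        · exact Or.inr ⟨k, hk, hxk, hxa⟩
    have h4 : μ.real (A a ∩ B a) + μ.real (⋃ k ∈ s, (A k \ A a) ∩ B k) ≤
        μ.real (⋃ k ∈ insert a s, A k ∩ B k) := by
      rw [← measureReal_union (h₂ := measure_ne_top _ _)]
      · refine measureReal_mono ?_ (measure_ne_top _ _)
        intro x hx
        simp only [Set.mem_iUnion, Finset.mem_insert, exists_prop, Set.mem_union, Set.mem_inter_iff,
          Set.mem_sdiff] at hx ⊢
        rcases hx with hx | ⟨k, hk, hx⟩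
        · exact ⟨a, Or.inl rfl, hx⟩
        · exact ⟨k, Or.inr hk, hx.1.1, hx.2⟩
      · rw [Set.disjoint_left]
        intro x hx hx'
        simp only [Set.mem_iUnion, exists_prop, Set.mem_inter_iff, Set.mem_sdiff] at hx hx'
        obtain ⟨k, _, hx'⟩ := hx'
        exact hx'.1.2 hx.1
      · exact Finset.measurableSet_biUnion _ fun k hk =>
          ((h₁ _ (hA k (Finset.mem_insert_of_mem hk))).diff (h₁ _ hAa)).inter
            (h₂ _ (hB k (Finset.mem_insert_of_mem hk)))
    have h5 := mul_le_mul_of_nonneg_left (hq a (Finset.mem_insert_self a s))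
      (measureReal_nonneg (μ := μ) (s := A a))
    have h6 := mul_le_mul_of_nonneg_left h3 hq0
    linarith

end Coordinates

/-! ### Failure of every estimator when a swap does not lower the score. -/

section Compare

variable {n K : ℕ} {P Q : Measure ℝ} {c : ℝ → ℝ}

/-- The event that the community `C` is not the unique one of maximal score. -/
def swapEvent (L : ℝ → ℝ) (C : Finset (Fin n)) : Set (Pair n → ℝ) :=
  {x | ∃ C', C'.card = C.card ∧ C' ≠ C ∧ score L C x ≤ score L C' x}

lemma measurableSet_swapEvent {L : ℝ → ℝ} (hL : Measurable L) (C : Finset (Fin n)) :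
    MeasurableSet (swapEvent L C) := by
  have : swapEvent L C = ⋃ C' ∈ {C' : Finset (Fin n) | C'.card = C.card ∧ C' ≠ C},
      {x | score L C x ≤ score L C' x} := by
    ext x; simp [swapEvent, and_assoc]
  rw [this]
  exact MeasurableSet.biUnion (Set.to_countable _) fun C' _ =>
    measurableSet_le (measurable_score L hL C) (measurable_score L hL C')

lemma law_apply (h : RegularPair P Q c) (C : Finset (Fin n)) {B : Set (Pair n → ℝ)}
    (hB : MeasurableSet B) : law P Q C B = ∫⁻ x, B.indicator (fun x => ENNReal.ofReal
      (Real.exp (score (llr P Q) C x - score (llr P Q) ∅ x))) x ∂(law P Q ∅) := by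
  rw [law_eq_withDensity h ∅ C, withDensity_apply _ hB, lintegral_indicator hB]

/-- No estimator can be right when the true community is not the unique one of maximal score. -/
lemma sum_law_swapEvent_le (h : RegularPair P Q c) {g : DataMatrix n → (Fin n → Bool)}
    (hg : Measurable g) :
    ∑ ξ ∈ communities n K, (law P Q (supp ξ)).real (swapEvent (llr P Q) (supp ξ)) ≤
      2 * ∑ ξ ∈ communities n K, (law P Q (supp ξ)).real {x | ξ ≠ g (symmMatrix x)} := by
  have hS := fun C : Finset (Fin n) => measurableSet_swapEvent (measurable_llr P Q) C
  have hE : ∀ ξ : Fin n → Bool, MeasurableSet {x | ξ ≠ g (symmMatrix x)} := fun ξ =>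
    measurableSet_est hg fun ζ => ξ ≠ ζ
  have hpr := fun C => isProbabilityMeasure_law (n := n) h C
  have h1 : ∑ ξ ∈ communities n K, law P Q (supp ξ)
      (swapEvent (llr P Q) (supp ξ) \ {x | ξ ≠ g (symmMatrix x)}) ≤
        ∑ ξ ∈ communities n K, law P Q (supp ξ) {x | ξ ≠ g (symmMatrix x)} := by
    have hm : ∀ C : Finset (Fin n), Measurable fun x => ENNReal.ofReal
        (Real.exp (score (llr P Q) C x - score (llr P Q) ∅ x)) := fun C =>
      (((measurable_score _ (measurable_llr P Q) C).sub
        (measurable_score _ (measurable_llr P Q) ∅)).exp).ennreal_ofReal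
    rw [Finset.sum_congr rfl fun ξ _ => law_apply h (supp ξ) ((hS (supp ξ)).diff (hE ξ)),
      Finset.sum_congr rfl fun ξ _ => law_apply h (supp ξ) (hE ξ),
      ← lintegral_finsetSum _ fun ξ _ => (hm _).indicator ((hS (supp ξ)).diff (hE ξ)),
      ← lintegral_finsetSum _ fun ξ _ => (hm _).indicator (hE ξ)]
    -- On densities relative to pure noise: at most one community equals the estimate at `x`. If it
    -- has a competitor of at least its score, that competitor has at least its density, and the
    -- estimate is wrong for it.
    refine lintegral_mono fun x => ?_
    by_cases hx : ∃ ξ ∈ communities n K,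
        x ∈ swapEvent (llr P Q) (supp ξ) \ {x | ξ ≠ g (symmMatrix x)}
    · obtain ⟨ξ, hξ, hx1, hx2⟩ := hx
      have hx2 : ξ = g (symmMatrix x) := not_not.mp hx2
      obtain ⟨C', hC', hne, hsc⟩ := hx1
      rw [Finset.sum_eq_single_of_mem ξ hξ fun ζ _ hζ => Set.indicator_of_notMem
        (fun hz => hζ ((not_not.mp hz.2 : ζ = g (symmMatrix x)).trans hx2.symm)) _]
      have hζ : (fun i => decide (i ∈ C')) ∈ communities n K := by
        rw [mem_communities, supp_decide, hC', mem_communities.mp hξ]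
      refine le_trans ?_ (Finset.single_le_sum_of_canonicallyOrdered hζ)
      rw [Set.indicator_of_mem (show x ∈ {x | (fun i => decide (i ∈ C')) ≠ g (symmMatrix x)} by
        intro heq
        rw [← hx2] at heq
        exact hne (by rw [← heq, supp_decide])), supp_decide]
      refine (Set.indicator_le_self _ _ _).trans (ENNReal.ofReal_le_ofReal ?_)
      exact Real.exp_le_exp.mpr (sub_le_sub_right hsc _)
    · push Not at hx
      rw [Finset.sum_eq_zero fun ξ hξ => Set.indicator_of_notMem (hx ξ hξ) _]
      exact zero_le
  have h2 := ENNReal.toReal_mono (ENNReal.sum_ne_top.mpr fun ξ _ => measure_ne_top _ _) h1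
  rw [ENNReal.toReal_sum fun ξ _ => measure_ne_top _ _,
    ENNReal.toReal_sum fun ξ _ => measure_ne_top _ _] at h2
  have h3 : ∀ ξ ∈ communities n K, (law P Q (supp ξ)).real (swapEvent (llr P Q) (supp ξ)) ≤
      (law P Q (supp ξ)).real (swapEvent (llr P Q) (supp ξ) \ {x | ξ ≠ g (symmMatrix x)}) +
        (law P Q (supp ξ)).real {x | ξ ≠ g (symmMatrix x)} := fun ξ _ => by
    rw [← measureReal_sdiff_add_inter (hE ξ) (s := swapEvent (llr P Q) (supp ξ))]
    exact add_le_add le_rfl (measureReal_mono Set.inter_subset_right)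
  refine (Finset.sum_le_sum h3).trans ?_
  rw [Finset.sum_add_distrib, two_mul]
  exact add_le_add h2 le_rfl

end Compare

/-! ### Existence of a favourable swap. -/

section SwapLowerBound

variable {n : ℕ} {P Q : Measure ℝ} {c : ℝ → ℝ}

lemma exp_neg_le_one_div {x : ℝ} (hx : 0 ≤ x) : Real.exp (-x) ≤ 1 / (1 + x) := by
  rw [Real.exp_neg, ← one_div]
  exact one_div_le_one_div_of_le (by linarith) (by linarith [Real.add_one_le_exp x])

lemma measurableSet_le_real {Ω : Type*} {m : MeasurableSpace Ω} {f g : Ω → ℝ}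
    (hf : Measurable[m] f) (hg : Measurable[m] g) : MeasurableSet[m] {x | f x ≤ g x} :=
  measurableSet_le hf hg

/-- Sums over ties to `C \ I` use disjoint sets of pairs for different vertices of `I` or outside
`C`, hence are independent; pairs inside `I`, shared by its members, go into the remainder. -/
lemma score_swap {C I : Finset (Fin n)} (hI : I ⊆ C) {i j : Fin n} (hi : i ∈ I) (hj : j ∉ C)
    (L : ℝ → ℝ) (x : Pair n → ℝ) :
    score L (insert j (C.erase i)) x - score L C x =
      (∑ e ∈ cross {j} (C \ I), L (x e) - ∑ e ∈ cross {i} (C \ I), L (x e)) +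
      (∑ e ∈ cross {j} (I.erase i), L (x e) - ∑ e ∈ cross {i} (I.erase i), L (x e)) := by
  have h1 : ∀ v ∉ C.erase i, ∑ e ∈ cross {v} (C.erase i), L (x e) =
      ∑ e ∈ cross {v} (C \ I), L (x e) + ∑ e ∈ cross {v} (I.erase i), L (x e) := by
    intro v hv
    have h2 : C.erase i \ I.erase i = C \ I := by
      ext k
      simp only [Finset.mem_sdiff, Finset.mem_erase]
      by_cases hk : k = i
      · subst hk; simp [hi]
      · simp [hk]
    have hsub : I.erase i ⊆ C.erase i := Finset.erase_subset_erase i hI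
    rw [cross_eq_union hsub, h2, Finset.sum_union]
    refine disjoint_cross_cross ?_ ?_ ?_
    · rw [← h2]; exact Finset.sdiff_disjoint
    · rw [← h2, Finset.disjoint_singleton_left]
      exact fun h => hv (Finset.mem_sdiff.mp h).1
    · rw [Finset.disjoint_singleton_left]
      exact fun h => hv (hsub h)
  have hjC : j ∉ C.erase i := fun h => hj (Finset.mem_of_mem_erase h)
  have hiC := Finset.notMem_erase i C
  have h3 := score_insert L hiC x
  rw [Finset.insert_erase (hI hi), h1 i hiC] at h3
  rw [score_insert L hjC, h1 j hjC, h3]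
  ring

/-- If some member of `C` is weakly connected and some other index is strongly connected to most
of `C`, then a swap increases the score. -/
lemma half_le_law_real_swapEvent (h : RegularPair P Q c) {C I : Finset (Fin n)} (hI : I ⊆ C)
    {α s p q : ℝ} (hs : I.card * (swapConst c * kl P Q) + 3 ≤ s)
    (hp : ∀ i ∈ I, p ≤ (law P Q C).real {x | ∑ e ∈ cross {i} (C \ I), llr P Q (x e) ≤ α})
    (hq : ∀ j ∈ Cᶜ, q ≤ (law P Q C).real {x | α + s ≤ ∑ e ∈ cross {j} (C \ I), llr P Q (x e)})
    (hpI : 7 ≤ p * I.card) (hqC : 7 ≤ q * Cᶜ.card) :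
    1 / 2 ≤ (law P Q C).real (swapEvent (llr P Q) C) := by
  have := h.prob_right
  have := isProbabilityMeasure_law h C
  have hprob := fun e : Pair n =>
    isProbabilityMeasure_tilted_mul h.integrable_exp (indic (edges C) e)
  have hL := measurable_llr P Q
  have hlaw : law P Q C = Measure.pi fun e => Q.tilted fun x => indic (edges C) e * llr P Q x := rfl
  set A₁ : Fin n → Set (Pair n → ℝ) :=
    fun i => {x | ∑ e ∈ cross {i} (C \ I), llr P Q (x e) ≤ α} with hA₁
  set A₂ : Fin n → Set (Pair n → ℝ) :=
    fun j => {x | α + s ≤ ∑ e ∈ cross {j} (C \ I), llr P Q (x e)} with hA₂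
  set B : Fin n × Fin n → Set (Pair n → ℝ) := fun k => {x | -s ≤
    ∑ e ∈ cross {k.2} (I.erase k.1), llr P Q (x e) -
      ∑ e ∈ cross {k.1} (I.erase k.1), llr P Q (x e)} with hB
  -- The choice of the vertices to swap uses the pairs in `S`, the remainder those in `T`. As `S`
  -- and `T` are disjoint, the remainder is independent of the choice.
  set S := cross (I ∪ Cᶜ) (C \ I) with hS
  set T := edges (I ∪ Cᶜ) with hT
  have hdis : Disjoint (I ∪ Cᶜ) (C \ I) := by
    rw [Finset.disjoint_left]
    intro v
    simp only [Finset.mem_union, Finset.mem_compl, Finset.mem_sdiff]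
    tauto
  have hST : Disjoint S T := (disjoint_edges_cross hdis).symm
  have hsubS : ∀ v ∈ I ∪ Cᶜ, cross {v} (C \ I) ⊆ S := by
    intro v hv e he
    simp only [mem_cross, Finset.mem_singleton] at he
    rw [hS, mem_cross]
    rcases he with ⟨rfl, he⟩ | ⟨he, rfl⟩
    · exact Or.inl ⟨hv, he⟩
    · exact Or.inr ⟨he, hv⟩
  have hsubT : ∀ v ∈ I ∪ Cᶜ, ∀ i, cross {v} (I.erase i) ⊆ T := by
    intro v hv i e he
    simp only [mem_cross, Finset.mem_singleton] at he
    rw [hT, mem_edges]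
    rcases he with ⟨rfl, he⟩ | ⟨he, rfl⟩
    · exact ⟨hv, Finset.mem_union_left _ (Finset.mem_of_mem_erase he)⟩
    · exact ⟨Finset.mem_union_left _ (Finset.mem_of_mem_erase he), hv⟩
  have hpair : ∀ v ∈ I ∪ Cᶜ, ∀ w ∈ I ∪ Cᶜ, v ≠ w →
      Disjoint (cross {v} (C \ I)) (cross {w} (C \ I)) := by
    intro v hv w hw hvw
    rw [Finset.disjoint_left]
    intro e h1 h2
    have hv' := Finset.disjoint_left.mp hdis hv
    have hw' := Finset.disjoint_left.mp hdis hw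
    simp only [mem_cross, Finset.mem_singleton] at h1 h2
    rcases h1 with ⟨rfl, h1⟩ | ⟨h1, rfl⟩ <;> rcases h2 with ⟨rfl, h2⟩ | ⟨h2, rfl⟩ <;> tauto
  have hmA₁ : ∀ F : Finset (Pair n), ∀ i, cross {i} (C \ I) ⊆ F →
      MeasurableSet[coordMeas F] (A₁ i) := fun F i hF =>
    measurableSet_le_real (measurable_sum_coord hL hF) measurable_const
  have hmA₂ : ∀ F : Finset (Pair n), ∀ j, cross {j} (C \ I) ⊆ F →
      MeasurableSet[coordMeas F] (A₂ j) := fun F i hF =>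
    measurableSet_le_real measurable_const (measurable_sum_coord hL hF)
  have hU := one_sub_exp_le_biUnion (fun e => Q.tilted fun x => indic (edges C) e * llr P Q x) I
    (fun i => cross {i} (C \ I)) (fun i hi j hj => hpair i (Finset.mem_union_left _ hi) j
      (Finset.mem_union_left _ hj)) A₁ (fun i _ => hmA₁ _ i (subset_refl _)) hp
  have hV := one_sub_exp_le_biUnion (fun e => Q.tilted fun x => indic (edges C) e * llr P Q x) Cᶜ
    (fun i => cross {i} (C \ I)) (fun i hi j hj => hpair i (Finset.mem_union_right _ hi) j
      (Finset.mem_union_right _ hj)) A₂ (fun i _ => hmA₂ _ i (subset_refl _)) hq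
  rw [← hlaw] at hU hV
  have hexp : ∀ y : ℝ, 7 ≤ y → Real.exp (-y) ≤ 1 / 8 := fun y hy =>
    (exp_neg_le_one_div (by linarith)).trans (one_div_le_one_div_of_le (by norm_num) (by linarith))
  have hU' := hexp _ hpI
  have hV' := hexp _ hqC
  have hUV : (⋃ i ∈ I, A₁ i) ∩ (⋃ j ∈ Cᶜ, A₂ j) ⊆ ⋃ k ∈ I ×ˢ Cᶜ, A₁ k.1 ∩ A₂ k.2 := by
    rintro x ⟨hx1, hx2⟩
    simp only [Set.mem_iUnion, exists_prop] at hx1 hx2 ⊢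
    obtain ⟨i, hi, hx1⟩ := hx1
    obtain ⟨j, hj, hx2⟩ := hx2
    exact ⟨(i, j), Finset.mk_mem_product hi hj, hx1, hx2⟩
  have hVm : MeasurableSet (⋃ j ∈ Cᶜ, A₂ j) := Finset.measurableSet_biUnion _ fun j _ =>
    coordMeas_le _ _ (hmA₂ _ j (subset_refl _))
  have h1 := measureReal_union_add_inter (μ := law P Q C) (s := ⋃ i ∈ I, A₁ i) hVm
    (measure_ne_top _ _) (measure_ne_top _ _)
  have h2 : (law P Q C).real ((⋃ i ∈ I, A₁ i) ∪ ⋃ j ∈ Cᶜ, A₂ j) ≤ 1 := measureReal_le_one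
  have h3 : 3 / 4 ≤ (law P Q C).real (⋃ k ∈ I ×ˢ Cᶜ, A₁ k.1 ∩ A₂ k.2) := by
    refine le_trans ?_ (measureReal_mono hUV (measure_ne_top _ _))
    linarith
  have hBm : ∀ k ∈ I ×ˢ Cᶜ, MeasurableSet[coordMeas T] (B k) := by
    intro k hk
    rw [Finset.mem_product] at hk
    exact measurableSet_le_real measurable_const
      ((measurable_sum_coord hL (hsubT _ (Finset.mem_union_right _ hk.2) _)).sub
        (measurable_sum_coord hL (hsubT _ (Finset.mem_union_left _ hk.1) _)))
  have hBp : ∀ k ∈ I ×ˢ Cᶜ, 3 / 4 ≤ (law P Q C).real (B k) := by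
    rintro ⟨i, j⟩ hk
    have hm := coordMeas_le _ _ (hBm _ hk)
    rw [Finset.mem_product, Finset.mem_compl] at hk
    obtain ⟨hi, hj⟩ := hk
    simp only at hi hj
    have e1 : cross {i} (I.erase i) ⊆ edges C := by
      intro e he
      simp only [mem_cross, Finset.mem_singleton] at he
      rw [mem_edges]
      rcases he with ⟨rfl, he⟩ | ⟨he, rfl⟩
      · exact ⟨hI hi, hI (Finset.mem_of_mem_erase he)⟩
      · exact ⟨hI (Finset.mem_of_mem_erase he), hI hi⟩
    have e2 : Disjoint (cross {j} (I.erase i)) (edges C) := by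
      rw [Finset.disjoint_left]
      intro e he he'
      simp only [mem_cross, Finset.mem_singleton] at he
      rw [mem_edges] at he'
      rcases he with ⟨rfl, _⟩ | ⟨_, rfl⟩
      · exact hj he'.1
      · exact hj he'.2
    have e3 := tiltPi_real_add_le_exp h (indic (edges C)) (e2.mono_right e1).symm (τ := 1) (σ := 0)
      (fun e he => if_pos (e1 he)) (fun e he => if_neg (Finset.disjoint_left.mp e2 he)) 1 (-1) s
    have hjI : j ∉ I.erase i := fun hjI => hj (hI (Finset.mem_of_mem_erase hjI))
    rw [card_cross (by simp), card_cross (by simpa using hjI),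
      Finset.card_singleton, Finset.card_singleton, one_mul, h.logMgf_one, h.logMgf_zero,
      show (1 : ℝ) + 1 = 2 by norm_num, zero_add, sub_zero, sub_zero] at e3
    have e4 : ((I.erase i).card : ℝ) * (logMgf P Q 2 + logMgf P Q (-1)) ≤
        I.card * (swapConst c * kl P Q) := by
      refine (mul_le_mul_of_nonneg_left h.logMgf_two_add_le (Nat.cast_nonneg _)).trans
        (mul_le_mul_of_nonneg_right ?_ (mul_pos h.swapConst_pos h.kl_pos).le)
      exact_mod_cast Finset.card_le_card (Finset.erase_subset i I)
    have e5 : (law P Q C).real (B (i, j))ᶜ ≤ 1 / 4 := by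
      refine (measureReal_mono (fun x hx => ?_) (measure_ne_top _ _)).trans (e3.trans ?_)
      · have hx : ¬ -s ≤ ∑ e ∈ cross {j} (I.erase i), llr P Q (x e) -
            ∑ e ∈ cross {i} (I.erase i), llr P Q (x e) := hx
        rw [Set.mem_ofPred_eq]
        linarith
      · calc _ ≤ Real.exp (-3) := Real.exp_le_exp.mpr (by linarith)
          _ ≤ 1 / (1 + 3) := exp_neg_le_one_div (by norm_num)
          _ = 1 / 4 := by norm_num
    rw [probReal_compl_eq_one_sub hm] at e5
    linarith
  -- A good pair of vertices exists with probability at least 3/4, the remainder is harmless with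
  -- probability at least 3/4, and `9 / 16 ≥ 1 / 2`.
  have h4 := mul_biUnion_le (law P Q C) (coordMeas_le S) (coordMeas_le T)
    (indep_coordMeas _ hST) (I ×ˢ Cᶜ) (fun k => A₁ k.1 ∩ A₂ k.2) B (fun k hk => by
      rw [Finset.mem_product] at hk
      exact (hmA₁ S k.1 (hsubS _ (Finset.mem_union_left _ hk.1))).inter
        (hmA₂ S k.2 (hsubS _ (Finset.mem_union_right _ hk.2)))) hBm (by norm_num) hBp
  have h5 : (⋃ k ∈ I ×ˢ Cᶜ, (A₁ k.1 ∩ A₂ k.2) ∩ B k) ⊆ swapEvent (llr P Q) C := by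
    intro x hx
    simp only [Set.mem_iUnion, exists_prop] at hx
    obtain ⟨⟨i, j⟩, hk, ⟨hx1, hx2⟩, hx3⟩ := hx
    rw [Finset.mem_product, Finset.mem_compl] at hk
    obtain ⟨hi, hj⟩ := hk
    simp only [hA₁, hA₂, hB, Set.mem_ofPred_eq] at hi hj hx1 hx2 hx3
    have hjC : j ∉ C.erase i := fun hjC => hj (Finset.mem_of_mem_erase hjC)
    refine ⟨insert j (C.erase i), ?_, ?_, ?_⟩
    · rw [Finset.card_insert_of_notMem hjC, Finset.card_erase_add_one (hI hi)]
    · exact fun heq => hj (heq ▸ Finset.mem_insert_self j _)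
    · have := score_swap hI hi hj (llr P Q) x
      linarith
  have h6 := measureReal_mono (μ := law P Q C) h5 (measure_ne_top _ _)
  linarith

/-- A lower bound for the probability that a sum is in a small window, by tilting. -/
lemma le_law_real_window (h : RegularPair P Q c) {C : Finset (Fin n)} {E : Finset (Pair n)}
    {τ t θ η : ℝ} (hE : ∀ e ∈ E, indic (edges C) e = τ) (hτ : τ ∈ Set.Icc (0 : ℝ) 1)
    (hτ0 : logMgf P Q τ = 0) (ht : t ∈ Set.Icc (0 : ℝ) 1) (hθ : deriv (logMgf P Q) t = θ)
    (hη0 : 0 < η) (hη1 : η ≤ 1) (hconc : 7 ≤ E.card * kl P Q * (η ^ 2 / (4 * c 1))) :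
    3 / 4 * Real.exp (E.card * (τ * θ - (t * θ - logMgf P Q t)) - η * (E.card * kl P Q)) ≤
      (law P Q C).real
        {x | |∑ e ∈ E, llr P Q (x e) - E.card * θ| ≤ η * (E.card * kl P Q)} := by
  have := h.prob_right
  have hL := measurable_llr P Q
  have hc1 := h.one_le 1
  have hD := h.kl_pos
  set M : ℝ := (E.card : ℝ) with hM
  set w := η * (M * kl P Q) with hw
  -- Only the pairs in `E` are retilted, to the parameter at which `L` has mean `θ`. The window is
  -- then typical, and the density on it fluctuates by at most `exp w` because `|τ - t| ≤ 1`.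
  set t' : Pair n → ℝ := fun e => if e ∈ E then t else indic (edges C) e with ht'
  have := isProbabilityMeasure_tiltPi h.integrable_exp t'
  set B : Set (Pair n → ℝ) := {x | |∑ e ∈ E, llr P Q (x e) - M * θ| ≤ w} with hB
  have hBm : MeasurableSet B := measurableSet_le
    (((Finset.measurable_sum _ fun e _ => hL.comp (measurable_pi_apply e)).sub
      measurable_const).abs) measurable_const
  have h1 := exp_mul_tiltPi_le hL h.integrable_exp t' (indic (edges C)) hBm
    (M * (τ * θ - (t * θ - logMgf P Q t)) - w) (by
      intro x hx
      have e1 : ∑ e, (indic (edges C) e - t' e) * llr P Q (x e) =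
          (τ - t) * ∑ e ∈ E, llr P Q (x e) := by
        rw [Finset.mul_sum, ← Finset.sum_subset (Finset.subset_univ E)]
        · exact Finset.sum_congr rfl fun e he => by simp [ht', he, hE e he]
        · intro e _ he; simp [ht', he]
      have e2 : ∑ e, (cgf (llr P Q) Q (indic (edges C) e) - cgf (llr P Q) Q (t' e)) =
          M * (0 - logMgf P Q t) := by
        rw [hM, ← nsmul_eq_mul, ← Finset.sum_const, ← Finset.sum_subset (Finset.subset_univ E)]
        · exact Finset.sum_congr rfl fun e he => by simp [ht', he, hE e he, ← hτ0]
        · intro e _ he; simp [ht', he]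
      rw [e1, e2]
      have hx : |∑ e ∈ E, llr P Q (x e) - M * θ| ≤ w := hx
      have e3 : |(τ - t) * (∑ e ∈ E, llr P Q (x e) - M * θ)| ≤ w := by
        rw [abs_mul]
        refine le_trans (mul_le_of_le_one_left (abs_nonneg _) ?_) hx
        rw [abs_le]
        constructor <;> linarith [hτ.1, hτ.2, ht.1, ht.2]
      have e4 := (abs_le.mp e3).1
      linarith)
  refine le_trans ?_ h1
  rw [mul_comm]
  refine mul_le_mul_of_nonneg_left ?_ (Real.exp_pos _).le
  set u := η / (2 * c 1) with hu
  have hu0 : 0 < u := by positivity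
  have hu1 : u ≤ 1 := by rw [hu, div_le_one (by positivity)]; linarith
  have htail : ∀ v : ℝ, |v| = u → (tiltPi Q (llr P Q) t').real
      {x | v * (M * θ) + u * w ≤ v * ∑ e ∈ E, llr P Q (x e)} ≤ 1 / 8 := by
    intro v hv
    have e1 := tiltPi_real_sum_le_exp hL h.integrable_exp t' E t (fun e he => if_pos he) v
      (v * (M * θ) + u * w)
    refine e1.trans ?_
    have e2 := h.logMgf_add_le t ht 1 v (hv.trans_le hu1)
    rw [hθ, ← sq_abs v, hv] at e2
    have e3 : M * (logMgf P Q (t + v) - logMgf P Q t) ≤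
        M * (v * θ + c 1 * kl P Q * u ^ 2) :=
      mul_le_mul_of_nonneg_left (by linarith) (Nat.cast_nonneg _)
    have e4 : M * (v * θ + c 1 * kl P Q * u ^ 2) - (v * (M * θ) + u * w) =
        -(M * kl P Q * (η ^ 2 / (4 * c 1))) := by
      rw [hw, hu]; field_simp; ring
    calc _ ≤ Real.exp (-7) := Real.exp_le_exp.mpr (by
          change M * (logMgf P Q (t + v) - logMgf P Q t) - (v * (M * θ) + u * w) ≤ -7
          linarith)
      _ ≤ 1 / (1 + 7) := exp_neg_le_one_div (by norm_num)
      _ = 1 / 8 := by norm_num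
  have h2 : Bᶜ ⊆ {x | u * (M * θ) + u * w ≤ u * ∑ e ∈ E, llr P Q (x e)} ∪
      {x | -u * (M * θ) + u * w ≤ -u * ∑ e ∈ E, llr P Q (x e)} := by
    intro x hx
    have hx : ¬ |∑ e ∈ E, llr P Q (x e) - M * θ| ≤ w := hx
    rw [not_le, lt_abs] at hx
    rcases hx with hx | hx
    · left
      have := mul_le_mul_of_nonneg_left hx.le hu0.le
      rw [Set.mem_ofPred_eq]
      linarith
    · right
      have := mul_le_mul_of_nonneg_left hx.le hu0.le
      rw [Set.mem_ofPred_eq]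
      linarith
  have h3 := (measureReal_mono (μ := tiltPi Q (llr P Q) t') h2 (measure_ne_top _ _)).trans
    (measureReal_union_le _ _)
  have h4 := htail u (abs_of_pos hu0)
  have h5 := htail (-u) (by rw [abs_neg, abs_of_pos hu0])
  rw [probReal_compl_eq_one_sub hBm] at h3
  linarith

end SwapLowerBound

section ExactNecessary

variable {K : ℕ → ℕ} {P Q : ℕ → Measure ℝ} {c : ℝ → ℝ} {κ : ℝ}

/-- Below the voting threshold a swap increases the score with probability at least `1 / 2`. -/
lemma half_le_law_real_swapEvent_of_rate {n K : ℕ} {P Q : Measure ℝ} {c : ℝ → ℝ}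
    {κ κ' δ η : ℝ} (h : RegularPair P Q c) (hK2 : 2 ≤ K) (hKκ : (K : ℝ) ≤ κ * n) (hκ : κ < 1)
    (hδ0 : 0 < δ) (hδ1 : δ ≤ 1 / 2) (hη0 : 0 < η) (hηδ : η * (16 * c 1) = δ)
    (hκ'0 : 0 < κ') (hκ'η : κ' * (16 * swapConst c) = η)
    (hinfo : 3 / 2 * Real.log (n / K) ≤ ((K : ℝ) - 1) * kl P Q)
    (hKDη : 24 ≤ K * kl P Q * η)
    (hKDη' : 14 ≤ K * kl P Q * ((η / 4) ^ 2 / (4 * c 1)))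
    (hlogn : Real.log (1 / κ') ≤ Real.log n * δ)
    (hexp : 7 ≤ Real.exp (δ / 2 * Real.log n) * (3 / 4 * κ'))
    (hexp' : 7 ≤ Real.exp (δ / 2 * Real.log n) * (3 / 4 * (1 - κ)))
    (hrate : ∀ t, K * (t * (1 / (K : ℝ) * Real.log ((n : ℝ) / (K : ℝ))) - logMgf P Q t) ≤
      (1 - δ) * Real.log n) {C : Finset (Fin n)} (hC : C.card = K) :
    1 / 2 ≤ (law P Q C).real (swapEvent (llr P Q) C) := by
  have hKn := SizeBound.le_of_le hκ hKκ
  have hc1 := h.one_le 1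
  set sc := swapConst c with hsc
  have hsc1 : 1 ≤ sc := by
    have := h.one_le 2
    rw [hsc, swapConst]; linarith
  have hη1 : η ≤ 1 / 32 := by nlinarith
  have hηδ' : η ≤ δ := by nlinarith
  have hκ'1 : κ' * 16 ≤ η := by nlinarith
  have hκ1 : 0 < 1 - κ := by linarith
  have hlog : 0 ≤ Real.log ((n : ℝ) / K) := Real.log_nonneg
    ((one_le_div (by exact_mod_cast (by omega : 0 < K))).mpr (by exact_mod_cast hKn))
  have hn : (0 : ℝ) < n := by exact_mod_cast (by omega : 0 < n)
  have hK : (2 : ℝ) ≤ K := by exact_mod_cast hK2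
  have hD := h.kl_pos
  set D := kl P Q with hDdef
  set k : ℝ := (K : ℝ) with hk
  set ℓ := Real.log ((n : ℝ) / k) with hℓ
  set Λ := Real.log n with hΛdef
  set θ := 1 / k * ℓ with hθ
  have hkθ : k * θ = ℓ := by rw [hθ]; field_simp
  have hθ0 : 0 ≤ θ := by positivity
  have hΛ0 : 0 ≤ Λ := Real.log_nonneg (by exact_mod_cast (by omega : 1 ≤ n))
  have hlogk : Real.log k = Λ - ℓ := by
    rw [hℓ, Real.log_div hn.ne' (by linarith)]; ring
  -- At `t = 1` the rate is `log (n / K)` itself; hence `K` is at least `n ^ δ`, which leaves room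
  -- for `I`.
  have hℓΛ : ℓ ≤ (1 - δ) * Λ := by
    have := hrate 1
    rw [h.logMgf_one] at this
    linarith
  have hKDΛ : k * D ≤ 4 * c 1 * Λ := by
    obtain ⟨t, ht, ht'⟩ := h.exists_logMgf_le
    have e1 := hrate t
    have e2 : k * (D / (4 * c 1)) ≤ (1 - δ) * Λ := by
      refine le_trans (mul_le_mul_of_nonneg_left ?_ (by linarith)) e1
      have := mul_nonneg ht.1 hθ0
      linarith
    have e3 : k * (D / (4 * c 1)) ≤ Λ := by linarith [mul_nonneg hδ0.le hΛ0]
    calc k * D = 4 * c 1 * (k * (D / (4 * c 1))) := by field_simp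
      _ ≤ _ := mul_le_mul_of_nonneg_left e3 (by positivity)
  have hθD : 3 / 2 * θ ≤ D := by
    have e1 : k * (3 / 2 * θ) ≤ k * D := by linarith
    exact le_of_mul_le_mul_left e1 (by linarith)
  have hκ'k : 1 ≤ κ' * k := by
    have e1 : Real.log (1 / κ') ≤ Real.log k := by rw [hlogk]; linarith
    rw [Real.log_le_log_iff (by positivity) (by linarith), div_le_iff₀ hκ'0] at e1
    linarith
  set m := ⌈κ' * k⌉₊ with hm
  have hm1 : κ' * k ≤ m := Nat.le_ceil _
  have hm2 : (m : ℝ) ≤ 2 * κ' * k := by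
    have := Nat.ceil_lt_add_one (by positivity : 0 ≤ κ' * k)
    linarith
  have hmk : m ≤ C.card := by
    rw [hC]
    have e1 : 2 * κ' * k ≤ 1 * k := mul_le_mul_of_nonneg_right (by linarith) (by linarith)
    have : (m : ℝ) ≤ K := by linarith
    exact_mod_cast this
  obtain ⟨I, hI, hIm⟩ := Finset.exists_subset_card_eq hmk
  set M : ℝ := ((C \ I).card : ℝ) with hM
  have hMk : M = k - m := by rw [hM, Finset.cast_card_sdiff hI, hC, hIm]
  have hM1 : (1 - 2 * κ') * k ≤ M := by linarith
  have hM2 : k / 2 ≤ M := by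
    have := mul_le_mul_of_nonneg_right hκ'1 (by linarith : (0 : ℝ) ≤ k)
    have := mul_le_mul_of_nonneg_right hη1 (by linarith : (0 : ℝ) ≤ k)
    linarith
  have hM3 : M ≤ k := by rw [hMk]; linarith [(Nat.cast_nonneg m : (0 : ℝ) ≤ m)]
  have hMD1 : k * D / 2 ≤ M * D := by
    have := mul_le_mul_of_nonneg_right hM2 hD.le
    linarith
  have hMD2 : M * D ≤ k * D := mul_le_mul_of_nonneg_right hM3 hD.le
  have hηMD : η * (M * D) ≤ δ / 4 * Λ := by
    have e1 := mul_le_mul_of_nonneg_left (hMD2.trans hKDΛ) hη0.le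
    have e2 : η * (4 * c 1 * Λ) = δ / 4 * Λ := by rw [← hηδ]; ring
    linarith
  -- Members of `I` are tilted down to mean `θ` per pair and outsiders up to `θ + η D`.
  obtain ⟨t₁, ht₁, hdt₁⟩ := h.exists_deriv_logMgf_eq hθ0 (by linarith : θ ≤ D)
  obtain ⟨t₂, ht₂, hdt₂⟩ := h.exists_deriv_logMgf_eq
    (by positivity : 0 ≤ θ + η * D) (by
      have := mul_le_mul_of_nonneg_right hη1 hD.le
      linarith : θ + η * D ≤ D)
  have hr₁ : ∀ t ∈ Set.Icc (0 : ℝ) 1, M * (t * θ - logMgf P Q t) ≤ (1 - δ) * Λ := by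
    intro t ht
    refine le_trans (mul_le_mul_of_nonneg_right hM3 ?_) (hrate t)
    have e1 := h.logMgf_nonpos ht
    have e2 := mul_nonneg ht.1 hθ0
    linarith
  have hconc : 7 ≤ M * D * ((η / 4) ^ 2 / (4 * c 1)) := by
    have := mul_le_mul_of_nonneg_right hMD1 (by positivity : 0 ≤ (η / 4) ^ 2 / (4 * c 1))
    linarith
  have hcard : ∀ v ∉ C \ I, ((cross {v} (C \ I)).card : ℝ) = M := by
    intro v hv
    rw [card_cross (by simpa using hv), Finset.card_singleton, one_mul]
  -- With windows of half-width `η M D / 4` around `M θ` and `M (θ + η D)`, the ends facing each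
  -- other are `α` and `α + s`.
  refine half_le_law_real_swapEvent h hI (α := M * θ + η / 4 * (M * D))
    (s := η / 2 * (M * D))
    (p := 3 / 4 * Real.exp (M * (1 * θ - (t₁ * θ - logMgf P Q t₁)) - η / 4 * (M * D)))
    (q := 3 / 4 * Real.exp (M * (0 * (θ + η * D) -
      (t₂ * (θ + η * D) - logMgf P Q t₂)) - η / 4 * (M * D))) ?_ ?_ ?_ ?_ ?_
  · rw [hIm]
    have e1 : (m : ℝ) * (sc * D) ≤ 2 * κ' * k * (sc * D) :=
      mul_le_mul_of_nonneg_right hm2 (by positivity)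
    have e2 : 2 * κ' * k * (sc * D) = η * (k * D) / 8 := by rw [← hκ'η]; ring
    have e3 := mul_le_mul_of_nonneg_left hMD1 hη0.le
    linarith
  · intro i hi
    have hiM : i ∉ C \ I := fun hi' => (Finset.mem_sdiff.mp hi').2 hi
    have hw := le_law_real_window h (C := C) (E := cross {i} (C \ I)) (τ := 1) (t := t₁)
      (θ := θ) (η := η / 4) (fun e he => if_pos (by
        simp only [mem_cross, Finset.mem_singleton, Finset.mem_sdiff] at he
        rw [mem_edges]
        rcases he with ⟨he, he'⟩ | ⟨he, he'⟩
        · exact ⟨he ▸ hI hi, he'.1⟩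
        · exact ⟨he.1, he' ▸ hI hi⟩)) (by simp) h.logMgf_one ht₁ hdt₁ (by positivity)
      (by linarith) (by rw [hcard i hiM]; exact hconc)
    rw [hcard i hiM] at hw
    have := isProbabilityMeasure_law h C
    refine hw.trans (measureReal_mono fun x hx => ?_)
    rw [Set.mem_ofPred_eq] at hx ⊢
    have hx := (abs_le.mp hx).2
    linarith
  · intro j hj
    rw [Finset.mem_compl] at hj
    have hjM : j ∉ C \ I := fun hj' => hj (Finset.mem_sdiff.mp hj').1
    have hw := le_law_real_window h (C := C) (E := cross {j} (C \ I)) (τ := 0) (t := t₂)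
      (θ := θ + η * D) (η := η / 4) (fun e he => if_neg (by
        simp only [mem_cross, Finset.mem_singleton, Finset.mem_sdiff] at he
        rw [mem_edges]
        rintro ⟨he1, he2⟩
        rcases he with ⟨he, _⟩ | ⟨_, he⟩
        · exact hj (he ▸ he1)
        · exact hj (he ▸ he2))) (by simp) h.logMgf_zero ht₂ hdt₂ (by positivity)
      (by linarith) (by rw [hcard j hjM]; exact hconc)
    rw [hcard j hjM] at hw
    have := isProbabilityMeasure_law h C
    refine hw.trans (measureReal_mono fun x hx => ?_)
    rw [Set.mem_ofPred_eq] at hx ⊢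
    have hx := (abs_le.mp hx).1
    linarith
  · rw [hIm]
    set X := M * (1 * θ - (t₁ * θ - logMgf P Q t₁)) - η / 4 * (M * D) with hX
    -- `M θ` is nearly `log n - log k`, so `log k + X` is at least `log n - (1 - δ) log n` up to
    -- small terms: the expected number of weak members grows like a power of `n`.
    have e1 : δ / 2 * Λ ≤ Real.log k + X := by
      have e2 := hr₁ t₁ ht₁
      have e3 := mul_le_mul_of_nonneg_right hM1 hθ0
      have e4 : 2 * κ' * ℓ ≤ δ / 8 * Λ := by
        have : ℓ ≤ Λ := by linarith [mul_nonneg hδ0.le hΛ0]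
        exact mul_le_mul (by linarith) this hlog (by positivity)
      have e5 : (1 - 2 * κ') * k * θ = ℓ - 2 * κ' * ℓ := by rw [mul_assoc, hkθ]; ring
      have e6 : 0 ≤ δ * Λ := by positivity
      rw [hX, hlogk]
      linarith
    have e7 := Real.exp_le_exp.mpr e1
    rw [Real.exp_add, Real.exp_log (by linarith)] at e7
    calc (7 : ℝ) ≤ Real.exp (δ / 2 * Λ) * (3 / 4 * κ') := hexp
      _ ≤ k * Real.exp X * (3 / 4 * κ') := mul_le_mul_of_nonneg_right e7 (by positivity)
      _ = 3 / 4 * Real.exp X * (κ' * k) := by ring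
      _ ≤ _ := mul_le_mul_of_nonneg_left hm1 (by positivity)
  · set Y := M * (0 * (θ + η * D) - (t₂ * (θ + η * D) - logMgf P Q t₂)) -
      η / 4 * (M * D) with hY
    have e1 : δ / 2 * Λ ≤ Λ + Y := by
      have e2 := hr₁ t₂ ht₂
      have e3 : t₂ * (η * (M * D)) ≤ 1 * (η * (M * D)) :=
        mul_le_mul_of_nonneg_right ht₂.2 (by positivity)
      have e6 : 0 ≤ δ * Λ := by positivity
      rw [hY]
      linarith
    have e7 := Real.exp_le_exp.mpr e1
    rw [Real.exp_add, hΛdef, Real.exp_log hn] at e7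
    have e8 : (1 - κ) * n ≤ (Cᶜ.card : ℝ) := by
      rw [Finset.card_compl, Fintype.card_fin, hC,
        Nat.cast_sub (SizeBound.le_of_le hκ hKκ)]
      linarith
    calc (7 : ℝ) ≤ Real.exp (δ / 2 * Λ) * (3 / 4 * (1 - κ)) := hexp'
      _ ≤ n * Real.exp Y * (3 / 4 * (1 - κ)) := mul_le_mul_of_nonneg_right e7 (by positivity)
      _ = 3 / 4 * Real.exp Y * ((1 - κ) * n) := by ring
      _ ≤ _ := mul_le_mul_of_nonneg_left e8 (by positivity)

lemma eventually_half_le_law_real_swapEvent (h : ∀ n, RegularPair (P n) (Q n) c)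
    (hs : SizeBound K κ) (hKD : Tendsto (fun n => (K n : ℝ) * kl (P n) (Q n)) atTop atTop)
    (hinfo : 2 ≤ liminf (infoRatio K P Q) atTop) {δ : ℝ} (hδ0 : 0 < δ) (hδ1 : δ ≤ 1 / 2) :
    ∀ᶠ n in atTop, (∀ t, K n * (t * (1 / (K n : ℝ) * Real.log ((n : ℝ) / (K n : ℝ))) -
        logMgf (P n) (Q n) t) ≤ (1 - δ) * Real.log n) →
      ∀ C : Finset (Fin n), C.card = K n →
        1 / 2 ≤ (law (P n) (Q n) C).real (swapEvent (llr (P n) (Q n)) C) := by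
  -- The value `3 / 2` lies strictly below the limit 2 and leaves room above 1, so that `θ + η D ≤
  -- D` later.
  have hinfo' : ((3 / 2 : ℝ) : EReal) < liminf (infoRatio K P Q) atTop :=
    lt_of_lt_of_le (EReal.coe_lt_coe_iff.mpr (by norm_num : (3 / 2 : ℝ) < (2 : ℝ))) hinfo
  obtain ⟨r, hr, hinf⟩ := exists_info_bound hs hinfo'
  have hc1 := (h 0).one_le 1
  have hsc := (h 0).swapConst_pos
  have hη : 0 < δ / (16 * c 1) := by positivity
  have hκ' : 0 < δ / (16 * c 1) / (16 * swapConst c) := by positivity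
  have hκ1 : 0 < 1 - κ := by linarith [hs.lt_one]
  have hΛ : Tendsto (fun n : ℕ => Real.log n) atTop atTop :=
    Real.tendsto_log_atTop.comp tendsto_natCast_atTop_atTop
  have hexp : Tendsto (fun n : ℕ => Real.exp (δ / 2 * Real.log n)) atTop atTop :=
    Real.tendsto_exp_atTop.comp (hΛ.const_mul_atTop (by positivity))
  filter_upwards [hinf, hs.eventually,
    (hKD.atTop_mul_const hη).eventually_ge_atTop 24,
    (hKD.atTop_mul_const (by positivity : 0 < (δ / (16 * c 1) / 4) ^ 2 /
      (4 * c 1))).eventually_ge_atTop 14,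
    (hΛ.atTop_mul_const hδ0).eventually_ge_atTop
      (Real.log (1 / (δ / (16 * c 1) / (16 * swapConst c)))),
    (hexp.atTop_mul_const (by positivity :
      0 < 3 / 4 * (δ / (16 * c 1) / (16 * swapConst c)))).eventually_ge_atTop 7,
    (hexp.atTop_mul_const (by positivity : 0 < 3 / 4 * (1 - κ))).eventually_ge_atTop 7] with
    n a1 ⟨a2, a3, _⟩ a5 a6 a7 a8 a9 hrate C hC
  have hlog := hs.log_pos.le.trans (SizeBound.log_div_ge hs.pos a2 a3)
  exact half_le_law_real_swapEvent_of_rate (h n) a2 a3 hs.lt_one hδ0 hδ1 hη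
    (div_mul_cancel₀ _ (by positivity)) hκ' (div_mul_cancel₀ _ (by positivity))
    ((mul_le_mul_of_nonneg_right hr.le hlog).trans a1) a5 a6 a7 a8 a9 hrate hC

lemma one_le_liminf_of_recovery (h : ∀ n, RegularPair (P n) (Q n) c) (hs : SizeBound K κ)
    (hrec : ExactRecoveryPossible K P Q) : 1 ≤ liminf (votingRatio K P Q) atTop := by
  have hKD := tendsto_mul_kl_of_recovery h hs hrec.almostExact
  have hinfo := two_le_liminf_of_recovery h hs hrec.almostExact
  obtain ⟨est, hmeas, hest⟩ := hrec
  by_contra! hlt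
  obtain ⟨r, hr, hr1⟩ := EReal.lt_iff_exists_real_btwn.mp hlt
  have hr1 : r < 1 := EReal.coe_lt_coe_iff.mp hr1
  -- The voting ratio is below `r` only for infinitely many `n`; one such `n` past all other
  -- thresholds suffices. There the average swap probability is at least 1/2, yet at most twice the
  -- error 1/8.
  have hfreq := frequently_lt_of_liminf_lt (by isBoundedDefault) hr
  set δ := min (1 - r) (1 / 2) with hδ
  have hδ0 : 0 < δ := lt_min (by linarith) (by norm_num)
  have hp := (tendsto_jointLaw_iff h _).mp hest
  obtain ⟨n, h1, h2, ⟨h3, h4, h5⟩, h6⟩ := (hfreq.and_eventually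
    ((eventually_half_le_law_real_swapEvent h hs hKD hinfo hδ0 (min_le_right _ _)).and
      (hs.eventually.and (hp.eventually_le_const (by norm_num : (0 : ℝ) < 1 / 8))))).exists
  have hn0 : 0 < Real.log n := Real.log_pos (by exact_mod_cast (by omega : 1 < n))
  have hKn := SizeBound.le_of_le hs.lt_one h4
  have h7 := h2 fun t => (le_of_votingRatio_lt hn0 h1 t).trans
    (mul_le_mul_of_nonneg_right (by linarith [min_le_left (1 - r) (1 / 2)]) hn0.le)
  have hN : (0 : ℝ) < (communities n (K n)).card := by
    rw [card_communities]; exact_mod_cast Nat.choose_pos hKn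
  rw [jointLaw_real_est (h n) (K n) (hmeas n) fun ξ ζ => ξ ≠ ζ, div_le_iff₀ hN] at h6
  have h8 := sum_law_swapEvent_le (K := K n) (h n) (hmeas n)
  have h9 := Finset.card_nsmul_le_sum (communities n (K n)) (fun ξ =>
    (law (P n) (Q n) (supp ξ)).real (swapEvent (llr (P n) (Q n)) (supp ξ))) (1 / 2)
    fun ξ hξ => h7 (supp ξ) (mem_communities.mp hξ)
  rw [nsmul_eq_mul] at h9
  linarith

end ExactNecessary

end SingleCommunity

theorem mainTheorem2 (K : ℕ → ℕ) (P Q : ℕ → Measure ℝ)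
    (hK : ∀ᶠ n in atTop, 2 ≤ K n)
    (hKn : ∃ c : ℝ, c < 1 ∧ ∀ᶠ n in atTop, (K n : ℝ) / (n : ℝ) ≤ c)
    (hPQ : GaussianCase P Q ∨ BernoulliCase P Q) :
    (Tendsto (fun n => (K n : ℝ) * kl (P n) (Q n)) atTop atTop →
      2 < liminf (infoRatio K P Q) atTop →
        AlmostExactRecoveryPossible K P Q) ∧
    (Tendsto (fun n => (K n : ℝ) * kl (P n) (Q n)) atTop atTop →
      2 < liminf (infoRatio K P Q) atTop →
      1 < liminf (votingRatio K P Q) atTop →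
        ExactRecoveryPossible K P Q) ∧
    (AlmostExactRecoveryPossible K P Q →
      Tendsto (fun n => (K n : ℝ) * kl (P n) (Q n)) atTop atTop ∧
      2 ≤ liminf (infoRatio K P Q) atTop) ∧
    (ExactRecoveryPossible K P Q →
      Tendsto (fun n => (K n : ℝ) * kl (P n) (Q n)) atTop atTop ∧
      2 ≤ liminf (infoRatio K P Q) atTop ∧
      1 ≤ liminf (votingRatio K P Q) atTop) := by
  obtain ⟨c, h⟩ := exists_regularPair hPQ
  obtain ⟨κ, hs⟩ := exists_sizeBound hK hKn
  refine ⟨almostExactRecoveryPossible h hs, exactRecoveryPossible h hs, fun hrec =>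
    ⟨tendsto_mul_kl_of_recovery h hs hrec, two_le_liminf_of_recovery h hs hrec⟩, fun hrec => ?_⟩
  exact ⟨tendsto_mul_kl_of_recovery h hs hrec.almostExact,
    two_le_liminf_of_recovery h hs hrec.almostExact, one_le_liminf_of_recovery h hs hrec⟩
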